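/- **Setting.** Let $d\ge 2$ and let $M$ be a smooth connected $d$-manifold (Hausdorff, second countable) with boundary. Let $D\subseteq\partial M$ be an embedded codimension-zero disc with centre $*$, identified with the cube $[-1,1]^{d-1}$ by a parametrisation that extends to an open embedding $\mathbb{R}^{d-1}\hookrightarrow\partial M$. Put $\hat M=M\cup_D(D\times[0,\infty))$, where $D\subseteq \partial M$ is identified with $D\times\{0\}$, and $\hat M_t=M\cup_D (D\times[0,t])$; put $p_r=(*,r-\tfrac12)$. Let $\xi\colon E\to M$ be a fibre bundle with fibre $X$, with $x_0\in X$ and a trivialisation $\theta\colon\xi|_D\cong D\times X$. Extend $\xi$ trivially, using $\theta$, to a bundle $\hat\xi$ over $\hat M$. **Charges.** A local section of $\xi$ near a point $p$ of the interior of $M$ is a pair $(B,\sigma)$ of an embedded closed $d$-ball $B$ in the interior of $M$ with $p\in\mathrm{int}(B)$ and a section $\sigma$ of $\xi|_{\partial B}$. Let $\Sigma(\xi)$ be the space of pairs $(p,[B,\sigma]_p)$ of a point $p$ and a class of local sections near $p$, for the equivalence relation generated by $(B,\sigma)\sim(B',\sigma')$ if $B\subseteq\mathrm{int}(B')$ and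 $\sigma\sqcup\sigma'$ extends to a section over $B'\smallsetminus\mathrm{int}(B)$; its topology has as basis the sets $\{(q,[B,\sigma]_q)\mid q\in\mathrm{int}(B)\}$. Let $c\subseteq\pi_0(\Sigma(\xi))$, let $\hat c\subseteq\pi_0(\Sigma(\hat\xi))$ be its image, and let $c_D\subseteq[S^{d-1},X]$ be the set of classes that give an element of $\hat c$ over a standard round sphere in $D\times(0,\infty)$. **Spaces.** Let $\dot C_k(M)$ be the space of pairs $(z,t)$ with $t\ge 0$ and $z$ a configuration of $k$ points in the interior of $\hat M_t$. Let $C\dot\Gamma_k$ be the space of triples $(z,s,t)$ with $(z,t)\in\dot C_k(M)$ and $s$ a section of $\hat\xi$ over $\hat M\smallsetminus z$ (in the compact-open topology, with $z$ varying) whose charge at each point of $z$, i.e. the component of $(p,[B,s|_{\partial B}]_p)$ for a ball $B$ around $p$ with $B\cap z=\{p\}$, lies in $\hat c$, and which is constant at $x_0$ on $D\times[t,\infty)$. Let $\dot C(M)=\bigsqcup_k\dot C_k(M)$ and $C\dot\Gamma=\bigsqcup_k C\dot\Gamma_k$, let $(z_k,k)$ with $z_k=\{p_1,\dots,p_k\}$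 be the base point of $\dot C_k(M)$, and let $\Gamma_k$ be the fibre of $C\dot\Gamma\to\dot C(M)$, $(z,s,t)\mapsto(z,t)$, over $(z_k,k)$. **Categories.** Let $\mathrm{Br}(M)$ be the full subgroupoid of the fundamental groupoid of $\dot C(M)$ on the base points, with objects $k\in\mathbb{N}$, and let $\mathcal B=\bigsqcup_\ell B_\ell$ be the monoidal braid groupoid of configurations in rectangles $(-1,1)\times(0,u)$, which acts on $\mathrm{Br}(M)$ by attaching a rectangle to $\hat M_t$ in the slice $(-1,1)\times\{0\}^{d-2}\times(t,t+u)$ of the cylinder, so that $\ell\oplus k=k+\ell$. The category $\mathcal C(M)=\langle\mathcal B,\mathrm{Br}(M)\rangle$ has the objects of $\mathrm{Br}(M)$; a morphism $k\to l$ is a class of pairs $(b,\varphi\colon b\oplus k\to l)$ under the equivalence relation generated by $(b_1,\varphi_1)\sim(b_2,\varphi_2)$ if $\varphi_1=\varphi_2\circ(\vartheta\oplus\mathrm{id})$ for some $\vartheta\colon b_1\to b_2$. There is a canonical functor $\mathrm{Br}(M)\to\mathcal C(M)$. Let $\iota_k\colon k\to k+1$ be the class of $(1,\mathrm{id}_{1\oplus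 k})$. Let $\mathrm{Ho}(\mathrm{Top})$ be the category of spaces and homotopy classes of continuous maps. **Stabilisation.** Choose $0<r\le\frac12$ and a map $f\colon D^d\smallsetminus\{0\}\to X$ whose restriction to $S^{d-1}$ has class in $c_D$ and which is $x_0$ on the southern hemisphere $\{x_d\le0\}$ of $S^{d-1}$. In $D\times[0,\infty)$ call the last coordinate of $D=[-1,1]^{d-1}$ vertical. The stabilisation map sends $(z,s,t)$ to $(z\sqcup\{p_{t+1}\},s',t+1)$, where $s'=s$ on $\hat M_t\smallsetminus z$ and where $s'$ on $D\times[t,\infty)\smallsetminus\{p_{t+1}\}$ corresponds, under the trivialisation of $\hat\xi$, to $f$ rescaled to the ball of radius $r$ around $p_{t+1}$, extended independently of the vertical coordinate above the ball, and by $x_0$ elsewhere. **Proposition.** The forgetful map $C\dot\Gamma\to\dot C(M)$ is a Hurewicz fibration, so that its monodromy defines a functor $\mathrm{Mon}^{c,D}(M,\xi)\colon\mathrm{Br}(M)\to\mathrm{Ho}(\mathrm{Top})$, $k\mapsto\Gamma_k$. The stabilisation map is a well-defined continuous map $C\dot\Gamma\to C\dot\Gamma$ covering $(z,t)\mapsto(z\sqcup\{p_{t+1}\},t+1)$,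 and hence restricts to maps $s_k\colon\Gamma_k\to\Gamma_{k+1}$. There is a unique functor $\mathcal C(M)\to\mathrm{Ho}(\mathrm{Top})$ whose composition with $\mathrm{Br}(M)\to\mathcal C(M)$ is $\mathrm{Mon}^{c,D}(M,\xi)$ and which sends $\iota_k$ to the homotopy class of $s_k$ for every $k\ge0$. This includes the case $d=2$. -/

import Mathlib

open CategoryTheory Topology
open scoped ContDiff MonoidalCategory NNReal
universe u v w

namespace ConfSec

/-! ### The homotopy category of spaces -/

/-- Homotopy of continuous maps, as a relation on the morphisms of `TopCat`. -/
def homotopyRel : HomRel TopCat.{u} := fun _ _ f g => f.hom.Homotopic g.hom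

instance : Congruence homotopyRel.{u} where
  equivalence := ⟨fun f => .refl f.hom, fun h => h.symm, fun h h' => h.trans h'⟩
  comp_left f _ _ h := ContinuousMap.Homotopic.comp h (.refl f.hom)
  comp_right g h := ContinuousMap.Homotopic.comp (.refl g.hom) h

/-- The homotopy category `Ho(Top)`: spaces and homotopy classes of continuous maps. -/
abbrev HoTop := CategoryTheory.Quotient homotopyRel.{u}

/-- A space as an object of `Ho(Top)`. -/
def HoTop.of (A : Type u) [TopologicalSpace A] : HoTop.{u} := ⟨TopCat.of A⟩

/-- The homotopy class of a continuous map, as a morphism of `Ho(Top)`. -/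
def HoTop.mk {A B : Type u} [TopologicalSpace A] [TopologicalSpace B] (f : C(A, B)) :
    HoTop.of A ⟶ HoTop.of B :=
  (Quotient.functor homotopyRel).map (X := TopCat.of A) (Y := TopCat.of B) (TopCat.ofHom f)

theorem HoTop.mk_eq_iff {A B : Type u} [TopologicalSpace A] [TopologicalSpace B] (f g : C(A, B)) :
    HoTop.mk f = HoTop.mk g ↔ f.Homotopic g :=
  Quotient.functor_map_eq_iff homotopyRel (X := TopCat.of A) (Y := TopCat.of B)
    (TopCat.ofHom f) (TopCat.ofHom g)

theorem HoTop.mk_id {A : Type u} [TopologicalSpace A] :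
    HoTop.mk (ContinuousMap.id A) = 𝟙 (HoTop.of A) :=
  (Quotient.functor homotopyRel).map_id (TopCat.of A)

theorem HoTop.mk_comp {A B D : Type u} [TopologicalSpace A] [TopologicalSpace B]
    [TopologicalSpace D] (f : C(A, B)) (g : C(B, D)) :
    HoTop.mk (g.comp f) = HoTop.mk f ≫ HoTop.mk g :=
  (Quotient.functor homotopyRel).map_comp (X := TopCat.of A) (Y := TopCat.of B)
    (Z := TopCat.of D) (TopCat.ofHom f) (TopCat.ofHom g)

/-! ### Hurewicz fibrations and their monodromy -/

section Monodromy

open scoped unitInterval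

variable {T : Type u} {B : Type v} [TopologicalSpace T] [TopologicalSpace B]

/-- A continuous map is a Hurewicz fibration if it has the homotopy lifting property for all
spaces. (Test spaces in the universe of the total space and the base suffice.) -/
def IsHurewiczFibration (p : C(T, B)) : Prop :=
  ∀ (A : Type (max u v)) [TopologicalSpace A] (H : C(A × I, B)) (f : C(A, T)),
    (∀ a, p (f a) = H (a, 0)) →
      ∃ G : C(A × I, T), (∀ a, G (a, 0) = f a) ∧ ∀ x, p (G x) = H x

/-- The fibre of `p` over `b`. -/
def Fibre (p : C(T, B)) (b : B) : Type u := {x : T // p x = b}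

instance (p : C(T, B)) (b : B) : TopologicalSpace (Fibre p b) :=
  inferInstanceAs (TopologicalSpace {x : T // p x = b})

/-- `φ` is the end of a lift of the path `γ` to a homotopy of the fibre over its starting point. -/
def IsTransport (p : C(T, B)) {b b' : B} (γ : Path b b') (φ : C(Fibre p b, Fibre p b')) : Prop :=
  ∃ g : C(Fibre p b × I, T), (∀ x, g (x, 0) = x.1) ∧ (∀ x s, p (g (x, s)) = γ s) ∧
    ∀ x, g (x, 1) = (φ x).1

/-- Homotopy lifting for test spaces in the universe of the total space. -/
theorem IsHurewiczFibration.lift {p : C(T, B)} (hp : IsHurewiczFibration p) (A : Type u)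
    [TopologicalSpace A] (H : C(A × I, B)) (f : C(A, T)) (h : ∀ a, p (f a) = H (a, 0)) :
    ∃ G : C(A × I, T), (∀ a, G (a, 0) = f a) ∧ ∀ x, p (G x) = H x := by
  obtain ⟨G, h0, h1⟩ := hp (ULift.{v} A) (H.comp ⟨fun x => (x.1.down, x.2), by fun_prop⟩)
    (f.comp ⟨ULift.down, continuous_uliftDown⟩) (fun a => h a.down)
  exact ⟨G.comp ⟨fun x => (⟨x.1⟩, x.2), by fun_prop⟩, fun a => h0 ⟨a⟩, fun x => h1 (⟨x.1⟩, x.2)⟩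

theorem exists_isTransport {p : C(T, B)} (hp : IsHurewiczFibration p) {b b' : B} (γ : Path b b') :
    ∃ φ, IsTransport p γ φ := by
  obtain ⟨G, h0, h1⟩ := hp.lift (Fibre p b) ⟨fun x => γ x.2, by fun_prop⟩
    ⟨Subtype.val, continuous_subtype_val⟩ (fun a => by change p a.1 = γ 0; rw [γ.source]; exact a.2)
  have h2 : ∀ x : Fibre p b, p (G (x, 1)) = b' := fun x => (h1 (x, 1)).trans γ.target
  exact ⟨⟨fun x => ⟨G (x, 1), h2 x⟩,
    Continuous.subtype_mk (by fun_prop) _⟩, G, h0, fun x s => h1 (x, s), fun x => rfl⟩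

/-- Lifts of homotopic paths have homotopic ends. -/
theorem IsTransport.homotopic {p : C(T, B)} (hp : IsHurewiczFibration p) {b b' : B}
    {γ γ' : Path b b'} (hγ : γ.Homotopic γ') {φ φ' : C(Fibre p b, Fibre p b')}
    (h : IsTransport p γ φ) (h' : IsTransport p γ' φ') : φ.Homotopic φ' := by
  obtain ⟨g, g0, gp, g1⟩ := h
  obtain ⟨g', g0', gp', g1'⟩ := h'
  -- run back along `g`, then forward along `g'`
  have hnull : (γ.symm.trans γ').Homotopic (Path.refl b') :=
    (Path.Homotopic.hcomp (.refl γ.symm) hγ.symm).trans (Path.Homotopic.symm_trans γ)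
  obtain ⟨K⟩ := hnull
  let φT : C(Fibre p b, T) := ⟨fun x => (φ x).1, continuous_subtype_val.comp φ.continuous⟩
  let φT' : C(Fibre p b, T) := ⟨fun x => (φ' x).1, continuous_subtype_val.comp φ'.continuous⟩
  let iT : C(Fibre p b, T) := ⟨fun x => x.1, continuous_subtype_val⟩
  let h1 : ContinuousMap.Homotopy iT φT :=
    { toFun := fun x => g (x.2, x.1), continuous_toFun := by fun_prop
      map_zero_left := fun x => g0 x, map_one_left := fun x => g1 x }
  let h2 : ContinuousMap.Homotopy iT φT' :=
    { toFun := fun x => g' (x.2, x.1), continuous_toFun := by fun_prop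
      map_zero_left := fun x => g0' x, map_one_left := fun x => g1' x }
  let G := h1.symm.trans h2
  have hG : ∀ s x, p (G (s, x)) = (γ.symm.trans γ') s := by
    intro s x
    simp only [G, ContinuousMap.Homotopy.trans_apply, Path.trans_apply]
    split_ifs with hs
    · simp only [ContinuousMap.Homotopy.symm_apply]
      exact gp _ _
    · exact gp' _ _
  obtain ⟨L, L0, L1⟩ := hp.lift (Fibre p b × I)
    ⟨fun x => K (x.2, x.1.2), by fun_prop⟩ ⟨fun x => G (x.2, x.1), by fun_prop⟩
    (fun a => by simp [hG])
  have hL : ∀ x s t, (s = 0 ∨ s = 1 ∨ t = 1) → p (L ((x, s), t)) = b' := by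
    intro x s t hst
    rw [L1]
    rcases hst with rfl | rfl | rfl <;> simp
  let ψ0 : C(Fibre p b, Fibre p b') :=
    ⟨fun x => ⟨L ((x, 0), 1), hL x 0 1 (by simp)⟩, Continuous.subtype_mk (by fun_prop) _⟩
  let ψ1 : C(Fibre p b, Fibre p b') :=
    ⟨fun x => ⟨L ((x, 1), 1), hL x 1 1 (by simp)⟩, Continuous.subtype_mk (by fun_prop) _⟩
  have e1 : φ.Homotopic ψ0 := ⟨
    { toFun := fun q => ⟨L ((q.2, 0), q.1), hL q.2 0 q.1 (by simp)⟩
      continuous_toFun := Continuous.subtype_mk (by fun_prop) _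
      map_zero_left := fun x => Subtype.ext (by
        change L ((x, 0), 0) = _
        rw [L0]; simp [φT])
      map_one_left := fun x => rfl }⟩
  have e2 : ψ0.Homotopic ψ1 := ⟨
    { toFun := fun q => ⟨L ((q.2, q.1), 1), hL q.2 q.1 1 (by simp)⟩
      continuous_toFun := Continuous.subtype_mk (by fun_prop) _
      map_zero_left := fun x => rfl
      map_one_left := fun x => rfl }⟩
  have e3 : φ'.Homotopic ψ1 := ⟨
    { toFun := fun q => ⟨L ((q.2, 1), q.1), hL q.2 1 q.1 (by simp)⟩
      continuous_toFun := Continuous.subtype_mk (by fun_prop) _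
      map_zero_left := fun x => Subtype.ext (by
        change L ((x, 1), 0) = _
        rw [L0]; simp [φT'])
      map_one_left := fun x => rfl }⟩
  exact (e1.trans e2).trans e3.symm

theorem isTransport_refl (p : C(T, B)) (b : B) :
    IsTransport p (Path.refl b) (ContinuousMap.id (Fibre p b)) :=
  ⟨⟨fun x => x.1.1, continuous_subtype_val.comp continuous_fst⟩, fun _ => rfl,
    fun x _ => x.2, fun _ => rfl⟩

theorem IsTransport.trans {p : C(T, B)} {b b' b'' : B} {γ : Path b b'} {γ' : Path b' b''}
    {φ : C(Fibre p b, Fibre p b')} {φ' : C(Fibre p b', Fibre p b'')}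
    (h : IsTransport p γ φ) (h' : IsTransport p γ' φ') :
    IsTransport p (γ.trans γ') (φ'.comp φ) := by
  obtain ⟨g, g0, gp, g1⟩ := h
  obtain ⟨g', g0', gp', g1'⟩ := h'
  let i0 : C(Fibre p b, T) := ⟨fun x => x.1, continuous_subtype_val⟩
  let i1 : C(Fibre p b, T) := ⟨fun x => (φ x).1, continuous_subtype_val.comp φ.continuous⟩
  let i2 : C(Fibre p b, T) := ⟨fun x => (φ' (φ x)).1,
    continuous_subtype_val.comp (φ'.continuous.comp φ.continuous)⟩
  let h1 : ContinuousMap.Homotopy i0 i1 :=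
    { toFun := fun x => g (x.2, x.1), continuous_toFun := by fun_prop
      map_zero_left := fun x => g0 x, map_one_left := fun x => g1 x }
  let h2 : ContinuousMap.Homotopy i1 i2 :=
    { toFun := fun x => g' (φ x.2, x.1), continuous_toFun := by fun_prop
      map_zero_left := fun x => g0' _, map_one_left := fun x => g1' _ }
  refine ⟨⟨fun x => (h1.trans h2) (x.2, x.1), by fun_prop⟩, fun x => ?_, fun x s => ?_,
    fun x => ?_⟩
  · change (h1.trans h2) (0, x) = x.1
    rw [ContinuousMap.Homotopy.apply_zero]; rfl
  · simp only [ContinuousMap.coe_mk, ContinuousMap.Homotopy.trans_apply, Path.trans_apply]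
    split_ifs with hs
    · exact gp _ _
    · exact gp' _ _
  · change (h1.trans h2) (1, x) = _
    rw [ContinuousMap.Homotopy.apply_one]; rfl

/-- The monodromy functor of a Hurewicz fibration: a point of the base goes to the fibre over it,
and the class of a path `γ` goes to the homotopy class of the end of any lift of `γ` to a homotopy
of the fibre. -/
noncomputable def monodromy (p : C(T, B)) (hp : IsHurewiczFibration p) :
    FundamentalGroupoid B ⥤ HoTop.{u} where
  obj b := HoTop.of (Fibre p b.as)
  map {b b'} γ := Quotient.lift
    (fun γ : Path b.as b'.as => HoTop.mk (exists_isTransport hp γ).choose)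
    (fun γ γ' h => (HoTop.mk_eq_iff _ _).2 (IsTransport.homotopic hp h
      (exists_isTransport hp γ).choose_spec (exists_isTransport hp γ').choose_spec)) γ
  map_id b := by
    rw [← HoTop.mk_id]
    exact (HoTop.mk_eq_iff _ _).2 (IsTransport.homotopic hp (.refl _)
      (exists_isTransport hp _).choose_spec (isTransport_refl p b.as))
  map_comp {b b' b''} γ γ' := by
    induction γ using Path.Homotopic.Quotient.ind with | mk γ =>
    induction γ' using Path.Homotopic.Quotient.ind with | mk γ' =>
    change HoTop.mk _ = HoTop.mk _ ≫ HoTop.mk _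
    rw [← HoTop.mk_comp]
    exact (HoTop.mk_eq_iff _ _).2 (IsTransport.homotopic hp (.refl _)
      (exists_isTransport hp _).choose_spec
      ((exists_isTransport hp γ).choose_spec.trans (exists_isTransport hp γ').choose_spec))

end Monodromy

/-! ### The bracket construction -/

section Bracket

open MonoidalCategory
open scoped MonoidalCategory.MonoidalLeftAction

/-- Objects of the bracket category `⟨D, C⟩`: the objects of `C`. -/
structure QBracket (D : Type*) (C : Type*) where
  /-- the underlying object -/
  as : C

variable {D : Type*} [Category D] {C : Type*} [Category C]
  [MonoidalCategory D] [MonoidalLeftAction D C]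

/-- A representative of a morphism of `⟨D, C⟩` from `X` to `Y`. -/
abbrev QBracket.Pre (X Y : QBracket D C) := Σ d : D, (d ⊙ₗ X.as ⟶ Y.as)

/-- The relation `(d, φ) ∼ (d', φ')` if `φ = φ' ∘ (θ ⊕ id)` for some `θ : d ⟶ d'`. -/
def QBracket.Rel {X Y : QBracket D C} (p q : QBracket.Pre X Y) : Prop :=
  ∃ θ : p.1 ⟶ q.1, p.2 = θ ⊵ₗ X.as ≫ q.2

/-- Quillen's bracket construction `⟨D, C⟩`: a morphism from `X` to `Y` is a class of pairs
`(d, φ : d ⊕ X ⟶ Y)` under the equivalence relation generated by `(d, φ) ∼ (d', φ')` if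
`φ = φ' ∘ (θ ⊕ id)` for some `θ : d ⟶ d'`. -/
instance : Category (QBracket D C) where
  Hom X Y := Quot (QBracket.Rel (X := X) (Y := Y))
  id X := Quot.mk _ ⟨𝟙_ D, (λₗ X.as).hom⟩
  comp {X Y Z} f g := Quot.map₂ (r := QBracket.Rel) (s := QBracket.Rel) (t := QBracket.Rel)
    (fun p q => ⟨q.1 ⊗ p.1, (αₗ q.1 p.1 X.as).hom ≫ q.1 ⊴ₗ p.2 ≫ q.2⟩)
    (by
      rintro ⟨d, φ⟩ ⟨e, ψ⟩ ⟨e', ψ'⟩ ⟨(θ : e ⟶ e'), (h : ψ = θ ⊵ₗ Y.as ≫ ψ')⟩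
      refine ⟨θ ▷ d, ?_⟩
      subst h
      simp [MonoidalLeftAction.action_exchange_assoc])
    (by
      rintro ⟨d, φ⟩ ⟨d', φ'⟩ ⟨e, ψ⟩ ⟨(θ : d ⟶ d'), (h : φ = θ ⊵ₗ X.as ≫ φ')⟩
      refine ⟨e ◁ θ, ?_⟩
      subst h
      simp) f g
  id_comp := by
    rintro X Y ⟨d, φ⟩
    exact Quot.sound ⟨(ρ_ d).hom, by simp⟩
  comp_id := by
    rintro X Y ⟨d, φ⟩
    exact Quot.sound ⟨(λ_ d).hom, by simp⟩
  assoc := by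
    rintro W X Y Z ⟨d, φ⟩ ⟨e, ψ⟩ ⟨f, χ⟩
    refine (Quot.sound ⟨(α_ f e d).hom, ?_⟩ : Quot.mk QBracket.Rel _ = Quot.mk _ _).symm
    simp [← MonoidalLeftAction.associator_actionHom_assoc]

/-- The morphism of `⟨D, C⟩` represented by `φ : d ⊕ X ⟶ Y`. -/
def QBracket.homMk {X Y : C} (d : D) (φ : d ⊙ₗ X ⟶ Y) :
    (⟨X⟩ : QBracket D C) ⟶ ⟨Y⟩ :=
  Quot.mk _ ⟨d, φ⟩

variable (D C) in
/-- The canonical functor `C ⥤ ⟨D, C⟩`. -/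
def QBracket.incl : C ⥤ QBracket D C where
  obj X := ⟨X⟩
  map {X Y} φ := QBracket.homMk (𝟙_ D) ((λₗ X).hom ≫ φ)
  map_id X := by simp [QBracket.homMk]; rfl
  map_comp {X Y Z} φ ψ := (Quot.sound ⟨(λ_ (𝟙_ D)).hom, by simp⟩ : Quot.mk _ _ = Quot.mk _ _).symm

end Bracket

/-! ### Fundamental groupoids on sequences of base points -/

noncomputable section Based

/-- Objects of the full subgroupoid of the fundamental groupoid of `Y` on the base points `c k`
(one object for every natural number). -/
structure BasedGpd {Y : Type*} (c : ℕ → Y) where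
  /-- the natural number -/
  idx : ℕ

namespace BasedGpd

variable {Y : Type u} [TopologicalSpace Y] {c : ℕ → Y}

/-- Morphisms from `k` to `l` are homotopy classes of paths from `c k` to `c l`. -/
instance : Groupoid (BasedGpd c) where
  Hom k l := Path.Homotopic.Quotient (c k.idx) (c l.idx)
  id k := .refl (c k.idx)
  comp := Path.Homotopic.Quotient.trans
  id_comp {k l} f := Category.id_comp (X := (⟨c k.idx⟩ : FundamentalGroupoid Y)) (Y := ⟨c l.idx⟩) f
  comp_id {k l} f := Category.comp_id (X := (⟨c k.idx⟩ : FundamentalGroupoid Y)) (Y := ⟨c l.idx⟩) f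
  assoc {j k l m} f g h := Category.assoc (W := (⟨c j.idx⟩ : FundamentalGroupoid Y))
    (X := ⟨c k.idx⟩) (Y := ⟨c l.idx⟩) (Z := ⟨c m.idx⟩) f g h
  inv := .symm
  inv_comp {k l} f := Groupoid.inv_comp (X := (⟨c k.idx⟩ : FundamentalGroupoid Y))
    (Y := ⟨c l.idx⟩) f
  comp_inv {k l} f := Groupoid.comp_inv (X := (⟨c k.idx⟩ : FundamentalGroupoid Y))
    (Y := ⟨c l.idx⟩) f

variable (c) in
/-- The inclusion into the fundamental groupoid. -/
def incl : BasedGpd c ⥤ FundamentalGroupoid Y where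
  obj k := ⟨c k.idx⟩
  map f := f

/-- The morphism represented by a path. -/
def homMk {k l : BasedGpd c} (p : Path (c k.idx) (c l.idx)) : k ⟶ l := Path.Homotopic.Quotient.mk p

theorem mk_surj {k l : BasedGpd c} (f : k ⟶ l) : ∃ p, f = homMk p :=
  ⟨_, (Path.Homotopic.Quotient.mk_surjective f).choose_spec.symm⟩

theorem mk_comp {k l m : BasedGpd c} (p : Path (c k.idx) (c l.idx)) (q : Path (c l.idx) (c m.idx)) :
    homMk p ≫ homMk q = (homMk (p.trans q) : k ⟶ m) := rfl

theorem mk_refl (k : BasedGpd c) : homMk (Path.refl (c k.idx)) = 𝟙 k := rfl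

theorem comm_eqToHom {k l k' l' : BasedGpd c} (p : Path (c k.idx) (c l.idx))
    (q : Path (c k'.idx) (c l'.idx)) (hk : k = k') (hl : l = l') (h : ∀ t, p t = q t) :
    homMk p ≫ eqToHom hl = eqToHom hk ≫ homMk q := by
  subst hk hl
  obtain rfl : p = q := by ext t; exact h t
  simp

end BasedGpd

variable {S : Type v} [TopologicalSpace S] [Monoid S] [ContinuousMul S]
  {Y : Type u} [TopologicalSpace Y] [MulAction S Y] [ContinuousSMul S Y]

/-- The points `b ℓ` of the monoid are multiplicative. -/
class IsMulBase (b : ℕ → S) : Prop where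
  zero : b 0 = 1
  add : ∀ i j, b (j + i) = b i * b j

/-- The points `b ℓ` of the monoid act compatibly on the points `c k` of the space. -/
class IsActBase (b : ℕ → S) (c : ℕ → Y) : Prop where
  add : ∀ i k, c (k + i) = b i • c k

instance (b : ℕ → S) [IsMulBase b] : IsActBase b b := ⟨IsMulBase.add⟩

namespace BasedGpd

variable (b : ℕ → S) (c : ℕ → Y)

variable {b c} in
/-- Acting with a path on a path. -/
def smulPath [IsActBase b c] {i j k l : ℕ} (f : Path (b i) (b j)) (g : Path (c k) (c l)) :
    Path (c (k + i)) (c (l + j)) where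
  toFun t := f t • g t
  continuous_toFun := by fun_prop
  source' := by simp [IsActBase.add (b := b)]
  target' := by simp [IsActBase.add (b := b)]

variable {b c} in
/-- Acting with a homotopy class of paths on a homotopy class of paths. -/
def act [IsActBase b c] {i j : BasedGpd b} {k l : BasedGpd c} (f : i ⟶ j) (g : k ⟶ l) :
    (⟨k.idx + i.idx⟩ : BasedGpd c) ⟶ ⟨l.idx + j.idx⟩ :=
  Quotient.map₂ smulPath (by
    rintro p p' ⟨F⟩ q q' ⟨G⟩
    exact ⟨
      { toFun := fun x => F x • G x
        continuous_toFun := by fun_prop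
        map_zero_left := fun t => by simp [smulPath]
        map_one_left := fun t => by simp [smulPath]
        prop' := fun t x hx => by
          rcases hx with rfl | rfl <;> simp [smulPath] }⟩) f g

section

variable {b c} [IsActBase b c]

theorem act_mk {i j : BasedGpd b} {k l : BasedGpd c} (p : Path (b i.idx) (b j.idx))
    (q : Path (c k.idx) (c l.idx)) : act (homMk p : i ⟶ j) (homMk q : k ⟶ l) = homMk (smulPath p q) := rfl

theorem act_id (i : BasedGpd b) (k : BasedGpd c) : act (𝟙 i) (𝟙 k) = 𝟙 _ := by
  rw [← mk_refl, ← mk_refl, act_mk, ← mk_refl]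
  congr 1
  ext t
  simp [smulPath, IsActBase.add (b := b)]

theorem act_comp {i i' i'' : BasedGpd b} {k k' k'' : BasedGpd c} (f : i ⟶ i') (f' : i' ⟶ i'')
    (g : k ⟶ k') (g' : k' ⟶ k'') : act f g ≫ act f' g' = act (f ≫ f') (g ≫ g') := by
  obtain ⟨f, rfl⟩ := mk_surj f
  obtain ⟨f', rfl⟩ := mk_surj f'
  obtain ⟨g, rfl⟩ := mk_surj g
  obtain ⟨g', rfl⟩ := mk_surj g'
  simp only [act_mk, mk_comp]
  congr 1
  ext t
  simp only [smulPath, Path.trans_apply, Path.coe_mk_mk]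
  split_ifs <;> rfl

theorem act_eqToHom {i j : BasedGpd b} {k l : BasedGpd c} (h : i = j) (h' : k = l) :
    act (eqToHom h) (eqToHom h') = eqToHom (by rw [h, h']) := by
  subst h h'
  simp [act_id]

theorem act_eqToHom_id {i j : BasedGpd b} (k : BasedGpd c) (h : i = j) :
    act (eqToHom h) (𝟙 k) = eqToHom (by rw [h]) := act_eqToHom h rfl

theorem act_id_eqToHom (i : BasedGpd b) {k l : BasedGpd c} (h : k = l) :
    act (𝟙 i) (eqToHom h) = eqToHom (by rw [h]) := act_eqToHom rfl h

variable [IsMulBase b]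

theorem act_assoc {i₁ j₁ i₂ j₂ : BasedGpd b} {k l : BasedGpd c} (f₁ : i₁ ⟶ j₁) (f₂ : i₂ ⟶ j₂)
    (g : k ⟶ l) :
    act (act f₁ f₂) g ≫ eqToHom (congrArg BasedGpd.mk (Nat.add_assoc _ _ _).symm) =
      eqToHom (congrArg BasedGpd.mk (Nat.add_assoc _ _ _).symm) ≫ act f₁ (act f₂ g) := by
  obtain ⟨f₁, rfl⟩ := mk_surj f₁
  obtain ⟨f₂, rfl⟩ := mk_surj f₂
  obtain ⟨g, rfl⟩ := mk_surj g
  simp only [act_mk]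
  exact comm_eqToHom _ _ _ _ fun t => by simp [smulPath, mul_smul]

theorem act_unit {k l : BasedGpd c} (g : k ⟶ l) :
    act (𝟙 (⟨0⟩ : BasedGpd b)) g ≫ eqToHom rfl = eqToHom rfl ≫ g := by
  obtain ⟨g, rfl⟩ := mk_surj g
  rw [← mk_refl, act_mk]
  exact comm_eqToHom _ _ _ _ fun t => by simp [smulPath, IsMulBase.zero (b := b)]

theorem act_unit' {k l : BasedGpd b} (g : k ⟶ l) :
    act g (𝟙 (⟨0⟩ : BasedGpd b)) ≫ eqToHom (congrArg BasedGpd.mk (Nat.zero_add _)) =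
      eqToHom (congrArg BasedGpd.mk (Nat.zero_add _)) ≫ g := by
  obtain ⟨g, rfl⟩ := mk_surj g
  rw [← mk_refl, act_mk]
  exact comm_eqToHom _ _ _ _ fun t => by simp [smulPath, IsMulBase.zero (b := b)]

end

variable [IsMulBase b]

/-- The tensor product `i ⊗ j` is `j + i`; on morphisms it is induced by the multiplication. -/
instance : MonoidalCategoryStruct (BasedGpd b) where
  tensorObj i j := ⟨j.idx + i.idx⟩
  whiskerLeft i _ _ g := act (𝟙 i) g
  whiskerRight f j := act f (𝟙 j)
  tensorHom f g := act f g
  tensorUnit := ⟨0⟩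
  associator _ _ _ := eqToIso (congrArg BasedGpd.mk (Nat.add_assoc _ _ _).symm)
  leftUnitor _ := eqToIso rfl
  rightUnitor _ := eqToIso (congrArg BasedGpd.mk (Nat.zero_add _))

instance : MonoidalCategory (BasedGpd b) := .ofTensorHom
  (id_tensorHom_id := act_id)
  (id_tensorHom := fun _ _ _ _ => rfl)
  (tensorHom_id := fun _ _ => rfl)
  (tensorHom_comp_tensorHom := fun f₁ f₂ g₁ g₂ => act_comp f₁ g₁ f₂ g₂)
  (associator_naturality := act_assoc)
  (leftUnitor_naturality := act_unit)
  (rightUnitor_naturality := act_unit')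
  (pentagon := fun _ _ _ _ => by
    simp only [MonoidalCategoryStruct.associator, MonoidalCategoryStruct.tensorHom, eqToIso.hom,
      act_eqToHom_id, act_id_eqToHom, eqToHom_trans])
  (triangle := fun _ _ => by
    simp only [MonoidalCategoryStruct.associator, MonoidalCategoryStruct.tensorHom, eqToIso.hom,
      MonoidalCategoryStruct.leftUnitor, MonoidalCategoryStruct.rightUnitor,
      act_eqToHom_id, act_id_eqToHom, eqToHom_trans])

variable [IsActBase b c]

/-- The object `i` takes `k` to `k + i`; on morphisms the action is induced by the action of the
monoid on the space. -/
instance : MonoidalCategory.MonoidalLeftAction (BasedGpd b) (BasedGpd c) where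
  actionObj i k := ⟨k.idx + i.idx⟩
  actionHomLeft f k := act f (𝟙 k)
  actionHomRight i _ _ g := act (𝟙 i) g
  actionHom f g := act f g
  actionAssocIso _ _ _ := eqToIso (congrArg BasedGpd.mk (Nat.add_assoc _ _ _).symm)
  actionUnitIso _ := eqToIso rfl
  actionHom_def f g := by rw [act_comp]; simp
  actionHomRight_id := act_id
  id_actionHomLeft := act_id
  actionHom_comp f₁ f₂ g₁ g₂ := (act_comp f₁ f₂ g₁ g₂).symm
  actionAssocIso_hom_naturality := act_assoc
  actionUnitIso_hom_naturality f := (act_unit f).symm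
  whiskerLeft_actionHomLeft i _ _ f k := by
    simp only [eqToIso.hom, eqToIso.inv]
    rw [← reassoc_of% act_assoc]
    simp [MonoidalCategoryStruct.whiskerLeft]
  whiskerRight_actionHomLeft j f k := by
    simp only [eqToIso.hom, eqToIso.inv]
    rw [← act_id, ← reassoc_of% act_assoc]
    simp [MonoidalCategoryStruct.whiskerRight]
  associator_actionHom _ _ _ _ := by
    simp only [MonoidalCategoryStruct.associator, eqToIso.hom,
      act_eqToHom_id, act_id_eqToHom, eqToHom_trans]
  leftUnitor_actionHom _ _ := by
    simp only [MonoidalCategoryStruct.leftUnitor, eqToIso.hom,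
      act_eqToHom_id, act_id_eqToHom, eqToHom_trans]
  rightUnitor_actionHom _ _ := by
    simp only [MonoidalCategoryStruct.rightUnitor, eqToIso.hom,
      act_eqToHom_id, act_id_eqToHom, eqToHom_trans]

end BasedGpd

end Based

/-! ### Spaces of finite configurations -/

section Configurations

variable {Y : Type u}

/-- Finite (unordered) configurations of distinct points of `Y`. -/
@[ext]
structure Cfg (Y : Type u) where
  /-- the set of points -/
  carrier : Set Y
  finite : carrier.Finite

/-- The unordered configuration underlying an ordered one. -/
def Cfg.ofInj (k : ℕ) (f : {f : Fin k → Y // Function.Injective f}) : Cfg Y :=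
  ⟨Set.range f.1, Set.finite_range _⟩

theorem Cfg.exists_ofInj (z : Cfg Y) : ∃ k f, z = Cfg.ofInj k f := by
  have := z.2.to_subtype
  obtain ⟨k, ⟨e⟩⟩ := Finite.exists_equiv_fin z.1
  refine ⟨k, ⟨fun i => (e.symm i).1, Subtype.val_injective.comp e.symm.injective⟩,
    Cfg.ext ?_⟩
  ext y
  constructor
  · intro hy
    exact ⟨e ⟨y, hy⟩, by simp⟩
  · rintro ⟨i, rfl⟩
    exact (e.symm i).2

variable [TopologicalSpace Y]

/-- The topology of the disjoint union, over all `k`, of the quotients of the spaces of ordered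
configurations of `k` points by the symmetric groups. -/
instance : TopologicalSpace (Cfg Y) :=
  ⨆ k, TopologicalSpace.coinduced (Cfg.ofInj k) inferInstance

/-- The empty configuration. -/
def Cfg.empty : Cfg Y := ⟨∅, Set.finite_empty⟩

/-- The union of two configurations. -/
def Cfg.union (z z' : Cfg Y) : Cfg Y := ⟨z.1 ∪ z'.1, z.2.union z'.2⟩

/-- The image of a configuration. -/
def Cfg.map {A : Type v} (g : A → Y) (z : Cfg A) : Cfg Y := ⟨g '' z.1, z.2.image g⟩

theorem Cfg.continuous_ofInj (k : ℕ) : Continuous (Cfg.ofInj k : _ → Cfg Y) :=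
  continuous_iff_coinduced_le.2 (le_iSup (fun k =>
    TopologicalSpace.coinduced (Cfg.ofInj (Y := Y) k) inferInstance) k)

theorem Cfg.isOpenMap_ofInj (k : ℕ) : IsOpenMap (Cfg.ofInj k : _ → Cfg Y) := by
  intro U hU
  refine isOpen_iSup_iff.2 fun l => isOpen_coinduced.2 ?_
  by_cases hkl : l = k
  · subst hkl
    have : Cfg.ofInj l ⁻¹' (Cfg.ofInj l '' U) = ⋃ e : Equiv.Perm (Fin l),
        (fun f : {f : Fin l → Y // Function.Injective f} =>
          (⟨f.1 ∘ e, f.2.comp e.injective⟩ : {f : Fin l → Y // Function.Injective f})) ⁻¹' U := by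
      ext f
      simp only [Set.mem_preimage, Set.mem_image, Set.mem_iUnion]
      constructor
      · rintro ⟨g, hg, hgf⟩
        have hr : Set.range g.1 = Set.range f.1 := congrArg Cfg.carrier hgf
        let e : Equiv.Perm (Fin l) := (Equiv.ofInjective g.1 g.2).trans
          ((Equiv.setCongr hr).trans (Equiv.ofInjective f.1 f.2).symm)
        refine ⟨e, ?_⟩
        convert hg using 1
        refine Subtype.ext (funext fun i => ?_)
        simp [e, Equiv.apply_ofInjective_symm]
      · rintro ⟨e, he⟩
        exact ⟨_, he, Cfg.ext (e.surjective.range_comp f.1)⟩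
    rw [this]
    refine isOpen_iUnion fun e => hU.preimage (Continuous.subtype_mk ?_ _)
    exact continuous_pi fun i => (continuous_apply (e i)).comp continuous_subtype_val
  · convert isOpen_empty
    ext f
    simp only [Set.mem_preimage, Set.mem_image, Set.mem_empty_iff_false, iff_false, not_exists,
      not_and]
    intro g _ hgf
    have hr : Set.range g.1 = Set.range f.1 := congrArg Cfg.carrier hgf
    have h1 := Set.ncard_image_of_injective Set.univ g.2
    have h2 := Set.ncard_image_of_injective Set.univ f.2
    simp only [Set.image_univ, Set.ncard_univ, Nat.card_eq_fintype_card, Fintype.card_fin] at h1 h2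
    exact hkl (by rw [← h2, ← hr, h1])

/-- The union of the images of two configurations under continuously varying maps varies
continuously as long as no points collide. -/
theorem Cfg.continuousOn_union {A B P : Type*} [TopologicalSpace A] [TopologicalSpace B]
    [TopologicalSpace P] {G : A → P → Y} {H : B → P → Y} (hG : Continuous fun x : A × P => G x.1 x.2)
    (hH : Continuous fun x : B × P => H x.1 x.2) {W : Set (Cfg A × Cfg B × P)}
    (hW : ∀ x ∈ W, Set.InjOn (fun a => G a x.2.2) x.1.1 ∧ Set.InjOn (fun a => H a x.2.2) x.2.1.1 ∧
      ∀ a ∈ x.1.1, ∀ b ∈ x.2.1.1, G a x.2.2 ≠ H b x.2.2) :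
    ContinuousOn (fun x : Cfg A × Cfg B × P =>
      (x.1.map (fun a => G a x.2.2)).union (x.2.1.map (fun a => H a x.2.2))) W := by
  rintro ⟨z, z', p⟩ hx
  obtain ⟨k, f, rfl⟩ := z.exists_ofInj
  obtain ⟨l, g, rfl⟩ := z'.exists_ofInj
  let R : {f : Fin k → A // Function.Injective f} × {f : Fin l → B // Function.Injective f} × P →
    Cfg A × Cfg B × P := Prod.map (Cfg.ofInj k) (Prod.map (Cfg.ofInj l) id)
  have hR : IsOpenMap R :=
    (Cfg.isOpenMap_ofInj k).prodMap ((Cfg.isOpenMap_ofInj l).prodMap IsOpenMap.id)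
  have hR' : Continuous R :=
    (Cfg.continuous_ofInj k).prodMap ((Cfg.continuous_ofInj l).prodMap continuous_id)
  have hn : 𝓝[W] (R (f, g, p)) = Filter.map R (𝓝[R ⁻¹' W] (f, g, p)) := by
    rw [nhdsWithin, nhdsWithin, ← Filter.comap_principal, Filter.push_pull,
      hR.map_nhds_eq hR'.continuousAt]
  change Filter.Tendsto _ (𝓝[W] (R (f, g, p))) _
  rw [hn, Filter.tendsto_map'_iff]
  refine ContinuousOn.continuousWithinAt ?_ hx
  rw [continuousOn_iff_continuous_domRestrict]
  have hinj : ∀ y : R ⁻¹' W, Function.Injective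
      (Fin.append (fun i => G (y.1.1.1 i) y.1.2.2) (fun i => H (y.1.2.1.1 i) y.1.2.2)) := by
    rintro ⟨⟨f, g, p⟩, hy⟩
    obtain ⟨h1, h2, h3⟩ := hW _ hy
    rw [Fin.append_injective_iff]
    exact ⟨fun i j h => f.2 (h1 ⟨i, rfl⟩ ⟨j, rfl⟩ h), fun i j h => g.2 (h2 ⟨i, rfl⟩ ⟨j, rfl⟩ h),
      fun i j => h3 _ ⟨i, rfl⟩ _ ⟨j, rfl⟩⟩
  have hc : Continuous fun y : R ⁻¹' W => Cfg.ofInj (Y := Y) (k + l) ⟨_, hinj y⟩ := by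
    refine (Cfg.continuous_ofInj _).comp (Continuous.subtype_mk (continuous_pi fun i => ?_) _)
    refine Fin.addCases (fun i => ?_) (fun i => ?_) i
    · simp only [Fin.append_left]
      exact hG.comp (Continuous.prodMk ((continuous_apply i).comp (by fun_prop)) (by fun_prop))
    · simp only [Fin.append_right]
      exact hH.comp (Continuous.prodMk ((continuous_apply i).comp (by fun_prop)) (by fun_prop))
  convert hc using 1
  funext y
  have hl := Fin.append_left (fun i => G (y.1.1.1 i) y.1.2.2) (fun i => H (y.1.2.1.1 i) y.1.2.2)
  have hr := Fin.append_right (fun i => G (y.1.1.1 i) y.1.2.2) (fun i => H (y.1.2.1.1 i) y.1.2.2)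
  refine Cfg.ext (Set.ext fun v => ?_)
  constructor
  · rintro (⟨_, ⟨i, rfl⟩, rfl⟩ | ⟨_, ⟨i, rfl⟩, rfl⟩)
    · exact ⟨Fin.castAdd l i, hl i⟩
    · exact ⟨Fin.natAdd k i, hr i⟩
  · rintro ⟨i, rfl⟩
    refine Fin.addCases (fun i => ?_) (fun i => ?_) i
    · exact Or.inl ⟨_, ⟨i, rfl⟩, (hl i).symm⟩
    · exact Or.inr ⟨_, ⟨i, rfl⟩, (hr i).symm⟩

end Configurations

/-! ### Braid groups of the disc -/

section Slab

/-- The half-infinite strip `(-1, 1) × [0, ∞)`. -/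
abbrev Strip := Set.Ioo (-1 : ℝ) 1 × ℝ≥0

/-- The monoid of configurations in the open rectangles `(-1, 1) × (0, u)`, for `u ≥ 0`. -/
@[ext]
structure Slab where
  /-- the configuration -/
  cfg : Cfg Strip
  /-- the length of the rectangle -/
  len : ℝ≥0
  mem : ∀ q ∈ cfg.carrier, 0 < q.2 ∧ q.2 < len

namespace Slab

instance : TopologicalSpace Slab := .induced (fun s => (s.cfg, s.len)) inferInstance

theorem continuous_pair : Continuous fun s : Slab => (s.cfg, s.len) := continuous_induced_dom

@[fun_prop]
theorem continuous_cfg : Continuous Slab.cfg := continuous_fst.comp continuous_pair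

@[fun_prop]
theorem continuous_len : Continuous Slab.len := continuous_snd.comp continuous_pair

theorem continuous_iff {A : Type*} [TopologicalSpace A] {f : A → Slab} :
    Continuous f ↔ Continuous (fun a => (f a).cfg) ∧ Continuous (fun a => (f a).len) := by
  rw [continuous_induced_rng]
  exact continuous_prodMk

/-- The product `s * s'` places the rectangle `s` after the end of the rectangle `s'`. -/
instance : Monoid Slab where
  mul s s' := ⟨s'.cfg.union (s.cfg.map fun q => (q.1, q.2 + s'.len)), s'.len + s.len, by
    rintro q (hq | ⟨q, hq, rfl⟩)
    · exact ⟨(s'.mem q hq).1, (s'.mem q hq).2.trans_le le_self_add⟩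
    · exact ⟨(s.mem q hq).1.trans_le le_self_add, by
        change q.2 + s'.len < s'.len + s.len
        rw [add_comm s'.len]
        exact add_lt_add_left (s.mem q hq).2 _⟩⟩
  one := ⟨.empty, 0, by simp [Cfg.empty]⟩
  mul_assoc s t r := by
    refine Slab.ext (Cfg.ext ?_) (add_assoc _ _ _).symm
    change r.cfg.carrier ∪ (fun q : Strip => (q.1, q.2 + r.len)) '' (t.cfg.carrier ∪
      (fun q : Strip => (q.1, q.2 + t.len)) '' s.cfg.carrier) = (r.cfg.carrier ∪
      (fun q : Strip => (q.1, q.2 + r.len)) '' t.cfg.carrier) ∪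
      (fun q : Strip => (q.1, q.2 + (r.len + t.len))) '' s.cfg.carrier
    rw [Set.image_union, Set.union_assoc, Set.image_image]
    simp only [add_assoc, add_comm r.len]
  one_mul s := by
    refine Slab.ext (Cfg.ext ?_) (add_zero _)
    change s.cfg.carrier ∪ _ '' ∅ = _
    simp
  mul_one s := by
    refine Slab.ext (Cfg.ext ?_) (zero_add _)
    change ∅ ∪ (fun q : Strip => (q.1, q.2 + (0 : ℝ≥0))) '' s.cfg.carrier = _
    simp

theorem mul_len (s s' : Slab) : (s * s').len = s'.len + s.len := rfl

theorem mul_carrier (s s' : Slab) : (s * s').cfg.carrier =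
    s'.cfg.carrier ∪ (fun q : Strip => (q.1, q.2 + s'.len)) '' s.cfg.carrier := rfl

instance : ContinuousMul Slab := ⟨by
  refine continuous_iff.2 ⟨?_, ?_⟩
  · have h := Cfg.continuousOn_union (A := Strip) (B := Strip) (P := ℝ≥0) (Y := Strip)
      (G := fun q _ => q) (H := fun q u => (q.1, q.2 + u)) (by fun_prop) (by fun_prop)
      (W := {x | ∀ q ∈ x.1.carrier, q.2 < x.2.2}) (fun x hx => ⟨fun _ _ _ _ h => h,
        fun a _ b _ hab => by simpa [Prod.ext_iff] using hab,
        fun a ha b hb hab => by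
          have h1 := hx a ha
          rw [hab] at h1
          exact absurd h1 (not_lt.2 le_add_self)⟩)
    have h' := h.comp_continuous (f := fun x : Slab × Slab => (x.2.cfg, x.1.cfg, x.2.len))
      (by fun_prop) (fun x q hq => (x.2.mem q hq).2)
    convert h' using 1
    funext x
    refine Cfg.ext ?_
    simp [mul_carrier, Cfg.union, Cfg.map]
  · simp only [mul_len]
    fun_prop⟩

/-- The base points: the points `(0, i + 1/2)`, for `i < ℓ`, in the rectangle of length `ℓ`. -/
noncomputable def base (ℓ : ℕ) : Slab where
  cfg := ⟨(fun i : ℕ => (⟨0, by simp⟩, i + 1 / 2)) '' Set.Iio ℓ, (Set.finite_Iio ℓ).image _⟩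
  len := ℓ
  mem := by
    rintro _ ⟨i, hi, rfl⟩
    refine ⟨by positivity, ?_⟩
    have h1 : (i : ℝ≥0) + 1 ≤ ℓ := by exact_mod_cast Nat.succ_le_of_lt hi
    refine lt_of_lt_of_le ?_ h1
    exact (add_lt_add_iff_left _).2 (NNReal.half_lt_self one_ne_zero)

instance : IsMulBase base where
  zero := Slab.ext (Cfg.ext (by simp [base]; rfl)) (by simp [base]; rfl)
  add i j := by
    refine Slab.ext (Cfg.ext ?_) (by simp [base, mul_len])
    rw [mul_carrier]
    simp only [base, Set.image_image]
    have : Set.Iio (j + i) = Set.Iio j ∪ (fun n => n + j) '' Set.Iio i := by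
      ext n
      simp only [Set.mem_Iio, Set.mem_union, Set.mem_image]
      constructor
      · intro h
        by_cases h' : n < j
        · exact Or.inl h'
        · exact Or.inr ⟨n - j, by omega, by omega⟩
      · rintro (h | ⟨a, h, rfl⟩) <;> omega
    rw [this, Set.image_union, Set.image_image]
    congr 1
    refine Set.image_congr fun n _ => ?_
    push_cast
    rw [add_right_comm]

end Slab

/-- The braid groupoid of the disc, i.e. the disjoint union of the braid groups, with its
monoidal structure given by juxtaposition. -/
abbrev BraidGpd := BasedGpd Slab.base

end Slab

/-! ### Local sections and their covering space -/

section LocalSections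

variable {Y : Type u} [TopologicalSpace Y] {T : Type v} [TopologicalSpace T]

/-- A local section of `π` over the boundary of a ball in `I`: an embedding of the closed unit ball
of `ℝᵈ` in `I` (which extends to an open embedding of the open ball of radius `2`), together with
a section of `π` over the image of the unit sphere. -/
structure LocalSection (d : ℕ) (π : T → Y) (I : Set Y) where
  /-- the parametrisation of the ball; only its values on the ball of radius `2` matter -/
  chart : EuclideanSpace ℝ (Fin d) → Y
  chart_emb : IsOpenEmbedding fun x : Metric.ball (0 : EuclideanSpace ℝ (Fin d)) 2 => chart x
  chart_mem : ∀ x ∈ Metric.ball (0 : EuclideanSpace ℝ (Fin d)) 2, chart x ∈ I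
  /-- the section over the boundary of the ball -/
  sec : C(Metric.sphere (0 : EuclideanSpace ℝ (Fin d)) 1, T)
  isSec : ∀ x, π (sec x) = chart x

variable {d : ℕ} {π : T → Y} {I : Set Y}

/-- The ball `B`. -/
def LocalSection.ball (L : LocalSection d π I) : Set Y := L.chart '' Metric.closedBall 0 1

/-- The interior of the ball `B`. -/
def LocalSection.inner (L : LocalSection d π I) : Set Y := L.chart '' Metric.ball 0 1

/-- The ball of `L` lies in the interior of the ball of `L'`, and the two sections extend to
a section over the closed region between the two spheres. -/
def LocalSection.Nested (L L' : LocalSection d π I) : Prop :=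
  L.ball ⊆ L'.inner ∧ ∃ s : C(↥(L'.ball \ L.inner), T), (∀ y, π (s y) = y.1) ∧
    (∀ x h, s ⟨L.chart x.1, h⟩ = L.sec x) ∧ ∀ x h, s ⟨L'.chart x.1, h⟩ = L'.sec x

variable (d π I) in
/-- The space of pairs of a point `p` of `I` and a class of local sections near `p`, under the
equivalence relation generated by `LocalSection.Nested`. -/
def LocSecSpace : Type (max u v) :=
  Σ p : I, Quot fun L L' : {L : LocalSection d π I // p.1 ∈ L.inner} => L.1.Nested L'.1

/-- The point of the space of local sections given by `L` and a point in the interior of its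
ball. -/
def LocalSection.germ (L : LocalSection d π I) (p : I) (h : p.1 ∈ L.inner) : LocSecSpace d π I :=
  ⟨p, Quot.mk _ ⟨L, h⟩⟩

/-- The topology with basis the sets of all `[B, σ]` at `q`, where `q` runs through the interior of
the ball `B`. -/
instance : TopologicalSpace (LocSecSpace d π I) :=
  .generateFrom {N | ∃ L : LocalSection d π I, N = {x | ∃ h, x = L.germ x.1 h}}

/-- The component of the space of local sections given by `L` and a point in the interior of its
ball. -/
def LocalSection.comp (L : LocalSection d π I) (p : I) (h : p.1 ∈ L.inner) :
    ConnectedComponents (LocSecSpace d π I) :=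
  ConnectedComponents.mk (L.germ p h)

end LocalSections

/-! ### Configuration-sections -/

section ConfigurationSections

variable {Y : Type u} [TopologicalSpace Y] {T : Type v} [TopologicalSpace T]

/-- A configuration-section of `π`: a finite configuration together with a section of `π` over its
complement. -/
structure ConfSection (π : T → Y) where
  /-- the configuration -/
  cfg : Cfg Y
  /-- the section over its complement -/
  sec : C({y : Y // y ∉ cfg.carrier}, T)
  isSec : ∀ y, π (sec y) = y.1

/-- The configuration varies continuously, and the section varies continuously in the compact-open
sense, as a partially defined map. -/
instance (π : T → Y) : TopologicalSpace (ConfSection π) :=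
  .induced ConfSection.cfg inferInstance ⊓ .generateFrom {W | ∃ K : Set Y, ∃ U : Set T,
    IsCompact K ∧ IsOpen U ∧ W = {x | ∀ y ∈ K, ∃ h, x.sec ⟨y, h⟩ ∈ U}}

theorem ConfSection.continuous_cfg (π : T → Y) : Continuous (ConfSection.cfg (π := π)) :=
  continuous_iff_le_induced.2 inf_le_left

end ConfigurationSections

/-! ### The input data -/

section InputData

variable (m : ℕ) (M : Type u) [TopologicalSpace M] [ChartedSpace (EuclideanHalfSpace (m + 2)) M]
  (E : Type v) [TopologicalSpace E] (X : Type w) [TopologicalSpace X]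

/-- The interior of a manifold with boundary of dimension `m + 2`. -/
def mInterior : Set M := (modelWithCornersEuclideanHalfSpace (m + 2)).interior M

/-- The boundary of a manifold with boundary of dimension `m + 2`. -/
def mBoundary : Set M := (modelWithCornersEuclideanHalfSpace (m + 2)).boundary M

/-- The cube `[-1, 1]^(m+1)`. -/
def cube : Set (Fin (m + 1) → ℝ) := {y | ∀ i, -1 ≤ y i ∧ y i ≤ 1}

/-- The open cube `(-1, 1)^(m+1)`. -/
def openCube : Set (Fin (m + 1) → ℝ) := {y | ∀ i, -1 < y i ∧ y i < 1}

/-- The input data, for a manifold `M` of dimension `d = m + 2`: a disc `D` in the boundary of `M`,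
a bundle over `M` with total space `E` and fibre `X`, a trivialisation of it over `D`, a point of
`X`, and a set `c` of components of the space of local sections of the bundle. -/
structure Inputs where
  /-- a parametrisation of an open neighbourhood in `∂M` of the disc `D`, which is the image of
  the cube; the centre of the disc is the image of the origin -/
  disc : (Fin (m + 1) → ℝ) → mBoundary m M
  disc_emb : IsOpenEmbedding disc
  /-- the projection of the bundle -/
  proj : E → M
  locTriv : ∀ x, ∃ τ : Bundle.Trivialization X proj, x ∈ τ.baseSet
  /-- the trivialisation over the disc -/
  θ : {e : E // ∃ y ∈ cube m, proj e = disc y} ≃ₜ {x : M // ∃ y ∈ cube m, x = disc y} × X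
  θ_fst : ∀ e, (θ e).1.1 = proj e.1
  /-- the base point of the fibre -/
  x₀ : X
  /-- the singularity condition -/
  c : Set (ConnectedComponents (LocSecSpace (m + 2) proj (mInterior m M)))

end InputData

namespace Inputs

variable {m : ℕ} {M : Type u} [TopologicalSpace M] [ChartedSpace (EuclideanHalfSpace (m + 2)) M]
  {E : Type v} [TopologicalSpace E] {X : Type w} [TopologicalSpace X] (i : Inputs m M E X)

/-- The disc `D` in the boundary. -/
def D : Set M := {x | ∃ y ∈ cube m, x = i.disc y}

/-- The manifold `M` with a cylinder `D × [0, ∞)` attached along `D`: the subspace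
`M × {0} ∪ D × [0, ∞)` of `M × [0, ∞)`. -/
def Hat : Type u := {p : M × ℝ≥0 // p.2 = 0 ∨ p.1 ∈ i.D}

instance : TopologicalSpace i.Hat := inferInstanceAs (TopologicalSpace {p : M × ℝ≥0 // _})

/-- The inclusion of `M`. -/
def incl (x : M) : i.Hat := ⟨(x, 0), Or.inl rfl⟩

/-- The retraction `M̂ → M`. -/
def retr (p : i.Hat) : M := p.1.1

/-- The height `M̂ → [0, ∞)`, which is zero on `M`. -/
def height (p : i.Hat) : ℝ≥0 := p.1.2

@[fun_prop]
theorem continuous_retr : Continuous i.retr := continuous_fst.comp continuous_subtype_val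

@[fun_prop]
theorem continuous_height : Continuous i.height := continuous_snd.comp continuous_subtype_val

/-- The interior of `M̂`. -/
def hatInterior : Set i.Hat :=
  {p | i.retr p ∈ mInterior m M ∨ ∃ y ∈ openCube m, i.retr p = i.disc y}

/-- The interior of the subspace `M̂_t` of points of height at most `t`. -/
def hatInt (t : ℝ≥0) : Set i.Hat :=
  {p | i.retr p ∈ mInterior m M ∨ (∃ y ∈ openCube m, i.retr p = i.disc y) ∧ i.height p < t}

/-- The extended bundle over `M̂`: the pullback of the bundle along the retraction. It agrees
with the bundle over `M`, and it is trivialised by `θ` over the cylinder. -/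
def HatE : Type (max u v) := {q : i.Hat × E // i.proj q.2 = i.retr q.1}

instance : TopologicalSpace i.HatE := inferInstanceAs (TopologicalSpace {q : i.Hat × E // _})

/-- The projection of the extended bundle. -/
def hatProj (q : i.HatE) : i.Hat := q.1.1

/-- The point of the extended bundle over a point `p` of the cylinder that corresponds to `x ∈ X`
under the trivialisation. -/
def triv (p : i.Hat) (h : i.retr p ∈ i.D) (x : X) : i.HatE :=
  ⟨(p, (i.θ.symm (⟨i.retr p, h⟩, x)).1), by
    rw [← i.θ_fst, Homeomorph.apply_symm_apply]⟩

/-- The nearest point of the cube. -/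
def clamp (y : Fin (m + 1) → ℝ) : Fin (m + 1) → ℝ := fun j => max (-1) (min (y j) 1)

theorem clamp_mem (y : Fin (m + 1) → ℝ) : clamp y ∈ cube m :=
  fun j => ⟨le_max_left _ _, max_le (by norm_num) (min_le_right _ _)⟩

theorem clamp_eq {y : Fin (m + 1) → ℝ} (hy : y ∈ cube m) : clamp y = y :=
  funext fun j => by simp [clamp, hy j]

/-- The point of the cylinder `D × [0, ∞)` with the given coordinates in the cube (points outside
the cube are first moved into the cube) and the given height. -/
def cyl (y : Fin (m + 1) → ℝ) (τ : ℝ≥0) : i.Hat :=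
  ⟨((i.disc (clamp y)).1, τ), Or.inr ⟨_, clamp_mem y, rfl⟩⟩

theorem retr_cyl_mem (y : Fin (m + 1) → ℝ) (τ : ℝ≥0) : i.retr (i.cyl y τ) ∈ i.D :=
  ⟨_, clamp_mem y, rfl⟩

theorem continuous_cyl : Continuous fun x : (Fin (m + 1) → ℝ) × ℝ≥0 => i.cyl x.1 x.2 := by
  refine Continuous.subtype_mk ?_ _
  have : Continuous (clamp (m := m)) := by unfold clamp; fun_prop
  exact ((continuous_subtype_val.comp (i.disc_emb.continuous.comp this)).comp
    continuous_fst).prodMk continuous_snd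

/-! ### The space of configurations -/

/-- A configuration in the interior of `M̂_t`, together with `t`. -/
@[ext]
structure Cdot where
  /-- the configuration -/
  cfg : Cfg i.Hat
  /-- the parameter `t` -/
  len : ℝ≥0
  mem : ∀ p ∈ cfg.carrier, p ∈ i.hatInt len

instance : TopologicalSpace i.Cdot := .induced (fun s => (s.cfg, s.len)) inferInstance

variable {i} in
theorem Cdot.continuous_pair : Continuous fun s : i.Cdot => (s.cfg, s.len) :=
  continuous_induced_dom

variable {i} in
@[fun_prop]
theorem Cdot.continuous_cfg : Continuous (Cdot.cfg (i := i)) :=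
  continuous_fst.comp Cdot.continuous_pair

variable {i} in
@[fun_prop]
theorem Cdot.continuous_len : Continuous (Cdot.len (i := i)) :=
  continuous_snd.comp Cdot.continuous_pair

variable {i} in
theorem Cdot.continuous_iff {A : Type*} [TopologicalSpace A] {f : A → i.Cdot} :
    Continuous f ↔ Continuous (fun a => (f a).cfg) ∧ Continuous (fun a => (f a).len) := by
  rw [continuous_induced_rng]
  exact continuous_prodMk

/-- The strip `(-1, 1) × [0, ∞)` as a subspace of the part of the cylinder of height at least `t`;
the coordinate in `(-1, 1)` is the first coordinate of the cube. -/
def strip (q : Strip) (t : ℝ≥0) : i.Hat := i.cyl (Pi.single 0 q.1) (q.2 + t)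

theorem continuous_strip : Continuous fun x : Strip × ℝ≥0 => i.strip x.1 x.2 := by
  refine i.continuous_cyl.comp (Continuous.prodMk ?_ (by fun_prop))
  exact (continuous_single (A := fun _ : Fin (m + 1) => ℝ) 0).comp (by fun_prop)

theorem single_mem (a : Set.Ioo (-1 : ℝ) 1) :
    (Pi.single 0 a.1 : Fin (m + 1) → ℝ) ∈ openCube m := by
  intro j
  by_cases hj : j = 0
  · subst hj; simp only [Pi.single_eq_same]; exact a.2
  · simp [Pi.single_eq_of_ne hj]

theorem openCube_subset {y : Fin (m + 1) → ℝ} (hy : y ∈ openCube m) : y ∈ cube m :=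
  fun j => ⟨(hy j).1.le, (hy j).2.le⟩

theorem retr_strip (q : Strip) (t : ℝ≥0) :
    i.retr (i.strip q t) = (i.disc (Pi.single 0 q.1)).1 := by
  change (i.disc (clamp _)).1 = _
  rw [clamp_eq (openCube_subset (single_mem _))]

theorem strip_injective (t : ℝ≥0) : Function.Injective fun q => i.strip q t := by
  intro q q' h
  have h1 := congrArg i.retr h
  have h2 : q.2 + t = q'.2 + t := congrArg i.height h
  simp only [retr_strip] at h1
  have h3 := congrFun (i.disc_emb.injective (Subtype.ext h1)) 0
  simp only [Pi.single_eq_same] at h3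
  exact Prod.ext (Subtype.ext h3) (add_right_cancel h2)

theorem ne_strip {t : ℝ≥0} {p : i.Hat} (hp : p ∈ i.hatInt t) (q : Strip) : p ≠ i.strip q t := by
  rintro rfl
  rcases hp with hp | ⟨_, hp⟩
  · rw [retr_strip] at hp
    exact (ModelWithCorners.disjoint_interior_boundary (I := modelWithCornersEuclideanHalfSpace
      (m + 2)) (M := M)).le_bot ⟨hp, (i.disc _).2⟩
  · exact absurd hp (not_lt.2 le_add_self)

/-- A configuration in a rectangle acts on a configuration in `M̂_t` by placing the rectangle, in
the slice of the cylinder where all coordinates but the first vanish, next to `M̂_t`. -/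
instance : MulAction Slab i.Cdot where
  smul s x := ⟨x.cfg.union (s.cfg.map fun q => i.strip q x.len), x.len + s.len, by
    rintro p (hp | ⟨q, hq, rfl⟩)
    · rcases x.mem p hp with h | ⟨h, h'⟩
      · exact Or.inl h
      · exact Or.inr ⟨h, h'.trans_le le_self_add⟩
    · refine Or.inr ⟨⟨_, single_mem q.1, i.retr_strip _ _⟩, ?_⟩
      change q.2 + x.len < x.len + s.len
      rw [add_comm x.len]
      exact add_lt_add_left (s.mem q hq).2 _⟩
  one_smul x := by
    refine Cdot.ext (Cfg.ext ?_) (add_zero _)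
    change x.cfg.carrier ∪ _ '' ∅ = _
    simp
  mul_smul s t x := by
    refine Cdot.ext (Cfg.ext ?_) (add_assoc _ _ _).symm
    change x.cfg.carrier ∪ (fun q => i.strip q x.len) '' (t.cfg.carrier ∪
      (fun q : Strip => (q.1, q.2 + t.len)) '' s.cfg.carrier) = (x.cfg.carrier ∪
      (fun q => i.strip q x.len) '' t.cfg.carrier) ∪
      (fun q => i.strip q (x.len + t.len)) '' s.cfg.carrier
    rw [Set.image_union, Set.union_assoc, Set.image_image]
    simp only [strip, add_assoc, add_comm x.len]

variable {i} in
theorem smul_len (s : Slab) (x : i.Cdot) : (s • x).len = x.len + s.len := rfl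

variable {i} in
theorem smul_carrier (s : Slab) (x : i.Cdot) : (s • x).cfg.carrier =
    x.cfg.carrier ∪ (fun q => i.strip q x.len) '' s.cfg.carrier := rfl

instance : ContinuousSMul Slab i.Cdot := ⟨by
  refine Cdot.continuous_iff.2 ⟨?_, ?_⟩
  · have h := Cfg.continuousOn_union (A := i.Hat) (B := Strip) (P := ℝ≥0) (Y := i.Hat)
      (G := fun q _ => q) (H := fun q u => i.strip q u) (by fun_prop) i.continuous_strip
      (W := {x | ∀ q ∈ x.1.carrier, q ∈ i.hatInt x.2.2}) (fun x hx => ⟨fun _ _ _ _ h => h,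
        fun a _ b _ hab => i.strip_injective _ hab, fun a ha b _ => i.ne_strip (hx a ha) b⟩)
    have h' := h.comp_continuous (f := fun x : Slab × i.Cdot => (x.2.cfg, x.1.cfg, x.2.len))
      (by fun_prop) (fun x q hq => x.2.mem q hq)
    convert h' using 1
    funext x
    refine Cfg.ext ?_
    simp [smul_carrier, Cfg.union, Cfg.map]
  · simp only [smul_len]
    fun_prop⟩

/-- The base points: the `k` points over the centre of `D` of heights `1/2, 3/2, …, k - 1/2`, with
parameter `k`. -/
noncomputable def base (k : ℕ) : i.Cdot where
  cfg := ⟨(fun j : ℕ => i.cyl 0 (j + 1 / 2)) '' Set.Iio k, (Set.finite_Iio k).image _⟩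
  len := k
  mem := by
    rintro _ ⟨j, hj, rfl⟩
    refine Or.inr ⟨⟨0, fun _ => by simp, ?_⟩, ?_⟩
    · change (i.disc (clamp 0)).1 = _
      rw [clamp_eq (fun _ => by simp)]
    · have h1 : (j : ℝ≥0) + 1 ≤ k := by exact_mod_cast Nat.succ_le_of_lt hj
      exact lt_of_lt_of_le ((add_lt_add_iff_left _).2 (NNReal.half_lt_self one_ne_zero)) h1

theorem base_eq (k : ℕ) : i.base k = Slab.base k • i.base 0 := by
  refine Cdot.ext (Cfg.ext ?_) (by simp [smul_len, base, Slab.base])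
  rw [smul_carrier]
  simp [base, Slab.base, Set.image_image, strip]

instance : IsActBase Slab.base i.base where
  add j k := by
    rw [i.base_eq (k + j), i.base_eq k, IsMulBase.add (b := Slab.base), mul_smul]

/-- The braid groupoid `Br(M)`. -/
abbrev Br := BasedGpd i.base

/-- The category `C(M) = ⟨B, Br(M)⟩`. -/
abbrev BrC := QBracket BraidGpd i.Br

/-- The canonical functor `Br(M) ⥤ C(M)`. -/
noncomputable def toBrC : i.Br ⥤ i.BrC := QBracket.incl BraidGpd i.Br

/-- The canonical morphism `k ⟶ k + 1` of `C(M)`, represented by the identity of `1 ⊕ k`. -/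
noncomputable def ι (k : ℕ) : i.toBrC.obj ⟨k⟩ ⟶ i.toBrC.obj ⟨k + 1⟩ :=
  QBracket.homMk (X := (⟨k⟩ : i.Br)) (Y := ⟨k + 1⟩) (⟨1⟩ : BraidGpd) (𝟙 (⟨k + 1⟩ : i.Br))

/-! ### The space of configuration-sections -/

/-- The singularity condition for the extended bundle: the image of `c` under the inclusion of the
bundle in the extended bundle. -/
def cHat : Set (ConnectedComponents (LocSecSpace (m + 2) i.hatProj i.hatInterior)) :=
  {x | ∃ (L : LocalSection (m + 2) i.proj (mInterior m M)) (p : mInterior m M) (h : p.1 ∈ L.inner)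
    (L' : LocalSection (m + 2) i.hatProj i.hatInterior)
    (h' : (⟨i.incl p, Or.inl p.2⟩ : i.hatInterior).1 ∈ L'.inner),
    (∀ y, L'.chart y = i.incl (L.chart y)) ∧ (∀ y, (L'.sec y).1.2 = L.sec y) ∧
    L.comp p h ∈ i.c ∧ x = L'.comp _ h'}

/-- A configuration-section has its charges in `ĉ`: near every point `p` of the configuration,
the section over the boundary of a ball that contains `p` in its interior and no other point of the
configuration represents an element of `ĉ`. -/
def Charged (x : ConfSection i.hatProj) : Prop :=
  ∀ (p : i.hatInterior) (L : LocalSection (m + 2) i.hatProj i.hatInterior) (h : p.1 ∈ L.inner),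
    L.ball ∩ x.cfg.carrier = {p.1} → (∀ y hy, L.sec y = x.sec ⟨L.chart y.1, hy⟩) →
      L.comp p h ∈ i.cHat

/-- Configuration-sections of the extended bundle with their configurations in the interior of
`M̂_t` and their charges in `ĉ`, which are constant at `x₀` over `D × [t, ∞)`, together
with `t`. -/
def CGdot : Type (max u v) :=
  {x : ConfSection i.hatProj × ℝ≥0 // (∀ p ∈ x.1.cfg.carrier, p ∈ i.hatInt x.2) ∧ i.Charged x.1 ∧
    ∀ p (h : i.retr p ∈ i.D) hp, x.2 ≤ i.height p → x.1.sec ⟨p, hp⟩ = i.triv p h i.x₀}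

instance : TopologicalSpace i.CGdot :=
  inferInstanceAs (TopologicalSpace {x : ConfSection i.hatProj × ℝ≥0 // _})

/-- The map that forgets the section. -/
def forget : C(i.CGdot, i.Cdot) where
  toFun x := ⟨x.1.1.cfg, x.1.2, x.2.1⟩
  continuous_toFun := Cdot.continuous_iff.2
    ⟨(ConfSection.continuous_cfg _).comp (continuous_fst.comp continuous_subtype_val),
      continuous_snd.comp continuous_subtype_val⟩

/-- The monodromy functor `Br(M) ⥤ Ho(Top)`. -/
noncomputable def mon (hp : IsHurewiczFibration i.forget) : i.Br ⥤ HoTop.{max u v} :=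
  BasedGpd.incl i.base ⋙ monodromy i.forget hp

/-! ### The stabilisation maps -/

/-- The standard ball in the cylinder, of radius `1/4` around the point of height `1/2` over the
centre of `D`. Coordinate `0` of `ℝᵈ` is the height; the others are the coordinates of the cube. -/
noncomputable def stdChart (x : EuclideanSpace ℝ (Fin (m + 2))) : i.Hat :=
  i.cyl (fun j => x j.succ / 4) (Real.toNNReal (1 / 2 + x 0 / 4))

/-- The set `c_D` of (homotopy classes of) maps from the sphere to `X` that give an element of `ĉ`
via the trivialisation over the cylinder. -/
def cD : Set C(Metric.sphere (0 : EuclideanSpace ℝ (Fin (m + 2))) 1, X) :=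
  {g | ∃ (L : LocalSection (m + 2) i.hatProj i.hatInterior) (p : i.hatInterior)
    (h : p.1 ∈ L.inner), L.chart = i.stdChart ∧
    (∀ y, L.sec y = i.triv (i.stdChart y.1) (i.retr_cyl_mem _ _) (g y)) ∧ L.comp p h ∈ i.cHat}

/-- The choices for the stabilisation maps: the radius of a ball in a slice of width `1` of the
cylinder, and a map on the punctured closed unit ball with charge in `c_D`, which sends the southern
hemisphere to the base point. -/
structure StabChoice where
  /-- the radius -/
  r : ℝ
  r_pos : 0 < r
  r_le : r ≤ 1 / 2
  /-- the map on the punctured ball -/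
  f : C({q : EuclideanSpace ℝ (Fin (m + 2)) // q ≠ 0 ∧ ‖q‖ ≤ 1}, X)
  south : ∀ q, ‖q.1‖ = 1 → q.1 (Fin.last _) ≤ 0 → f q = i.x₀
  charge : ∃ g ∈ i.cD, ∀ y h, g y = f ⟨y.1, h⟩

variable {i}

/-- The point of the horizontal plane through the origin below or above `q`. -/
noncomputable def flat (q : EuclideanSpace ℝ (Fin (m + 2))) : EuclideanSpace ℝ (Fin (m + 2)) :=
  WithLp.toLp 2 (Function.update q (Fin.last _) 0)

/-- If the vertical line through `q` meets the unit ball, the point of the ball on that line that is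
nearest to `q`. -/
noncomputable def pull (q : EuclideanSpace ℝ (Fin (m + 2))) : EuclideanSpace ℝ (Fin (m + 2)) :=
  WithLp.toLp 2 (Function.update q (Fin.last _)
    (max (-√(1 - ‖flat q‖ ^ 2)) (min (q (Fin.last _)) √(1 - ‖flat q‖ ^ 2))))

open Classical in
/-- The extension of `f` to the complement of the origin in `ℝᵈ`: it is independent of the vertical
(last) coordinate above and below the ball, and `x₀` elsewhere. (Below the ball this is `x₀` as
well.) -/
noncomputable def StabChoice.ext (σ : StabChoice i) (q : EuclideanSpace ℝ (Fin (m + 2))) : X :=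
  if h : pull q ≠ 0 ∧ ‖pull q‖ ≤ 1 then σ.f ⟨pull q, h⟩ else i.x₀

/-- `S` is the stabilisation map: it adds the point of height `t + 1/2` over the centre of `D` to
the configuration, increases `t` by `1`, leaves the section unchanged up to height `t`, and extends
it over the cylinder by the chosen map, scaled by `r` and centred at the new point. -/
structure StabChoice.IsStab (σ : StabChoice i) (S : C(i.CGdot, i.CGdot)) : Prop where
  forget_eq : ∀ x, i.forget (S x) = Slab.base 1 • i.forget x
  old : ∀ x p h h', i.height p ≤ x.1.2 → (S x).1.1.sec ⟨p, h⟩ = x.1.1.sec ⟨p, h'⟩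
  new : ∀ x, ∀ y ∈ cube m, ∀ (τ : ℝ≥0) h, (S x).1.1.sec ⟨i.cyl y (x.1.2 + τ), h⟩ =
    i.triv (i.cyl y (x.1.2 + τ)) (i.retr_cyl_mem _ _)
      (σ.ext (WithLp.toLp 2 (Fin.cons ((τ - 1 / 2) / σ.r) fun j => y j / σ.r)))

/-- The restriction of the stabilisation map to the fibres over the base points. -/
def StabChoice.IsStab.fibreMap {σ : StabChoice i} {S : C(i.CGdot, i.CGdot)} (hS : σ.IsStab S)
    (k : ℕ) : C(Fibre i.forget (i.base k), Fibre i.forget (i.base (k + 1))) where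
  toFun x := ⟨S x.1, (hS.forget_eq x.1).trans
    ((congrArg (Slab.base 1 • ·) x.2).trans (IsActBase.add (b := Slab.base) 1 k).symm)⟩
  continuous_toFun := Continuous.subtype_mk (S.continuous.comp continuous_subtype_val) _

end Inputs

end ConfSec

/-! Fibration. Forgetting the charge condition gives a larger space `Free` over `Cdot`. Near a given
configuration with length, all others are related to each other by continuously varying self-maps of
the extended manifold that are homotopic to the identity (`exists_isotopy`). Pulling a section back
along such a map and transporting its values in the bundle gives local slicings of `Free`
(`hasLocalSlicing_freeForget`). Over a metrizable, second countable base, local slicings combine to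
a continuous choice of path lifts (`HasLocalSlicing.exists_lifting`), which is homotopy lifting for
all test spaces. The class of a charge is constant along a path of configuration-sections
(`charged_of_path`), so lifts that start in `CGdot` stay in it.

Functor. Every morphism of the bracket category is a composite of canonical morphisms `ι` followed
by a morphism from `Br(M)`, so uniqueness is formal (`brC_functor_ext`). For existence, a class `(d,
φ)` should go to the `d`-fold stabilisation followed by the monodromy of `φ`. Compatibility with
composition holds because the stabilisation is defined on the whole total space and covers the
action of the base point of length one (`fibrePow_naturality`). Independence of the representative
says that the monodromy of a braid of the new points does not change the iterated stabilisation up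
to homotopy (`fibrePow_braid`).

To see this, the iterated stabilisation is extended to a family over a path of configurations in
rectangles (`exists_lift_smul`). The fields around the moving points have to be superposed in a
continuous way, and this is the heart of the matter (`StabChoice.exists_combination`). Up to
homotopy, the chosen map `f` is constant along rays. If `d ≥ 3`, the points move in a plane that
does not contain the vertical direction, so that vertical cylinders over small balls are disjoint
and at most one field is nontrivial at each place. If `d = 2`, the vertical direction lies in the
plane of motion and the cylinders overlap when one point passes above another. But then `f` factors
through a circle, the southern half of the unit circle being collapsed, and all fields are
composites of one and the same loop in `X` with maps to the circle. Such maps can be added in the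
circle group, which is commutative, so the order of the points plays no role. -/

namespace ConfSec

/-! ### Local slicings and regular path lifting -/

section Uniformization

open scoped unitInterval

variable {T : Type u} {B : Type v} [TopologicalSpace T] [TopologicalSpace B]

/-- Over a neighbourhood of every point of the base, points of the total space can be moved
continuously between any two fibres, and points that need not move stay where they are. -/
def HasLocalSlicing (p : C(T, B)) : Prop :=
  ∀ b, ∃ U, IsOpen U ∧ b ∈ U ∧ ∃ g : T × B → T, ContinuousOn g {x | p x.1 ∈ U ∧ x.2 ∈ U} ∧
    (∀ e b', p e ∈ U → b' ∈ U → p (g (e, b')) = b') ∧ ∀ e, p e ∈ U → g (e, p e) = e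

/-- A countable family of local slicings with a subordinate partition of unity. -/
structure SlicingFamily (p : C(T, B)) where
  /-- the open sets -/
  U : ℕ → Set B
  isOpen : ∀ n, IsOpen (U n)
  /-- the slicings -/
  slide : ℕ → T × B → T
  cont : ∀ n, ContinuousOn (slide n) {x | p x.1 ∈ U n ∧ x.2 ∈ U n}
  proj : ∀ n e b', p e ∈ U n → b' ∈ U n → p (slide n (e, b')) = b'
  stay : ∀ n e, p e ∈ U n → slide n (e, p e) = e
  /-- the partition of unity -/
  pou : PartitionOfUnity ℕ B
  subord : pou.IsSubordinate U

/-- Second countability makes the cover countable, so that the slicings can be applied in the order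
of `ℕ`; metrizability supplies the partition of unity. -/
theorem HasLocalSlicing.exists_family [TopologicalSpace.MetrizableSpace B]
    [SecondCountableTopology B]
    [Nonempty B] {p : C(T, B)} (hp : HasLocalSlicing p) : Nonempty (SlicingFamily p) := by
  choose V hVo hV sl hσ hproj hstay using hp
  obtain ⟨s, hs, hsU⟩ := TopologicalSpace.isOpen_iUnion_countable V hVo
  have hne : s.Nonempty := by
    obtain ⟨b⟩ := ‹Nonempty B›
    have : b ∈ ⋃ i ∈ s, V i := by rw [hsU]; exact Set.mem_iUnion.2 ⟨b, hV b⟩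
    simp only [Set.mem_iUnion] at this
    exact ⟨_, this.choose_spec.choose⟩
  obtain ⟨g, hg⟩ := hs.exists_eq_range hne
  let := TopologicalSpace.metrizableSpaceMetric B
  obtain ⟨f, hf⟩ := PartitionOfUnity.exists_isSubordinate (isClosed_univ (X := B))
    (fun n => V (g n)) (fun n => hVo _) (fun b _ => by
      have : b ∈ ⋃ i ∈ s, V i := by rw [hsU]; exact Set.mem_iUnion.2 ⟨b, hV b⟩
      simpa [hg] using this)
  exact ⟨⟨fun n => V (g n), fun n => hVo _, fun n => sl (g n), fun n => hσ _, fun n => hproj _,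
    fun n => hstay _, f, hf⟩⟩

/-- A path, extended constantly to the real line. -/
noncomputable def evR (γ : C(I, B)) (s : ℝ) : B := γ (Set.projIcc 0 1 zero_le_one s)

@[fun_prop]
theorem continuous_evR : Continuous fun x : C(I, B) × ℝ => evR x.1 x.2 := by
  unfold evR
  have : Continuous (Set.projIcc (0 : ℝ) 1 zero_le_one) := continuous_projIcc
  fun_prop

theorem evR_coe (γ : C(I, B)) (s : I) : evR γ s = γ s := by simp [evR]

namespace SlicingFamily

variable {p : C(T, B)} (Φ : SlicingFamily p)

/-- Partial sums of the partition of unity. -/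
noncomputable def tau (n : ℕ) (b : B) : ℝ := ∑ j ∈ Finset.range n, Φ.pou j b

theorem continuous_tau (n : ℕ) : Continuous (Φ.tau n) := by
  unfold tau
  exact continuous_finsetSum _ fun j _ => (Φ.pou j).continuous

theorem tau_nonneg (n : ℕ) (b : B) : 0 ≤ Φ.tau n b :=
  Finset.sum_nonneg fun j _ => Φ.pou.nonneg j b

theorem tau_eq_one {n : ℕ} {b : B} (h : ∀ k ≥ n, b ∉ tsupport (Φ.pou k)) : Φ.tau n b = 1 := by
  refine Φ.pou.sum_finsupport' (Set.mem_univ b) fun j hj => ?_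
  rw [Finset.mem_range]
  by_contra hjn
  exact h j (not_lt.1 hjn) (subset_tsupport _ ((Φ.pou.mem_finsupport b).1 hj))

/-- Local finiteness in the form used below: near every point, a fixed finite number of slicings
makes up the whole infinite composite. -/
theorem exists_bound (b : B) : ∃ N, ∀ᶠ b' in 𝓝 b, ∀ n ≥ N, b' ∉ tsupport (Φ.pou n) := by
  obtain ⟨t, ht, hfin⟩ := Φ.pou.locallyFinite_tsupport b
  obtain ⟨N, hN⟩ := hfin.bddAbove
  refine ⟨N + 1, Filter.mem_of_superset ht fun b' hb' n hn hmem => ?_⟩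
  have : n ≤ N := hN ⟨b', hmem, hb'⟩
  omega

theorem tau_le_one (n : ℕ) (b : B) : Φ.tau n b ≤ 1 := by
  obtain ⟨N, hN⟩ := Φ.exists_bound b
  rw [← Φ.tau_eq_one (n := max N n) fun k hk => hN.self_of_nhds k (le_trans (le_max_left _ _) hk)]
  exact Finset.sum_le_sum_of_subset_of_nonneg
    (Finset.range_subset_range.2 (le_max_right _ _)) fun j _ _ => Φ.pou.nonneg j b

open Classical in
/-- Moving along the path `γ` from time `s` towards time `s'` through the first `n` slicings. -/
noncomputable def stepN (x : C(I, B) × ℝ × ℝ × T) : ℕ → T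
  | 0 => x.2.2.2
  | n + 1 =>
    -- The test and the weights `tau` refer to the starting point of the move only. The `n`-th
    -- slicing covers the fraction `pou n` of the time from `s` to `s'`.
    if evR x.1 x.2.1 ∈ tsupport (Φ.pou n) then
      Φ.slide n (stepN x n,
        evR x.1 (x.2.1 + Φ.tau (n + 1) (evR x.1 x.2.1) * (x.2.2.1 - x.2.1)))
    else stepN x n

/-- The arguments for which the moves make sense. -/
def good : Set (C(I, B) × ℝ × ℝ × T) :=
  {x | p x.2.2.2 = evR x.1 x.2.1 ∧ ∀ n, evR x.1 x.2.1 ∈ tsupport (Φ.pou n) →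
    ∀ s ∈ Set.uIcc x.2.1 x.2.2.1, evR x.1 s ∈ Φ.U n}

theorem time_mem (n : ℕ) (b : B) (s s' : ℝ) : s + Φ.tau n b * (s' - s) ∈ Set.uIcc s s' := by
  have h0 := Φ.tau_nonneg n b
  have h1 := Φ.tau_le_one n b
  rw [Set.mem_uIcc]
  rcases le_total s s' with h | h
  · left; constructor <;> nlinarith
  · right; constructor <;> nlinarith

variable {Φ}

/-- Off the support of `pou n` the partial sums `tau n` and `tau (n + 1)` agree, so that doing
nothing also ends over the right time. -/
theorem proj_stepN {x : C(I, B) × ℝ × ℝ × T} (hx : x ∈ Φ.good) (n : ℕ) : p (Φ.stepN x n) =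
    evR x.1 (x.2.1 + Φ.tau n (evR x.1 x.2.1) * (x.2.2.1 - x.2.1)) := by
  induction n with
  | zero => simpa [stepN, tau] using hx.1
  | succ n ih =>
    rw [stepN]
    split_ifs with h
    · refine Φ.proj n _ _ ?_ (hx.2 n h _ (Φ.time_mem _ _ _ _))
      rw [ih]
      exact hx.2 n h _ (Φ.time_mem _ _ _ _)
    · rw [ih, tau, tau, Finset.sum_range_succ, image_eq_zero_of_notMem_tsupport h, add_zero]

theorem stepN_of_const {x : C(I, B) × ℝ × ℝ × T} (hx : x ∈ Φ.good)
    (hc : ∀ s ∈ Set.uIcc x.2.1 x.2.2.1, evR x.1 s = p x.2.2.2) (n : ℕ) :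
    Φ.stepN x n = x.2.2.2 := by
  induction n with
  | zero => rfl
  | succ n ih =>
    rw [stepN, ih]
    split_ifs with h
    · rw [hc _ (Φ.time_mem _ _ _ _)]
      refine Φ.stay n _ ?_
      rw [hx.1]
      exact hx.2 n h _ Set.left_mem_uIcc
    · rfl

theorem stepN_eq {x : C(I, B) × ℝ × ℝ × T} {n m : ℕ}
    (h : ∀ k ≥ n, evR x.1 x.2.1 ∉ tsupport (Φ.pou k)) (hm : n ≤ m) :
    Φ.stepN x m = Φ.stepN x n := by
  induction m, hm using Nat.le_induction with
  | base => rfl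
  | succ m hm ih => rw [stepN, if_neg (h m hm), ih]

theorem isOpen_dom (n : ℕ) : IsOpen {x : T × B | p x.1 ∈ Φ.U n ∧ x.2 ∈ Φ.U n} :=
  ((Φ.isOpen n).preimage (p.continuous.comp continuous_fst)).inter
    ((Φ.isOpen n).preimage continuous_snd)

/-- The case distinction in `stepN` is harmless. Near a point of the closed support the slicing may
be applied even where the weight vanishes, because there it is asked to move a point to its own
fibre, and `stay` makes it the identity. Away from the support nothing happens in a whole
neighbourhood. -/
theorem continuousOn_stepN (n : ℕ) : ContinuousOn (fun x => Φ.stepN x n) Φ.good := by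
  induction n with
  | zero => exact Continuous.continuousOn (by unfold stepN; fun_prop)
  | succ n ih =>
    intro x hx
    have hb : Continuous fun x : C(I, B) × ℝ × ℝ × T => evR x.1 x.2.1 :=
      continuous_evR.comp (f := fun x : C(I, B) × ℝ × ℝ × T => (x.1, x.2.1)) (by fun_prop)
    by_cases h : evR x.1 x.2.1 ∈ tsupport (Φ.pou n)
    · let F : C(I, B) × ℝ × ℝ × T → T × B := fun x => (Φ.stepN x n,
        evR x.1 (x.2.1 + Φ.tau (n + 1) (evR x.1 x.2.1) * (x.2.2.1 - x.2.1)))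
      have hF : ContinuousWithinAt F Φ.good x := by
        refine (ih x hx).prodMk (Continuous.continuousWithinAt ?_)
        have h1 := (Φ.continuous_tau (n + 1)).comp hb
        exact continuous_evR.comp (f := fun x : C(I, B) × ℝ × ℝ × T => (x.1, x.2.1 +
          Φ.tau (n + 1) (evR x.1 x.2.1) * (x.2.2.1 - x.2.1)))
          (continuous_fst.prodMk ((by fun_prop : Continuous fun x : C(I, B) × ℝ × ℝ × T =>
            x.2.1).add (h1.mul (by fun_prop))))
      have hFx : F x ∈ {x : T × B | p x.1 ∈ Φ.U n ∧ x.2 ∈ Φ.U n} := by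
        refine ⟨?_, hx.2 n h _ (Φ.time_mem _ _ _ _)⟩
        change p (Φ.stepN x n) ∈ _
        rw [proj_stepN hx]
        exact hx.2 n h _ (Φ.time_mem _ _ _ _)
      have hσ : ContinuousAt (Φ.slide n) (F x) :=
        (Φ.cont n).continuousAt ((isOpen_dom n).mem_nhds hFx)
      have hc : ContinuousWithinAt (fun x => Φ.slide n (F x)) Φ.good x :=
        hσ.comp_continuousWithinAt hF
      have hev : ∀ᶠ y in 𝓝[Φ.good] x, Φ.stepN y (n + 1) = Φ.slide n (F y) := by
        filter_upwards [hF ((isOpen_dom n).mem_nhds hFx), self_mem_nhdsWithin] with y hy hyg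
        rw [stepN]
        split_ifs with h'
        · rfl
        · have h2 : (F y).2 = p (F y).1 := by
            change _ = p (Φ.stepN y n)
            rw [proj_stepN hyg]
            simp only [F, tau]
            rw [Finset.sum_range_succ, image_eq_zero_of_notMem_tsupport h', add_zero]
          have h3 := Φ.stay n (F y).1 hy.1
          rw [← h2] at h3
          exact h3.symm
      exact hc.congr_of_eventuallyEq hev (hev.self_of_nhdsWithin hx)
    · have hev : ∀ᶠ y in 𝓝[Φ.good] x, Φ.stepN y (n + 1) = Φ.stepN y n := by
        refine eventually_nhdsWithin_of_eventually_nhds ?_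
        filter_upwards [hb.continuousAt.preimage_mem_nhds
          ((isClosed_tsupport (Φ.pou n)).isOpen_compl.mem_nhds h)] with y hy
        rw [stepN, if_neg hy]
      exact (ih x hx).congr_of_eventuallyEq hev (hev.self_of_nhdsWithin hx)

variable (Φ) in
/-- A bound for the number of slicings in use near a point. -/
noncomputable def bound (b : B) : ℕ := (Φ.exists_bound b).choose

theorem bound_spec (b : B) : ∀ n ≥ Φ.bound b, b ∉ tsupport (Φ.pou n) :=
  (Φ.exists_bound b).choose_spec.self_of_nhds

variable (Φ) in
/-- Moving along the path `γ` from time `s` to a near time `s'`. -/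
noncomputable def step (x : C(I, B) × ℝ × ℝ × T) : T := Φ.stepN x (Φ.bound (evR x.1 x.2.1))

theorem proj_step {x : C(I, B) × ℝ × ℝ × T} (hx : x ∈ Φ.good) :
    p (Φ.step x) = evR x.1 x.2.2.1 := by
  rw [step, proj_stepN hx, Φ.tau_eq_one (bound_spec _)]
  congr 1
  ring

theorem step_of_const {x : C(I, B) × ℝ × ℝ × T} (hx : x ∈ Φ.good)
    (hc : ∀ s ∈ Set.uIcc x.2.1 x.2.2.1, evR x.1 s = p x.2.2.2) : Φ.step x = x.2.2.2 :=
  stepN_of_const hx hc _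

theorem continuousOn_step : ContinuousOn Φ.step Φ.good := by
  intro x hx
  obtain ⟨N, hN⟩ := Φ.exists_bound (evR x.1 x.2.1)
  have hb : Continuous fun x : C(I, B) × ℝ × ℝ × T => evR x.1 x.2.1 :=
    continuous_evR.comp (f := fun x : C(I, B) × ℝ × ℝ × T => (x.1, x.2.1)) (by fun_prop)
  have hev : ∀ᶠ y in 𝓝[Φ.good] x, Φ.step y = Φ.stepN y N := by
    refine eventually_nhdsWithin_of_eventually_nhds ?_
    filter_upwards [hb.continuousAt.eventually hN] with y hy
    rw [step]
    rcases le_total N (Φ.bound (evR y.1 y.2.1)) with h | h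
    · exact stepN_eq hy h
    · exact (stepN_eq (bound_spec _) h).symm
  exact (continuousOn_stepN N x hx).congr_of_eventuallyEq hev (hev.self_of_nhdsWithin hx)

variable (Φ) in
/-- Step sizes for which moves along `γ` make sense. -/
def stepSize (γ : C(I, B)) : Set ℝ :=
  {c | 0 < c ∧ ∀ s s' : I, |(s : ℝ) - s'| ≤ c →
    ∀ n, γ s ∈ tsupport (Φ.pou n) → γ s' ∈ Φ.U n}

/-- Convexity allows locally constant step sizes to be averaged, by a partition of unity on the
metrizable path space, to a continuous one. -/
theorem convex_stepSize (γ : C(I, B)) : Convex ℝ (Φ.stepSize γ) := by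
  refine Set.OrdConnected.convex ⟨fun a ha b hb c hc => ⟨ha.1.trans_le hc.1, fun s s' h => ?_⟩⟩
  exact hb.2 s s' (h.trans hc.2)

/-- Only finitely many `n` matter near `b`, and for each of them the closed support of `pou n` lies
in the open set `U n`. -/
theorem diag_mem (b : B) :
    ∀ᶠ x : B × B in 𝓝 (b, b), ∀ n, x.1 ∈ tsupport (Φ.pou n) → x.2 ∈ Φ.U n := by
  obtain ⟨N, hN⟩ := Φ.exists_bound b
  have h1 : ∀ᶠ x : B × B in 𝓝 (b, b), ∀ n ≥ N, x.1 ∉ tsupport (Φ.pou n) :=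
    (continuous_fst.tendsto (b, b)).eventually hN
  have h2 : ∀ n, ∀ᶠ x : B × B in 𝓝 (b, b), x.1 ∈ tsupport (Φ.pou n) → x.2 ∈ Φ.U n := by
    intro n
    by_cases h : b ∈ tsupport (Φ.pou n)
    · have := (continuous_snd.tendsto (b, b)).eventually
        ((Φ.isOpen n).mem_nhds (Φ.subord n h))
      filter_upwards [this] with x hx _ using hx
    · have := (continuous_fst.tendsto (b, b)).eventually
        ((isClosed_tsupport (Φ.pou n)).isOpen_compl.mem_nhds h)
      filter_upwards [this] with x hx hx' using absurd hx' hx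
  have h3 : ∀ᶠ x : B × B in 𝓝 (b, b), ∀ n < N, x.1 ∈ tsupport (Φ.pou n) → x.2 ∈ Φ.U n :=
    (Filter.eventually_all_finite (Set.finite_Iio N)).2 fun n _ => h2 n
  filter_upwards [h1, h3] with x hx1 hx3 n hn
  exact hx3 n (by by_contra h; exact hx1 n (not_lt.1 h) hn) hn

/-- A Lebesgue number argument: compactness of the interval makes the estimate from `diag_mem`
uniform in time, for all paths near `γ`. -/
theorem exists_local_stepSize (γ : C(I, B)) : ∃ c : ℝ, ∀ᶠ γ' in 𝓝 γ, c ∈ Φ.stepSize γ' := by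
  have key : ∀ s : I, ∃ c > (0 : ℝ), ∀ᶠ x : C(I, B) × I in 𝓝 (γ, s), ∀ s' : I,
      |(x.2 : ℝ) - s'| ≤ c → ∀ n, x.1 x.2 ∈ tsupport (Φ.pou n) → x.1 s' ∈ Φ.U n := by
    intro s
    have hc : Continuous fun x : C(I, B) × I × I => (x.1 x.2.1, x.1 x.2.2) := by fun_prop
    have := (hc.continuousAt (x := (γ, s, s))).eventually (diag_mem (Φ := Φ) (γ s))
    rw [nhds_prod_eq, nhds_prod_eq, Filter.eventually_prod_iff] at this
    obtain ⟨P, hP, R, hR, hPR⟩ := this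
    rw [← nhds_prod_eq, Metric.eventually_nhds_iff] at hR
    obtain ⟨ε, hε, hR⟩ := hR
    refine ⟨ε / 2, by positivity, ?_⟩
    rw [nhds_prod_eq]
    refine (hP.prod_mk (Metric.ball_mem_nhds s (ε := ε / 2) (by positivity))).mono ?_
    rintro ⟨γ', s1⟩ ⟨h1, h2⟩ s' hs'
    refine hPR (y := (s1, s')) h1 (hR ?_)
    rw [Prod.dist_eq, max_lt_iff]
    have h2' : dist s1 s < ε / 2 := h2
    refine ⟨by linarith, ?_⟩
    have h3 : dist s1 s' ≤ ε / 2 := by rw [Subtype.dist_eq, Real.dist_eq]; exact hs'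
    have h4 := dist_triangle s' s1 s
    rw [dist_comm s' s1] at h4
    linarith
  choose c hc hk using key
  have hk' : ∀ s : I, ∃ V ∈ 𝓝 s, ∃ W ∈ 𝓝 γ, ∀ γ' ∈ W, ∀ s1 ∈ V, ∀ s' : I,
      |(s1 : ℝ) - s'| ≤ c s → ∀ n, γ' s1 ∈ tsupport (Φ.pou n) → γ' s' ∈ Φ.U n := by
    intro s
    have := hk s
    rw [nhds_prod_eq, Filter.eventually_prod_iff] at this
    obtain ⟨P, hP, R, hR, hPR⟩ := this
    exact ⟨_, hR, _, hP, fun γ' h s1 h1 => hPR h h1⟩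
  choose V hV W hW hVW using hk'
  obtain ⟨t, ht⟩ := isCompact_univ.elim_nhds_subcover V (fun s _ => hV s)
  have ht' : ∀ s : I, ∃ a ∈ t, s ∈ V a := fun s => by simpa using ht.2 (Set.mem_univ s)
  have hne : t.Nonempty := ⟨(ht' 0).choose, (ht' 0).choose_spec.1⟩
  refine ⟨t.inf' hne c, ?_⟩
  filter_upwards [(Filter.biInter_finset_mem t).2 fun a _ => hW a] with γ' hγ'
  refine ⟨(Finset.lt_inf'_iff hne).2 fun a _ => hc a, fun s s' h n hn => ?_⟩
  obtain ⟨a, ha, hsa⟩ := ht' s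
  exact hVW a γ' (Set.mem_iInter₂.1 hγ' a ha) s hsa s' (h.trans (Finset.inf'_le c ha)) n hn

variable (Φ) in
theorem exists_stepSize [TopologicalSpace.MetrizableSpace B] :
    ∃ δ : C(C(I, B), ℝ), ∀ γ, δ γ ∈ Φ.stepSize γ := by
  let := TopologicalSpace.metrizableSpaceMetric B
  exact exists_continuous_forall_mem_convex_of_local_const convex_stepSize exists_local_stepSize

variable (Φ) in
/-- The lift of `γ`, up to time `s`, after `n` steps. -/
noncomputable def iter (δ : C(C(I, B), ℝ)) (x : (C(I, B) × T) × I) : ℕ → T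
  | 0 => x.1.2
  -- Both times are cut off at the target time, so that steps after it are constant and one formula
  -- serves all targets.
  | n + 1 => Φ.step (x.1.1, min (x.2 : ℝ) (n * δ x.1.1), min (x.2 : ℝ) ((n + 1) * δ x.1.1),
      iter δ x n)

variable {δ : C(C(I, B), ℝ)} (hδ : ∀ γ, δ γ ∈ Φ.stepSize γ)
include hδ

theorem good_of_stepSize {γ : C(I, B)} {s s' : ℝ} {e : T} (he : p e = evR γ s)
    (hs : s ≤ s') (hss : s' - s ≤ δ γ) : (γ, s, s', e) ∈ Φ.good := by
  refine ⟨he, fun n hn r hr => (hδ γ).2 _ _ ?_ n hn⟩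
  rw [Set.uIcc_of_le hs] at hr
  have h1 : |(Set.projIcc 0 1 zero_le_one s : ℝ) - Set.projIcc 0 1 zero_le_one r| ≤ |s - r| := by
    simp only [Set.coe_projIcc]
    have := abs_max_sub_max_le_max (0 : ℝ) (min 1 s) 0 (min 1 r)
    have h2 := abs_min_sub_min_le_max (1 : ℝ) s 1 r
    simp only [sub_self, abs_zero, abs_nonneg, max_eq_right] at this h2
    exact this.trans h2
  refine h1.trans ?_
  rw [abs_sub_comm, abs_of_nonneg (sub_nonneg.2 hr.1)]
  linarith [hr.2]

theorem good_iter {x : (C(I, B) × T) × I} (n : ℕ)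
    (h : p (Φ.iter δ x n) = evR x.1.1 (min (x.2 : ℝ) (n * δ x.1.1))) :
    (x.1.1, min (x.2 : ℝ) (n * δ x.1.1), min (x.2 : ℝ) ((n + 1) * δ x.1.1), Φ.iter δ x n) ∈
      Φ.good := by
  have h0 := (hδ x.1.1).1
  refine good_of_stepSize hδ h ?_ ?_
  · exact min_le_min le_rfl (by nlinarith)
  · rcases le_total (x.2 : ℝ) (n * δ x.1.1) with h' | h'
    · rw [min_eq_left h']
      linarith [min_le_left (x.2 : ℝ) ((n + 1) * δ x.1.1)]
    · rw [min_eq_right h']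
      linarith [min_le_right (x.2 : ℝ) ((n + 1) * δ x.1.1)]

theorem proj_iter {x : (C(I, B) × T) × I} (hx : p x.1.2 = x.1.1 0) (n : ℕ) :
    p (Φ.iter δ x n) = evR x.1.1 (min (x.2 : ℝ) (n * δ x.1.1)) := by
  induction n with
  | zero =>
    have : min (x.2 : ℝ) ((0 : ℕ) * δ x.1.1) = ((0 : I) : ℝ) := by simp [x.2.2.1]
    rw [this, evR_coe]
    exact hx
  | succ n ih =>
    rw [iter, proj_step (good_iter hδ n ih)]
    simp

theorem continuousOn_iter (n : ℕ) :
    ContinuousOn (fun x => Φ.iter δ x n) {x : (C(I, B) × T) × I | p x.1.2 = x.1.1 0} := by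
  induction n with
  | zero => exact Continuous.continuousOn (by unfold iter; fun_prop)
  | succ n ih =>
    refine continuousOn_step.comp (f := fun x : (C(I, B) × T) × I => (x.1.1,
      min (x.2 : ℝ) (n * δ x.1.1), min (x.2 : ℝ) ((n + 1) * δ x.1.1), Φ.iter δ x n)) ?_
      fun x hx => good_iter hδ n (proj_iter hδ hx n)
    exact ContinuousOn.prodMk (by fun_prop) (ContinuousOn.prodMk (by fun_prop)
      (ContinuousOn.prodMk (by fun_prop) ih))

theorem iter_of_const {x : (C(I, B) × T) × I} (hx : p x.1.2 = x.1.1 0)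
    (hc : ∀ s ≤ x.2, x.1.1 s = p x.1.2) (n : ℕ) : Φ.iter δ x n = x.1.2 := by
  induction n with
  | zero => rfl
  | succ n ih =>
    rw [iter, step_of_const (good_iter hδ n (proj_iter hδ hx n)), ih]
    intro s hs
    simp only [ih]
    refine hc _ ?_
    have h1 : s ≤ x.2 := (Set.uIcc_subset_Icc ⟨min_le_min (le_refl _) le_rfl, min_le_left _ _⟩
      ⟨min_le_min le_rfl (by nlinarith [(hδ x.1.1).1]), min_le_left _ _⟩ hs).2
    rw [← Subtype.coe_le_coe, Set.coe_projIcc]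
    exact max_le x.2.2.1 ((min_le_right _ _).trans h1)

/-- Once `n` steps cover the unit interval, the start and the end of every further step are cut off
at the same time, and such a step is constant. -/
theorem iter_succ {x : (C(I, B) × T) × I} (hx : p x.1.2 = x.1.1 0) {n : ℕ}
    (hn : 1 ≤ n * δ x.1.1) {m : ℕ} (hm : n ≤ m) : Φ.iter δ x m = Φ.iter δ x n := by
  induction m, hm using Nat.le_induction with
  | base => rfl
  | succ m hm ih =>
    have hm' : (n : ℝ) * δ x.1.1 ≤ m * δ x.1.1 :=
      mul_le_mul_of_nonneg_right (by exact_mod_cast hm) (hδ x.1.1).1.le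
    have h1 : (x.2 : ℝ) ≤ m * δ x.1.1 := x.2.2.2.trans (hn.trans hm')
    have h2 : (x.2 : ℝ) ≤ (m + 1) * δ x.1.1 := by nlinarith [(hδ x.1.1).1]
    have hp := proj_iter hδ hx m
    rw [iter, step_of_const (good_iter hδ m hp), ih]
    intro s hs
    simp only [min_eq_left h1, min_eq_left h2, Set.uIcc_self, Set.mem_singleton_iff] at hs
    simp only [hp, min_eq_left h1, hs]

end SlicingFamily

/-- A map with local slicings over a metrizable base admits a continuous choice of lifts of paths
that lifts constant paths to constant paths. -/
theorem HasLocalSlicing.exists_lifting [TopologicalSpace.MetrizableSpace B]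
    [SecondCountableTopology B]
    {p : C(T, B)} (hp : HasLocalSlicing p) : ∃ Λ : (C(I, B) × T) × I → T,
      ContinuousOn Λ {x | p x.1.2 = x.1.1 0} ∧
      (∀ γ e, p e = γ 0 → ∀ s, p (Λ ((γ, e), s)) = γ s) ∧
      (∀ γ e, p e = γ 0 → Λ ((γ, e), 0) = e) ∧
      ∀ γ e, (∀ s, γ s = p e) → ∀ s, Λ ((γ, e), s) = e := by
  rcases isEmpty_or_nonempty B with hB | hB
  · have : IsEmpty T := p.toFun.isEmpty
    exact ⟨fun x => x.1.2, fun x => (this.false x.1.2).elim, fun _ e => (this.false e).elim,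
      fun _ e => (this.false e).elim, fun _ e => (this.false e).elim⟩
  obtain ⟨Φ⟩ := hp.exists_family
  obtain ⟨δ, hδ⟩ := Φ.exists_stepSize
  have hN : ∀ γ : C(I, B), ∃ n : ℕ, 1 < n * δ γ := fun γ => by
    obtain ⟨n, hn⟩ := exists_nat_gt (1 / δ γ)
    exact ⟨n, by rwa [div_lt_iff₀ (hδ γ).1] at hn⟩
  choose N hN using hN
  -- The number `N γ` of steps is not continuous in `γ`. But the strict inequality `1 < N γ * δ`
  -- persists for nearby paths, and further steps change nothing, so near `γ` the fixed number `N γ`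
  -- may be used.
  refine ⟨fun x => Φ.iter δ x (N x.1.1), ?_, ?_, ?_, ?_⟩
  · intro x hx
    have hev : ∀ᶠ y in 𝓝[{x | p x.1.2 = x.1.1 0}] x,
        Φ.iter δ y (N y.1.1) = Φ.iter δ y (N x.1.1) := by
      have h1 : ∀ᶠ y : (C(I, B) × T) × I in 𝓝 x, 1 < N x.1.1 * δ y.1.1 :=
        (by fun_prop : Continuous fun y : (C(I, B) × T) × I => N x.1.1 * δ y.1.1).continuousAt
          |>.eventually (lt_mem_nhds (hN x.1.1))
      filter_upwards [eventually_nhdsWithin_of_eventually_nhds h1, self_mem_nhdsWithin]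
        with y hy1 hy2
      rcases le_total (N x.1.1) (N y.1.1) with h | h
      · exact SlicingFamily.iter_succ hδ hy2 hy1.le h
      · exact (SlicingFamily.iter_succ hδ hy2 (hN y.1.1).le h).symm
    exact (SlicingFamily.continuousOn_iter hδ _ x hx).congr_of_eventuallyEq hev
      (hev.self_of_nhdsWithin hx)
  · intro γ e he s
    change p (Φ.iter δ ((γ, e), s) (N γ)) = _
    rw [SlicingFamily.proj_iter hδ he]
    simp only
    rw [min_eq_left (s.2.2.trans (hN γ).le), evR_coe]
  · intro γ e he
    refine SlicingFamily.iter_of_const hδ (x := ((γ, e), 0)) he (fun s hs => ?_) _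
    rw [he, le_antisymm hs s.2.1]
  · intro γ e he s
    exact SlicingFamily.iter_of_const hδ (x := ((γ, e), s)) (he 0).symm (fun s _ => he s) _

end Uniformization


/-! ### Topology of configuration spaces -/

section CfgTopology

open scoped unitInterval

/-- Ordered configurations. -/
abbrev OrdCfg (k : ℕ) (Y : Type u) := {f : Fin k → Y // Function.Injective f}

variable {Y : Type u}

theorem Cfg.ofInj_eq_iff {k : ℕ} {f g : OrdCfg k Y} :
    Cfg.ofInj k f = Cfg.ofInj k g ↔ ∃ e : Equiv.Perm (Fin k), g.1 = f.1 ∘ e := by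
  constructor
  · intro h
    have hr : Set.range g.1 = Set.range f.1 := (congrArg Cfg.carrier h).symm
    refine ⟨(Equiv.ofInjective g.1 g.2).trans
      ((Equiv.setCongr hr).trans (Equiv.ofInjective f.1 f.2).symm), funext fun i => ?_⟩
    simp [Equiv.apply_ofInjective_symm]
  · rintro ⟨e, he⟩
    refine Cfg.ext ?_
    change Set.range f.1 = Set.range g.1
    rw [he, e.surjective.range_comp]

theorem Cfg.ncard_ofInj {k : ℕ} (f : OrdCfg k Y) : (Cfg.ofInj k f).carrier.ncard = k := by
  have h1 := Set.ncard_image_of_injective Set.univ f.2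
  rw [Set.image_univ, Set.ncard_univ, Nat.card_eq_fintype_card, Fintype.card_fin] at h1
  exact h1

theorem Cfg.level_unique {k l : ℕ} {f : OrdCfg k Y} {g : OrdCfg l Y}
    (h : Cfg.ofInj k f = Cfg.ofInj l g) : k = l := by
  rw [← Cfg.ncard_ofInj f, h, Cfg.ncard_ofInj]

variable [TopologicalSpace Y]

/-- The saturation of a closed set under the finite symmetric group is a finite union of closed
sets. -/
theorem Cfg.isClosedMap_ofInj (k : ℕ) : IsClosedMap (Cfg.ofInj k : _ → Cfg Y) := by
  intro C hC
  rw [← isOpen_compl_iff]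
  refine isOpen_iSup_iff.2 fun l => isOpen_coinduced.2 ?_
  rw [Set.preimage_compl, isOpen_compl_iff]
  by_cases hkl : l = k
  · subst hkl
    have : Cfg.ofInj l ⁻¹' (Cfg.ofInj l '' C) = ⋃ e : Equiv.Perm (Fin l),
        (fun f : OrdCfg l Y => (⟨f.1 ∘ e, f.2.comp e.injective⟩ : OrdCfg l Y)) ⁻¹' C := by
      ext f
      simp only [Set.mem_preimage, Set.mem_image, Set.mem_iUnion]
      constructor
      · rintro ⟨g, hg, hgf⟩
        obtain ⟨e, he⟩ := Cfg.ofInj_eq_iff.1 hgf.symm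
        refine ⟨e, ?_⟩
        convert hg using 1
        exact Subtype.ext he.symm
      · rintro ⟨e, he⟩
        exact ⟨_, he, (Cfg.ofInj_eq_iff.2 ⟨e, rfl⟩).symm⟩
    rw [this]
    refine isClosed_iUnion_of_finite fun e => hC.preimage (Continuous.subtype_mk ?_ _)
    exact continuous_pi fun i => (continuous_apply (e i)).comp continuous_subtype_val
  · convert isClosed_empty
    ext f
    simp only [Set.mem_preimage, Set.mem_image, Set.mem_empty_iff_false, iff_false, not_exists,
      not_and]
    exact fun g _ hgf => hkl (Cfg.level_unique hgf).symm

instance [T2Space Y] : T1Space (Cfg Y) where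
  t1 z := by
    obtain ⟨k, f, rfl⟩ := z.exists_ofInj
    rw [← Set.image_singleton]
    exact Cfg.isClosedMap_ofInj k _ isClosed_singleton

/-- Forgetting the order is open and closed, so it takes closed neighbourhoods to closed
neighbourhoods. Together with second countability this leads to metrizability of the base of the
fibration. -/
instance [T3Space Y] : T3Space (Cfg Y) := by
  have : RegularSpace (Cfg Y) := by
    refine .of_exists_mem_nhds_isClosed_subset fun z S hS => ?_
    obtain ⟨k, f, rfl⟩ := z.exists_ofInj
    obtain ⟨C, hC, hCc, hCS⟩ := exists_mem_nhds_isClosed_subset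
      ((Cfg.continuous_ofInj k).continuousAt.preimage_mem_nhds hS)
    exact ⟨_, (Cfg.isOpenMap_ofInj k).image_mem_nhds hC, Cfg.isClosedMap_ofInj k _ hCc,
      Set.image_subset_iff.2 hCS⟩
  exact {}

instance [SecondCountableTopology Y] : SecondCountableTopology (Cfg Y) := by
  have h0 : ∀ k, SecondCountableTopology (OrdCfg k Y) := fun k =>
    TopologicalSpace.Subtype.secondCountableTopology _
  let F : (Σ k, OrdCfg k Y) → Cfg Y := fun x => Cfg.ofInj x.1 x.2
  have h1 : Continuous F := continuous_sigma fun k => Cfg.continuous_ofInj k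
  have h2 : IsOpenMap F := isOpenMap_sigma.2 fun k => Cfg.isOpenMap_ofInj k
  have h3 : Function.Surjective F := fun z => by
    obtain ⟨k, f, rfl⟩ := z.exists_ofInj
    exact ⟨⟨k, f⟩, rfl⟩
  exact (h2.isQuotientMap h1 h3).secondCountableTopology h2

theorem Cfg.exists_disjoint_nhds [T2Space Y] {k : ℕ} (f : OrdCfg k Y) :
    ∃ V : Fin k → Set Y, (∀ i, IsOpen (V i) ∧ f.1 i ∈ V i) ∧
      ∀ i j y, y ∈ V i → y ∈ V j → i = j := by
  obtain ⟨U, hU, hd⟩ := (Set.finite_range f.1).t2_separation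
  refine ⟨fun i => U (f.1 i), fun i => ⟨(hU _).2, (hU _).1⟩, fun i j y hi hj => ?_⟩
  by_contra hij
  exact Set.disjoint_left.1 (hd ⟨i, rfl⟩ ⟨j, rfl⟩ (f.2.ne hij)) hi hj

/-- Near an ordered configuration, configurations can be ordered continuously. -/
theorem Cfg.exists_local_order [T2Space Y] {k : ℕ} (f : OrdCfg k Y) :
    ∃ U : Set (Cfg Y), IsOpen U ∧ Cfg.ofInj k f ∈ U ∧ ∃ c : Cfg Y → Fin k → Y,
      ContinuousOn c U ∧ c (Cfg.ofInj k f) = f.1 ∧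
      ∀ z ∈ U, Function.Injective (c z) ∧ z.carrier = Set.range (c z) := by
  obtain ⟨V, hV, hd⟩ := Cfg.exists_disjoint_nhds f
  let W : Set (OrdCfg k Y) := {g | ∀ i, g.1 i ∈ V i}
  have hW : IsOpen W := by
    have : W = ⋂ i, (fun g : OrdCfg k Y => g.1 i) ⁻¹' V i := by ext; simp [W]
    rw [this]
    exact isOpen_iInter_of_finite fun i => (hV i).1.preimage
      ((continuous_apply i).comp continuous_subtype_val)
  have hf : f ∈ W := fun i => (hV i).2
  -- Two tuples in `W` differ by a permutation only if it is the identity, because the sets `V i`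
  -- are disjoint. So forgetting the order is an open embedding of `W`, and its inverse is the
  -- ordering.
  have hemb : IsOpenEmbedding fun g : W => Cfg.ofInj k g.1 := by
    refine .of_continuous_injective_isOpenMap
      ((Cfg.continuous_ofInj k).comp continuous_subtype_val) ?_
      ((Cfg.isOpenMap_ofInj k).comp hW.isOpenMap_subtype_val)
    rintro ⟨g, hg⟩ ⟨g', hg'⟩ h
    obtain ⟨e, he⟩ := Cfg.ofInj_eq_iff.1 h
    refine Subtype.ext (Subtype.ext (funext fun i => ?_))
    have h1 := hg' i
    rw [he] at h1
    have : e i = i := hd _ _ _ (hg (e i)) h1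
    change g.1 i = g'.1 i
    rw [he, Function.comp_apply, this]
  have : Nonempty W := ⟨⟨f, hf⟩⟩
  let φ := hemb.toOpenPartialHomeomorph
  refine ⟨Set.range fun g : W => Cfg.ofInj k g.1, hemb.isOpen_range, ⟨⟨f, hf⟩, rfl⟩,
    fun z => (φ.symm z).1.1, ?_, ?_, ?_⟩
  · exact (continuous_subtype_val.comp continuous_subtype_val).comp_continuousOn
      (hemb.toOpenPartialHomeomorph_target ▸ φ.continuousOn_symm)
  · have : φ.symm (φ ⟨f, hf⟩) = ⟨f, hf⟩ := φ.left_inv (Set.mem_univ _)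
    exact congrArg (fun g : W => g.1.1) this
  · rintro _ ⟨g, rfl⟩
    have : φ.symm (φ g) = g := φ.left_inv (Set.mem_univ _)
    have h2 : φ.symm (Cfg.ofInj k g.1) = g := this
    simp only [h2]
    exact ⟨g.1.2, rfl⟩

/-- The complements of varying configurations form an open set; this is the domain on which families
of sections are tested for continuity. -/
theorem Cfg.isOpen_notMem [T2Space Y] : IsOpen {x : Cfg Y × Y | x.2 ∉ x.1.carrier} := by
  rw [isOpen_iff_mem_nhds]
  rintro ⟨z, y⟩ hy
  obtain ⟨k, f, rfl⟩ := z.exists_ofInj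
  obtain ⟨U, hU, hfU, c, hc, hcf, hcU⟩ := Cfg.exists_local_order f
  have h1 : ∀ i, ∀ᶠ x : Cfg Y × Y in 𝓝 (Cfg.ofInj k f, y), c x.1 i ≠ x.2 := by
    intro i
    have h2 : ContinuousAt (fun x : Cfg Y × Y => (c x.1 i, x.2)) (Cfg.ofInj k f, y) := by
      have := (hc.continuousAt (hU.mem_nhds hfU))
      exact ((continuous_apply i).continuousAt.comp
        (this.comp (x := (Cfg.ofInj k f, y)) continuous_fst.continuousAt)).prodMk
          continuous_snd.continuousAt
    refine h2.eventually (isOpen_ne_fun continuous_fst continuous_snd |>.mem_nhds ?_)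
    change c _ i ≠ y
    rw [hcf]
    rintro rfl
    exact hy ⟨i, rfl⟩
  filter_upwards [Filter.eventually_all.2 h1,
    (continuous_fst.tendsto (Cfg.ofInj k f, y)).eventually (hU.mem_nhds hfU)] with x hx hxU
  rw [(hcU _ hxU).2]
  rintro ⟨i, hi⟩
  exact hx i hi

theorem Cfg.isOpen_range_ofInj (k : ℕ) : IsOpen (Set.range (Cfg.ofInj k : OrdCfg k Y → Cfg Y)) :=
  (Cfg.isOpenMap_ofInj k).isOpen_range

/-- The points of a path of configurations can be ordered continuously. -/
theorem Cfg.exists_tracks [T2Space Y] (q : C(I, Cfg Y)) :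
    ∃ k, ∃ c : C(I, OrdCfg k Y), ∀ s, q s = Cfg.ofInj k (c s) := by
  obtain ⟨k, f, hf⟩ := (q 0).exists_ofInj
  have hmem : ∀ s, q s ∈ Set.range (Cfg.ofInj k) := by
    -- The configurations of exactly `k` points are open and closed, so the number of points is
    -- constant along the path.
    have hclopen : IsClopen (q ⁻¹' Set.range (Cfg.ofInj k)) := by
      refine ⟨?_, (Cfg.isOpen_range_ofInj k).preimage q.continuous⟩
      exact ((Cfg.isClosedMap_ofInj k).isClosed_range).preimage q.continuous
    have := hclopen.eq_univ ⟨0, f, hf.symm⟩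
    exact fun s => (Set.ext_iff.1 this s).2 trivial
  let : MulAction (Equiv.Perm (Fin k)) (OrdCfg k Y) :=
    { smul e g := ⟨g.1 ∘ e.symm, g.2.comp e.symm.injective⟩
      one_smul g := rfl
      mul_smul e e' g := rfl }
  let P : OrdCfg k Y → Set.range (Cfg.ofInj k : OrdCfg k Y → Cfg Y) := Set.rangeFactorization _
  have hPc : Continuous P := (Cfg.continuous_ofInj k).subtype_mk _
  have hPo : IsOpenMap P := fun U hU => by
    have : P '' U = Subtype.val ⁻¹' (Cfg.ofInj k '' U) := by
      ext ⟨z, hz⟩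
      simp only [Set.mem_image, Set.mem_preimage, P, Set.rangeFactorization, Subtype.mk.injEq]
    rw [this]
    exact (Cfg.isOpenMap_ofInj k U hU).preimage continuous_subtype_val
  -- The symmetric group permutes the entries freely, and small neighbourhoods have disjoint
  -- translates. Hence forgetting the order is a covering and paths lift.
  have hq : IsQuotientCoveringMap P (Equiv.Perm (Fin k)) :=
    { toIsQuotientMap := hPo.isQuotientMap hPc Set.rangeFactorization_surjective
      continuous_const_smul := fun e => by
        have : Continuous fun g : OrdCfg k Y => g.1 ∘ e.symm :=
          continuous_pi fun i => (continuous_apply (e.symm i)).comp continuous_subtype_val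
        exact this.subtype_mk _
      apply_eq_iff_mem_orbit := fun {g g'} => by
        rw [Subtype.ext_iff]
        change Cfg.ofInj k g = Cfg.ofInj k g' ↔ _
        rw [eq_comm, Cfg.ofInj_eq_iff]
        constructor
        · rintro ⟨e, he⟩
          exact ⟨e.symm, Subtype.ext he.symm⟩
        · rintro ⟨e, rfl⟩
          exact ⟨e.symm, rfl⟩
      disjoint := fun g => by
        obtain ⟨V, hV, hd⟩ := Cfg.exists_disjoint_nhds g
        refine ⟨⋂ i, (fun g : OrdCfg k Y => g.1 i) ⁻¹' V i, (isOpen_iInter_of_finite fun i =>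
          (hV i).1.preimage ((continuous_apply i).comp continuous_subtype_val)).mem_nhds
          (Set.mem_iInter.2 fun i => (hV i).2), fun e => ?_⟩
        rintro ⟨_, ⟨h, h1, rfl⟩, h2⟩
        rw [Set.mem_iInter] at h1 h2
        have : e.symm = 1 := Equiv.ext fun i => hd _ _ _ (h1 (e.symm i)) (h2 i)
        rw [← Equiv.Perm.inv_def, inv_eq_one] at this
        exact this }
  obtain ⟨Γ, hΓ, -⟩ := hq.isCoveringMap.exists_path_lifts
    ⟨fun s => ⟨q s, hmem s⟩, q.continuous.subtype_mk _⟩ f (Subtype.ext hf)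
  exact ⟨k, Γ, fun s => (congrArg Subtype.val (congrFun hΓ s)).symm⟩

end CfgTopology

/-! ### Topology of spaces of configuration-sections -/

section ConfSectionTopology

variable {Y : Type u} [TopologicalSpace Y] {T : Type v} [TopologicalSpace T] {π : T → Y}

theorem ConfSection.ext' {x x' : ConfSection π} (h : x.cfg = x'.cfg)
    (hs : ∀ y h h', x.sec ⟨y, h⟩ = x'.sec ⟨y, h'⟩) : x = x' := by
  obtain ⟨z, s, hs1⟩ := x
  obtain ⟨z', s', hs2⟩ := x'
  obtain rfl : z = z' := h
  congr 1
  exact ContinuousMap.ext fun y => hs y.1 y.2 y.2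

/-- Evaluation is jointly continuous as for the compact-open topology on a locally compact space: a
small compact neighbourhood of `y` defines a basic open set of sections. -/
theorem ConfSection.continuous_sec [T2Space Y] [LocallyCompactSpace Y] :
    Continuous fun x : {x : ConfSection π × Y // x.2 ∉ x.1.cfg.carrier} =>
      x.1.1.sec ⟨x.1.2, x.2⟩ := by
  rw [continuous_iff_continuousAt]
  rintro ⟨⟨x, y⟩, hy⟩
  refine tendsto_nhds.2 fun U hU hxU => ?_
  have hz : IsOpen (x.cfg.carrier)ᶜ := x.cfg.finite.isClosed.isOpen_compl
  have h1 : ∃ N ∈ 𝓝 y, ∀ y' ∈ N, ∃ h, x.sec ⟨y', h⟩ ∈ U := by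
    have h2 : x.sec ⁻¹' U ∈ 𝓝 ⟨y, hy⟩ := x.sec.continuous.continuousAt.preimage_mem_nhds
      (hU.mem_nhds hxU)
    have h3 := (hz.isOpenEmbedding_subtypeVal.map_nhds_eq ⟨y, hy⟩)
    refine ⟨Subtype.val '' (x.sec ⁻¹' U), ?_, ?_⟩
    · have := Filter.image_mem_map (m := Subtype.val) h2
      exact h3 ▸ this
    · rintro _ ⟨y', hy', rfl⟩
      exact ⟨y'.2, hy'⟩
  obtain ⟨N, hN, hNU⟩ := h1
  obtain ⟨K, hK, hKN, hKc⟩ := local_compact_nhds hN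
  have hW : IsOpen {x' : ConfSection π | ∀ y' ∈ K, ∃ h, x'.sec ⟨y', h⟩ ∈ U} :=
    (inf_le_right : instTopologicalSpaceConfSection π ≤ _) _
      (TopologicalSpace.isOpen_generateFrom_of_mem ⟨K, U, hKc, hU, rfl⟩)
  have h4 : ∀ᶠ a : ConfSection π × Y in 𝓝 (x, y),
      (∀ y' ∈ K, ∃ h, a.1.sec ⟨y', h⟩ ∈ U) ∧ a.2 ∈ K :=
    ((continuous_fst.tendsto (x, y)).eventually
      (hW.mem_nhds fun y' hy' => hNU y' (hKN hy'))).and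
      ((continuous_snd.tendsto (x, y)).eventually hK)
  have h5 := (continuous_subtype_val.tendsto
    (⟨(x, y), hy⟩ : {x : ConfSection π × Y // x.2 ∉ x.1.cfg.carrier})).eventually h4
  filter_upwards [h5] with a ha
  obtain ⟨h, hh⟩ := ha.1 _ ha.2
  exact hh

/-- The converse of `continuous_sec`, by the tube lemma inside the open domain of the family of
sections. All continuity statements about configuration-sections are reduced to these two. -/
theorem ConfSection.continuous_mk [T2Space Y] {A : Type*} [TopologicalSpace A]
    {f : A → ConfSection π} (hc : Continuous fun a => (f a).cfg)
    (hs : Continuous fun x : {x : A × Y // x.2 ∉ (f x.1).cfg.carrier} =>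
      (f x.1.1).sec ⟨x.1.2, x.2⟩) : Continuous f := by
  refine continuous_inf_rng.2 ⟨continuous_induced_rng.2 hc, continuous_generateFrom_iff.2 ?_⟩
  rintro _ ⟨K, U, hK, hU, rfl⟩
  have hO : IsOpen {x : A × Y | x.2 ∉ (f x.1).cfg.carrier} :=
    Cfg.isOpen_notMem.preimage ((hc.comp continuous_fst).prodMk continuous_snd)
  have hV : IsOpen {x : A × Y | ∃ h : x.2 ∉ (f x.1).cfg.carrier, (f x.1).sec ⟨x.2, h⟩ ∈ U} := by
    have := hO.isOpenMap_subtype_val _ (hU.preimage hs)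
    convert this using 1
    ext x
    constructor
    · rintro ⟨h, hh⟩
      exact ⟨⟨x, h⟩, hh, rfl⟩
    · rintro ⟨⟨x, h⟩, hh, rfl⟩
      exact ⟨h, hh⟩
  rw [isOpen_iff_mem_nhds]
  intro a ha
  obtain ⟨P, R, hP, -, haP, hKR, hPR⟩ := generalized_tube_lemma (isCompact_singleton (x := a)) hK hV
    (by rintro ⟨a', y⟩ ⟨rfl, hy⟩; exact ha y hy)
  filter_upwards [hP.mem_nhds (haP rfl)] with a' ha' y hy
  exact hPR (show (a', y) ∈ P ×ˢ R from ⟨ha', hKR hy⟩)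

end ConfSectionTopology


/-! ### Charts of the manifold and of its extension by a cylinder -/

section Charts

/-- The half-space as a product, with the distance from the boundary as the second factor. -/
noncomputable def halfSpaceHomeo (m : ℕ) :
    EuclideanHalfSpace (m + 2) ≃ₜ (Fin (m + 1) → ℝ) × ℝ≥0 where
  toFun x := (fun j => x.1 j.succ, ⟨x.1 0, x.2⟩)
  invFun y := ⟨WithLp.toLp 2 (Fin.cons (y.2 : ℝ) y.1), by simp⟩
  left_inv x := by
    refine Subtype.ext ?_
    ext j
    refine Fin.cases ?_ (fun j => ?_) j
    · rfl
    · simp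
  right_inv y := by
    refine Prod.ext (funext fun j => by simp) (Subtype.ext ?_)
    rfl
  continuous_toFun := by
    refine Continuous.prodMk (continuous_pi fun j => ?_) (Continuous.subtype_mk ?_ _)
    · exact (PiLp.continuous_apply 2 _ _).comp continuous_subtype_val
    · exact (PiLp.continuous_apply 2 _ _).comp continuous_subtype_val
  continuous_invFun := by
    refine Continuous.subtype_mk ((PiLp.continuous_toLp 2 _).comp (continuous_pi fun j => ?_)) _
    refine Fin.cases ?_ (fun j => ?_) j
    · simp only [Fin.cons_zero]; fun_prop
    · simp only [Fin.cons_succ]; fun_prop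

variable {m : ℕ} {M : Type u} [TopologicalSpace M] [ChartedSpace (EuclideanHalfSpace (m + 2)) M]

/-- The preferred chart at a point, with the half-space as a product. -/
noncomputable def prodChart (x : M) : OpenPartialHomeomorph M ((Fin (m + 1) → ℝ) × ℝ≥0) :=
  (chartAt (EuclideanHalfSpace (m + 2)) x).trans (halfSpaceHomeo m).toOpenPartialHomeomorph

theorem mem_prodChart_source (x : M) : x ∈ (prodChart (m := m) x).source := by
  simp [prodChart]

variable [IsManifold (modelWithCornersEuclideanHalfSpace (m + 2)) ∞ M]

/-- The definition of interior points refers to the preferred chart at the point itself; that any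
chart of the atlas may be used is where the smooth structure enters. -/
theorem mem_mInterior_iff {x y : M} (hy : y ∈ (prodChart (m := m) x).source) :
    y ∈ mInterior m M ↔ 0 < (prodChart (m := m) x y).2 := by
  have hy' : y ∈ (chartAt (EuclideanHalfSpace (m + 2)) x).source := by simpa [prodChart] using hy
  have hn : (∞ : WithTop ℕ∞) ≠ 0 := by simp
  change (modelWithCornersEuclideanHalfSpace (m + 2)).IsInteriorPoint y ↔ _
  have h1 : (chartAt (EuclideanHalfSpace (m + 2)) x).extend
      (modelWithCornersEuclideanHalfSpace (m + 2)) y ∈ interior (Set.range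
        (Subtype.val : EuclideanHalfSpace (m + 2) → _)) ↔
      0 < (prodChart (m := m) x y).2 := by
    rw [range_euclideanHalfSpace, interior_halfSpace]
    rfl
  rw [ModelWithCorners.isInteriorPoint_iff_of_mem_atlas hn (chart_mem_atlas _ x) hy', ← h1]
  exact ⟨fun h => OpenPartialHomeomorph.interior_extend_target_subset_interior_range _ h,
    fun h => OpenPartialHomeomorph.mem_interior_extend_target _
      ((chartAt (EuclideanHalfSpace (m + 2)) x).map_source hy') h⟩

theorem mem_mBoundary_iff {x y : M} (hy : y ∈ (prodChart (m := m) x).source) :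
    y ∈ mBoundary m M ↔ (prodChart (m := m) x y).2 = 0 := by
  rw [mBoundary, ← ModelWithCorners.compl_interior, Set.mem_compl_iff]
  change y ∉ mInterior m M ↔ _
  rw [mem_mInterior_iff hy, not_lt, nonpos_iff_eq_zero]

omit [IsManifold (modelWithCornersEuclideanHalfSpace (m + 2)) ∞ M] in
theorem notMem_mBoundary {x : M} (hx : x ∈ mInterior m M) : x ∉ mBoundary m M := by
  rw [mBoundary, ← ModelWithCorners.compl_interior]
  exact fun h => h hx

open Classical in
/-- The chart of the boundary that is induced by a chart of the manifold. -/
noncomputable def boundaryChart (x : mBoundary m M) :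
    OpenPartialHomeomorph (mBoundary m M) (Fin (m + 1) → ℝ) where
  toFun y := (prodChart x.1 y.1).1
  invFun w := if h : (prodChart x.1).symm (w, 0) ∈ mBoundary m M then ⟨_, h⟩ else x
  source := Subtype.val ⁻¹' (prodChart x.1).source
  target := {w | (w, 0) ∈ (prodChart x.1).target}
  map_source' y hy := by
    have h2 := (mem_mBoundary_iff hy).1 y.2
    change ((prodChart (m := m) x.1 y.1).1, 0) ∈ (prodChart x.1).target
    rw [← h2]
    exact (prodChart x.1).map_source hy
  map_target' w hw := by
    have h := (mem_mBoundary_iff ((prodChart x.1).map_target hw)).2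
      (by rw [(prodChart x.1).right_inv hw])
    rw [dif_pos h]
    exact (prodChart x.1).map_target hw
  left_inv' y hy := by
    have h2 := (mem_mBoundary_iff hy).1 y.2
    have h3 : (prodChart (m := m) x.1).symm ((prodChart x.1 y.1).1, 0) = y.1 := by
      rw [← h2]
      exact (prodChart x.1).left_inv hy
    rw [dif_pos (h3.symm ▸ y.2)]
    exact Subtype.ext h3
  right_inv' w hw := by
    have h := (mem_mBoundary_iff ((prodChart x.1).map_target hw)).2
      (by rw [(prodChart x.1).right_inv hw])
    rw [dif_pos h]
    simp only
    rw [(prodChart x.1).right_inv hw]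
  open_source := (prodChart x.1).open_source.preimage continuous_subtype_val
  open_target := (prodChart x.1).open_target.preimage (by fun_prop)
  continuousOn_toFun := continuous_fst.comp_continuousOn ((prodChart x.1).continuousOn.comp
    continuous_subtype_val.continuousOn fun _ h => h)
  continuousOn_invFun := by
    rw [Topology.IsInducing.subtypeVal.continuousOn_iff]
    refine ((prodChart x.1).continuousOn_symm.comp (f := fun w => (w, 0))
      (by fun_prop) fun _ h => h).congr fun w hw => ?_
    have h := (mem_mBoundary_iff ((prodChart x.1).map_target hw)).2
      (by rw [(prodChart x.1).right_inv hw])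
    simp only [Function.comp_apply]
    rw [dif_pos h]

/-- A chart of the manifold near a boundary point that extends given coordinates on the
boundary. -/
theorem exists_collarChart {disc : (Fin (m + 1) → ℝ) → mBoundary m M} (hd : IsOpenEmbedding disc)
    (y₀ : Fin (m + 1) → ℝ) : ∃ e : OpenPartialHomeomorph ((Fin (m + 1) → ℝ) × ℝ≥0) M,
      (y₀, 0) ∈ e.source ∧ (∀ y, (y, 0) ∈ e.source → e (y, 0) = disc y) ∧
      ∀ y u, (y, u) ∈ e.source → 0 < u → e (y, u) ∈ mInterior m M := by
  let φ := prodChart (m := m) (disc y₀).1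
  let g := hd.toOpenPartialHomeomorph.trans (boundaryChart (disc y₀))
  -- A chart `φ` at the boundary point already provides a collar. Only its boundary coordinates are
  -- replaced by those of `disc`; the distance from the boundary is kept.
  let e := (g.prod (OpenPartialHomeomorph.refl ℝ≥0)).trans φ.symm
  have hg : ∀ y, g y = (φ (disc y).1).1 := fun y => rfl
  have he : ∀ y u, e (y, u) = φ.symm (g y, u) := fun y u => rfl
  have hs : ∀ y u, (y, u) ∈ e.source → (disc y).1 ∈ φ.source ∧ (g y, u) ∈ φ.target := by
    intro y u h
    simp only [e, OpenPartialHomeomorph.trans_source, Set.mem_inter_iff] at h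
    have h1 : y ∈ g.source := h.1.1
    simp only [g, OpenPartialHomeomorph.trans_source, Set.mem_inter_iff] at h1
    exact ⟨h1.2, h.2⟩
  have hb : ∀ y, (disc y).1 ∈ φ.source → φ (disc y).1 = (g y, 0) := fun y h =>
    Prod.ext (hg y).symm ((mem_mBoundary_iff h).1 (disc y).2)
  refine ⟨e, ?_, fun y h => ?_, fun y u h hu => ?_⟩
  · have h0 := mem_prodChart_source (m := m) (disc y₀).1
    simp only [e, OpenPartialHomeomorph.trans_source, Set.mem_inter_iff]
    refine ⟨⟨?_, Set.mem_univ _⟩, ?_⟩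
    · simp only [g, OpenPartialHomeomorph.trans_source, Set.mem_inter_iff]
      exact ⟨Set.mem_univ _, h0⟩
    · change (g y₀, (0 : ℝ≥0)) ∈ φ.target
      rw [← hb y₀ h0]
      exact φ.map_source h0
  · rw [he, ← hb y (hs y 0 h).1, φ.left_inv (hs y 0 h).1]
  · rw [he]
    have := (hs y u h).2
    rw [mem_mInterior_iff (φ.map_target this)]
    change 0 < (φ (φ.symm _)).2
    rw [φ.right_inv this]
    exact hu

end Charts


/-! ### Topology of the extended manifold -/

section HatTopology

/-- The first coordinate of a vector is split off. -/
noncomputable def splitHomeo (m : ℕ) :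
    EuclideanSpace ℝ (Fin (m + 2)) ≃ₜ (Fin (m + 1) → ℝ) × ℝ where
  toFun x := (fun j => x j.succ, x 0)
  invFun y := WithLp.toLp 2 (Fin.cons y.2 y.1)
  left_inv x := by
    ext j
    refine Fin.cases ?_ (fun j => ?_) j <;> simp
  right_inv y := by simp
  continuous_toFun := by fun_prop
  continuous_invFun := by
    refine (PiLp.continuous_toLp 2 _).comp (continuous_pi fun j => ?_)
    refine Fin.cases ?_ (fun j => ?_) j
    · simp only [Fin.cons_zero]; fun_prop
    · simp only [Fin.cons_succ]; fun_prop

theorem isCompact_cube (m : ℕ) : IsCompact (cube m) := by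
  have : cube m = Set.Icc (fun _ => -1) (fun _ => 1) := by
    ext y
    simp only [cube, Set.mem_ofPred_eq, Set.mem_Icc, Pi.le_def]
    exact forall_and
  rw [this]
  exact isCompact_Icc

theorem isOpen_openCube (m : ℕ) : IsOpen (openCube m) := by
  have : openCube m = ⋂ j, {y : Fin (m + 1) → ℝ | -1 < y j ∧ y j < 1} := by
    ext y; simp [openCube]
  rw [this]
  exact isOpen_iInter_of_finite fun j =>
    (isOpen_lt continuous_const (continuous_apply j)).inter
      (isOpen_lt (continuous_apply j) continuous_const)

namespace Inputs

variable {m : ℕ} {M : Type u} [TopologicalSpace M] [ChartedSpace (EuclideanHalfSpace (m + 2)) M]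
  {E : Type v} [TopologicalSpace E] {X : Type w} [TopologicalSpace X] (i : Inputs m M E X)

theorem disc_eq_of_coe {y y' : Fin (m + 1) → ℝ} (h : (i.disc y).1 = (i.disc y').1) : y = y' :=
  i.disc_emb.injective (Subtype.ext h)

theorem mem_D {x : M} (h : x ∈ i.D) : x ∈ mBoundary m M := by
  obtain ⟨y, -, rfl⟩ := h
  exact (i.disc y).2

theorem disc_mem_D {y : Fin (m + 1) → ℝ} (hy : y ∈ cube m) : (i.disc y).1 ∈ i.D := ⟨y, hy, rfl⟩

theorem notMem_D {x : M} (h : x ∈ mInterior m M) : x ∉ i.D :=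
  fun h' => notMem_mBoundary h (i.mem_D h')

theorem disc_mem_D_iff {y : Fin (m + 1) → ℝ} : (i.disc y).1 ∈ i.D ↔ y ∈ cube m :=
  ⟨fun ⟨_, hy, h⟩ => i.disc_eq_of_coe h ▸ hy, i.disc_mem_D⟩

theorem isCompact_D : IsCompact i.D := by
  have : i.D = (fun y => (i.disc y).1) '' cube m := by
    ext x
    simp only [D, Set.mem_ofPred_eq, Set.mem_image, eq_comm]
  rw [this]
  exact (isCompact_cube m).image (continuous_subtype_val.comp i.disc_emb.continuous)

variable {i} in
theorem Hat.ext {p q : i.Hat} (h : i.retr p = i.retr q) (h' : i.height p = i.height q) : p = q :=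
  Subtype.ext (Prod.ext h h')

variable {i} in
theorem height_eq_zero {p : i.Hat} (h : i.retr p ∉ i.D) : i.height p = 0 := p.2.resolve_right h

open Classical in
/-- The coordinates of a point of the disc. -/
noncomputable def coord (x : M) : Fin (m + 1) → ℝ :=
  if h : x ∈ mBoundary m M then i.disc_emb.toOpenPartialHomeomorph.symm ⟨x, h⟩ else 0

@[simp]
theorem coord_disc (y : Fin (m + 1) → ℝ) : i.coord (i.disc y).1 = y := by
  rw [coord, dif_pos (i.disc y).2]
  exact i.disc_emb.toOpenPartialHomeomorph.left_inv (Set.mem_univ y)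

theorem coord_mem {x : M} (h : x ∈ i.D) : i.coord x ∈ cube m := by
  obtain ⟨y, hy, rfl⟩ := h
  rwa [coord_disc]

theorem disc_coord {x : M} (h : x ∈ i.D) : (i.disc (i.coord x)).1 = x := by
  obtain ⟨y, hy, rfl⟩ := h
  rw [coord_disc]

theorem continuousOn_coord : ContinuousOn i.coord i.D := by
  rw [continuousOn_iff_continuous_domRestrict]
  have h1 : ContinuousOn i.disc_emb.toOpenPartialHomeomorph.symm
    (i.disc_emb.toOpenPartialHomeomorph).target :=
    i.disc_emb.toOpenPartialHomeomorph.continuousOn_symm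
  have h2 : Continuous fun x : i.D => (⟨x.1, i.mem_D x.2⟩ : mBoundary m M) := by fun_prop
  have h3 := h1.comp_continuous h2 (fun x => by
    obtain ⟨y, hy, hx⟩ := x.2
    rw [i.disc_emb.toOpenPartialHomeomorph_target]
    exact ⟨y, Subtype.ext hx.symm⟩)
  convert h3 using 1
  funext x
  exact dif_pos (i.mem_D x.2)

theorem retr_cyl {y : Fin (m + 1) → ℝ} (hy : y ∈ cube m) (τ : ℝ≥0) :
    i.retr (i.cyl y τ) = (i.disc y).1 := by
  change (i.disc (clamp y)).1 = _
  rw [clamp_eq hy]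

@[simp]
theorem height_cyl (y : Fin (m + 1) → ℝ) (τ : ℝ≥0) : i.height (i.cyl y τ) = τ := rfl

theorem cyl_coord {p : i.Hat} (h : i.retr p ∈ i.D) : i.cyl (i.coord (i.retr p)) (i.height p) = p :=
  Hat.ext (by rw [i.retr_cyl (i.coord_mem h), i.disc_coord h]) rfl

theorem coord_cyl {y : Fin (m + 1) → ℝ} (hy : y ∈ cube m) (τ : ℝ≥0) :
    i.coord (i.retr (i.cyl y τ)) = y := by
  rw [i.retr_cyl hy, coord_disc]

theorem continuous_triv : Continuous fun x : {x : i.Hat × X // i.retr x.1 ∈ i.D} =>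
    i.triv x.1.1 x.2 x.1.2 := by
  have h : Continuous fun x : {x : i.Hat × X // i.retr x.1 ∈ i.D} =>
      i.θ.symm (⟨i.retr x.1.1, x.2⟩, x.1.2) := by fun_prop
  exact Continuous.subtype_mk ((continuous_fst.comp continuous_subtype_val).prodMk
    (continuous_subtype_val.comp h)) _

variable [T2Space M]

theorem isClosed_D : IsClosed i.D := i.isCompact_D.isClosed

theorem isClosedEmbedding_hat :
    IsClosedEmbedding (Subtype.val : i.Hat → M × ℝ≥0) := by
  refine IsClosed.isClosedEmbedding_subtypeVal ?_
  exact (isClosed_eq continuous_snd continuous_const).union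
    (i.isClosed_D.preimage continuous_fst)

instance : T2Space i.Hat := i.isClosedEmbedding_hat.isEmbedding.t2Space

instance : LocallyCompactSpace i.Hat := by
  have := (modelWithCornersEuclideanHalfSpace (m + 2)).locallyCompactSpace
  have := ChartedSpace.locallyCompactSpace (EuclideanHalfSpace (m + 2)) M
  exact i.isClosedEmbedding_hat.locallyCompactSpace

instance [SecondCountableTopology M] : SecondCountableTopology i.Hat :=
  i.isClosedEmbedding_hat.isEmbedding.secondCountableTopology

variable [IsManifold (modelWithCornersEuclideanHalfSpace (m + 2)) ∞ M]

omit [T2Space M] [IsManifold (modelWithCornersEuclideanHalfSpace (m + 2)) ∞ M] in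
/-- A chart of the manifold near the boundary or in the interior gives a chart of its extension. -/
theorem isOpenEmbedding_hatChart (e : OpenPartialHomeomorph ((Fin (m + 1) → ℝ) × ℝ≥0) M)
    (he : ∀ y u, (y, u) ∈ e.source → 0 < u → e (y, u) ∈ mInterior m M)
    {S : Set ((Fin (m + 1) → ℝ) × ℝ)} (hS : IsOpen S)
    (hS1 : ∀ x ∈ S, (x.1, Real.toNNReal (-x.2)) ∈ e.source)
    (hS2 : ∀ x ∈ S, 0 ≤ x.2 → x.1 ∈ openCube m ∧ e (x.1, 0) = i.disc x.1) :
    ∃ c : S → i.Hat, IsOpenEmbedding c ∧ (∀ x, c x ∈ i.hatInterior) ∧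
      ∀ x, i.retr (c x) = e (x.1.1, Real.toNNReal (-x.1.2)) ∧
        i.height (c x) = Real.toNNReal x.1.2 := by
  have h0 : ∀ x : S, 0 ≤ x.1.2 → e (x.1.1, Real.toNNReal (-x.1.2)) = i.disc x.1.1 := by
    intro x h
    rw [Real.toNNReal_of_nonpos (by linarith), (hS2 x x.2 h).2]
  -- The last coordinate is signed: negative values measure depth in `M` and positive values height
  -- in the cylinder. The inverse `g` takes height minus depth, at least one of which vanishes.
  let c : S → i.Hat := fun x => ⟨(e (x.1.1, Real.toNNReal (-x.1.2)), Real.toNNReal x.1.2), by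
    rcases le_total x.1.2 0 with h | h
    · exact Or.inl (Real.toNNReal_of_nonpos h)
    · right
      rw [h0 x h]
      exact i.disc_mem_D (openCube_subset (hS2 x x.2 h).1)⟩
  have hc1 : ∀ x, i.retr (c x) = e (x.1.1, Real.toNNReal (-x.1.2)) := fun x => rfl
  have hc2 : ∀ x, i.height (c x) = Real.toNNReal x.1.2 := fun x => rfl
  have hcont : Continuous c := by
    refine Continuous.subtype_mk (Continuous.prodMk ?_ (by fun_prop)) _
    exact e.continuousOn.comp_continuous (by fun_prop) fun x => hS1 x x.2
  let g : i.Hat → (Fin (m + 1) → ℝ) × ℝ := fun p =>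
    ((e.symm (i.retr p)).1, (i.height p : ℝ) - (e.symm (i.retr p)).2)
  have hg : ContinuousOn g (i.retr ⁻¹' e.target) := by
    have h1 : ContinuousOn (fun p => e.symm (i.retr p)) (i.retr ⁻¹' e.target) :=
      e.continuousOn_symm.comp i.continuous_retr.continuousOn fun _ h => h
    have h2 : ContinuousOn (fun p => (i.height p : ℝ)) (i.retr ⁻¹' e.target) :=
      (NNReal.continuous_coe.comp i.continuous_height).continuousOn
    exact (continuous_fst.comp_continuousOn h1).prodMk (h2.sub
      (NNReal.continuous_coe.comp_continuousOn (continuous_snd.comp_continuousOn h1)))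
  have hgc : ∀ x, g (c x) = x.1 := by
    intro x
    have h1 : e.symm (i.retr (c x)) = (x.1.1, Real.toNNReal (-x.1.2)) := by
      rw [hc1]
      exact e.left_inv (hS1 x x.2)
    refine Prod.ext ?_ ?_
    · simp only [g, h1]
    · simp only [g, h1, hc2, Real.coe_toNNReal']
      rcases le_total x.1.2 0 with h | h
      · rw [max_eq_right h, max_eq_left (by linarith)]; ring
      · rw [max_eq_left h, max_eq_right (by linarith)]; ring
  have hct : ∀ x, c x ∈ i.retr ⁻¹' e.target := fun x => e.map_source (hS1 x x.2)
  have hTo : IsOpen (i.retr ⁻¹' e.target) := e.open_target.preimage i.continuous_retr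
  have hcg : ∀ p (hp : i.retr p ∈ e.target) (hgp : g p ∈ S), c ⟨g p, hgp⟩ = p := by
    intro p hp hgp
    have hu : i.height p ≠ 0 → (e.symm (i.retr p)).2 = 0 := by
      intro h
      by_contra hu
      have h1 := he (e.symm (i.retr p)).1 (e.symm (i.retr p)).2 (e.map_target hp)
        (pos_iff_ne_zero.2 hu)
      rw [Prod.mk.eta, e.right_inv hp] at h1
      exact i.notMem_D h1 (p.2.resolve_left h)
    have key : Real.toNNReal (-(g p).2) = (e.symm (i.retr p)).2 ∧
        Real.toNNReal (g p).2 = i.height p := by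
      by_cases h : i.height p = 0
      · simp only [g, h]
        simp
      · simp only [g, hu h]
        simp
    refine Hat.ext ?_ ?_
    · rw [hc1]
      simp only [key.1]
      exact e.right_inv hp
    · rw [hc2, key.2]
  refine ⟨c, ⟨⟨?_, fun x y h => Subtype.ext (by rw [← hgc x, h, hgc])⟩, ?_⟩, fun x => ?_,
    fun x => ⟨rfl, rfl⟩⟩
  · refine ⟨le_antisymm (continuous_iff_le_induced.1 hcont) ?_⟩
    rw [← continuous_id_iff_le]
    let _ : TopologicalSpace S := .induced c inferInstance
    have hci : Continuous c := continuous_induced_dom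
    have h3 : Continuous fun x => g (c x) := hg.comp_continuous hci hct
    rw [continuous_induced_rng]
    convert h3 using 1
    exact funext fun x => (hgc x).symm
  · have : Set.range c = (i.retr ⁻¹' e.target) ∩ g ⁻¹' S := by
      ext p
      constructor
      · rintro ⟨x, rfl⟩
        exact ⟨hct x, by rw [Set.mem_preimage, hgc]; exact x.2⟩
      · rintro ⟨h1, h2⟩
        exact ⟨_, hcg p h1 h2⟩
    rw [this]
    exact hg.isOpen_inter_preimage hTo hS
  · rcases lt_or_ge x.1.2 0 with h | h
    · exact Or.inl (he _ _ (hS1 x x.2) (by simpa using h))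
    · exact Or.inr ⟨_, (hS2 x x.2 h).1, h0 x h⟩

omit [T2Space M] in
/-- Every interior point of the extended manifold has arbitrarily small charts. -/
theorem exists_chart {p : i.Hat} (hp : p ∈ i.hatInterior) {N : Set i.Hat} (hN : N ∈ 𝓝 p) :
    ∃ χ : EuclideanSpace ℝ (Fin (m + 2)) → i.Hat,
      IsOpenEmbedding (fun x : Metric.ball (0 : EuclideanSpace ℝ (Fin (m + 2))) 2 => χ x) ∧
      (∀ x ∈ Metric.ball (0 : EuclideanSpace ℝ (Fin (m + 2))) 2, χ x ∈ i.hatInterior ∧ χ x ∈ N) ∧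
      χ 0 = p := by
  have key : ∃ (S : Set ((Fin (m + 1) → ℝ) × ℝ)) (c : S → i.Hat), IsOpen S ∧ IsOpenEmbedding c ∧
      (∀ x, c x ∈ i.hatInterior) ∧ ∃ a, c a = p := by
    rcases hp with hp | ⟨y, hy, hp⟩
    · let e := (prodChart (m := m) (i.retr p)).symm
      have he : ∀ y u, (y, u) ∈ e.source → 0 < u → e (y, u) ∈ mInterior m M := by
        intro y u h hu
        have h1 := (prodChart (m := m) (i.retr p)).map_target h
        rw [mem_mInterior_iff h1, (prodChart (m := m) (i.retr p)).right_inv h]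
        exact hu
      have hx := mem_prodChart_source (m := m) (i.retr p)
      let a := prodChart (m := m) (i.retr p) (i.retr p)
      have ha : a ∈ e.source := (prodChart (m := m) (i.retr p)).map_source hx
      have ha0 : 0 < a.2 := (mem_mInterior_iff hx).1 hp
      -- At an interior point of `M` only negative values of the signed coordinate are used, so that
      -- the condition about the cylinder is vacuous.
      obtain ⟨c, hc, hci, hcr⟩ := i.isOpenEmbedding_hatChart e he
        (S := {x | x.2 < 0 ∧ (x.1, Real.toNNReal (-x.2)) ∈ e.source})
        ((isOpen_lt continuous_snd continuous_const).inter
          (e.open_source.preimage (by fun_prop))) (fun x h => h.2)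
        (fun x h h' => absurd h' (not_le.2 h.1))
      refine ⟨_, c, ?_, hc, hci, ⟨(a.1, -a.2), ?_, ?_⟩, ?_⟩
      · exact ((isOpen_lt continuous_snd continuous_const).inter
          (e.open_source.preimage (by fun_prop)))
      · simpa using ha0
      · simpa using ha
      · refine Hat.ext ?_ ?_
        · rw [(hcr _).1]
          simp only [neg_neg, Real.toNNReal_coe, Prod.mk.eta]
          exact (prodChart (m := m) (i.retr p)).left_inv hx
        · rw [(hcr _).2, height_eq_zero (i.notMem_D hp)]
          simp
    · obtain ⟨e, hey, he0, he⟩ := exists_collarChart i.disc_emb y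
      have hSo : IsOpen {x : (Fin (m + 1) → ℝ) × ℝ | (x.1 ∈ openCube m ∧ (x.1, 0) ∈ e.source) ∧
          (x.1, Real.toNNReal (-x.2)) ∈ e.source} :=
        (((isOpen_openCube m).preimage continuous_fst).inter
          (e.open_source.preimage (by fun_prop))).inter (e.open_source.preimage (by fun_prop))
      obtain ⟨c, hc, hci, hcr⟩ := i.isOpenEmbedding_hatChart e he hSo (fun x h => h.2)
        (fun x h _ => ⟨h.1.1, he0 _ h.1.2⟩)
      have h0 : Real.toNNReal (-(i.height p : ℝ)) = 0 := by simp
      refine ⟨_, c, hSo, hc, hci, ⟨(y, i.height p), ⟨hy, hey⟩, ?_⟩, ?_⟩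
      · simpa [h0] using hey
      · refine Hat.ext ?_ ?_
        · rw [(hcr _).1]
          simp only [h0]
          rw [he0 _ hey, hp]
        · rw [(hcr _).2]
          simp
  obtain ⟨S, c, hS, hc, hci, a, rfl⟩ := key
  have hN' : Subtype.val '' (c ⁻¹' N) ∈ 𝓝 a.1 := by
    have h1 := Filter.image_mem_map (m := Subtype.val)
        (hc.continuous.continuousAt.preimage_mem_nhds hN)
    rwa [hS.isOpenEmbedding_subtypeVal.map_nhds_eq] at h1
  obtain ⟨ε, hε, hεN⟩ := Metric.mem_nhds_iff.1 hN'
  let A : EuclideanSpace ℝ (Fin (m + 2)) ≃ₜ (Fin (m + 1) → ℝ) × ℝ :=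
    ((splitHomeo m).trans (Homeomorph.smulOfNeZero (ε / 2) (by positivity))).trans
      (Homeomorph.addLeft a.1)
  have hA : ∀ v, A v = a.1 + (ε / 2) • splitHomeo m v := fun v => rfl
  have hAb : ∀ v ∈ Metric.ball (0 : EuclideanSpace ℝ (Fin (m + 2))) 2,
      A v ∈ Subtype.val '' (c ⁻¹' N) := by
    intro v hv
    refine hεN ?_
    rw [mem_ball_zero_iff] at hv
    have h1 : ‖splitHomeo m v‖ < 2 := by
      refine lt_of_le_of_lt ?_ hv
      rw [Prod.norm_def]
      refine max_le ((pi_norm_le_iff_of_nonneg (norm_nonneg _)).2 fun j => ?_) ?_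
      · exact PiLp.norm_apply_le v _
      · exact PiLp.norm_apply_le v _
    rw [Metric.mem_ball, hA, dist_eq_norm, add_sub_cancel_left, norm_smul, Real.norm_eq_abs,
      abs_of_pos (by positivity)]
    nlinarith
  have hAS : ∀ v ∈ Metric.ball (0 : EuclideanSpace ℝ (Fin (m + 2))) 2, A v ∈ S := fun v hv => by
    obtain ⟨b, -, hb⟩ := hAb v hv
    rw [← hb]
    exact b.2
  classical
  let χ : EuclideanSpace ℝ (Fin (m + 2)) → i.Hat := fun v => if h : A v ∈ S then c ⟨A v, h⟩ else c a
  refine ⟨χ, ?_, fun v hv => ?_, ?_⟩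
  · have h1 : IsOpenEmbedding
        fun v : Metric.ball (0 : EuclideanSpace ℝ (Fin (m + 2))) 2 => (⟨A v, hAS v v.2⟩ : S) :=
      .of_comp _ hS.isOpenEmbedding_subtypeVal
        (A.isOpenEmbedding.comp Metric.isOpen_ball.isOpenEmbedding_subtypeVal)
    convert hc.comp h1 using 1
    funext v
    exact dif_pos (hAS v v.2)
  · have h1 : χ v = c ⟨A v, hAS v hv⟩ := dif_pos (hAS v hv)
    rw [h1]
    refine ⟨hci _, ?_⟩
    obtain ⟨b, hb, hb'⟩ := hAb v hv
    have : (⟨A v, hAS v hv⟩ : S) = b := Subtype.ext hb'.symm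
    rw [this]
    exact hb
  · have h0 : A 0 = a.1 := by
      rw [hA]
      have : splitHomeo m 0 = 0 := by
        refine Prod.ext (funext fun j => ?_) ?_ <;> rfl
      rw [this, smul_zero, add_zero]
    have h1 : A 0 ∈ S := h0 ▸ a.2
    have h2 : χ 0 = c ⟨A 0, h1⟩ := dif_pos h1
    rw [h2]
    congr 1
    exact Subtype.ext h0

end Inputs

end HatTopology


/-! ### Pushing the manifold into the cylinder -/

section Push

open Inputs (clamp clamp_mem clamp_eq)

variable {m : ℕ}

/-- The nearest point of the cube `[-1 - r, 1 + r]^(m+1)`. -/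
def clampTo (r : ℝ≥0) (y : Fin (m + 1) → ℝ) : Fin (m + 1) → ℝ :=
  fun j => max (-(1 + r : ℝ)) (min (y j) (1 + r))

/-- The distance of `(y, u)` from the product of the cube and `{0}`. -/
noncomputable def cubeDist (y : Fin (m + 1) → ℝ) (u : ℝ≥0) : ℝ≥0 := max ‖y - clamp y‖₊ u

theorem continuous_clamp : Continuous (clamp (m := m)) := by
  unfold clamp
  fun_prop

theorem continuous_clampTo :
    Continuous fun x : ℝ≥0 × (Fin (m + 1) → ℝ) => clampTo x.1 x.2 := by
  unfold clampTo
  fun_prop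

theorem continuous_cubeDist :
    Continuous fun x : (Fin (m + 1) → ℝ) × ℝ≥0 => cubeDist x.1 x.2 := by
  have := continuous_clamp (m := m)
  unfold cubeDist
  fun_prop

/-- The cube enlarged by the distance of `(y, u)` still contains `y`. This is why the push below
starts at the identity. -/
theorem clampTo_cubeDist (y : Fin (m + 1) → ℝ) (u : ℝ≥0) : clampTo (cubeDist y u) y = y := by
  funext j
  have h1 : |y j - clamp y j| ≤ cubeDist y u := by
    have h2 := norm_le_pi_norm (y - clamp y) j
    refine le_trans h2 ?_
    rw [← coe_nnnorm, NNReal.coe_le_coe]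
    exact le_max_left _ _
  rw [abs_le] at h1
  have h3 : clamp y j ≤ 1 := (clamp_mem y j).2
  have h4 : -1 ≤ clamp y j := (clamp_mem y j).1
  rw [clampTo, min_eq_left (by linarith), max_eq_right (by linarith)]

theorem clampTo_zero (y : Fin (m + 1) → ℝ) : clampTo 0 y = clamp y := by
  funext j
  simp only [clampTo, clamp, NNReal.coe_zero, add_zero]

theorem cubeDist_eq_zero {y : Fin (m + 1) → ℝ} (hy : y ∈ cube m) : cubeDist y 0 = 0 := by
  simp [cubeDist, clamp_eq hy]

/-- Clamping to enlarged cubes does not increase the distance from a point of the cube, so the push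
does not leave a box in the chart around such a point. -/
theorem norm_clampTo_sub_le {y₀ : Fin (m + 1) → ℝ} (h : y₀ ∈ cube m) (r : ℝ≥0)
    (y : Fin (m + 1) → ℝ) : ‖clampTo r y - y₀‖ ≤ ‖y - y₀‖ := by
  refine (pi_norm_le_iff_of_nonneg (norm_nonneg _)).2 fun j => ?_
  refine le_trans ?_ (norm_le_pi_norm (y - y₀) j)
  have h1 := (h j).1
  have h2 := (h j).2
  have h3 := r.2
  simp only [Pi.sub_apply, clampTo, Real.norm_eq_abs]
  change |max (-(1 + (r : ℝ))) (min (y j) (1 + r)) - y₀ j| ≤ _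
  have hr : (0 : ℝ) ≤ r := r.2
  rcases le_total (y j) (1 + r) with h4 | h4
  · rw [min_eq_left h4]
    rcases le_total (-(1 + (r : ℝ))) (y j) with h5 | h5
    · rw [max_eq_right h5]
    · rw [max_eq_left h5, abs_sub_comm, abs_sub_comm (y j), abs_of_nonneg (by linarith),
        abs_of_nonneg (by linarith)]
      linarith
  · rw [min_eq_right h4, max_eq_right (by linarith), abs_of_nonneg (by linarith),
      abs_of_nonneg (by linarith)]
    linarith

namespace Inputs

variable {M : Type u} [TopologicalSpace M] [ChartedSpace (EuclideanHalfSpace (m + 2)) M]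
  {E : Type v} [TopologicalSpace E] {X : Type w} [TopologicalSpace X] (i : Inputs m M E X)

/-- A homotopy `Ψ` of the extended manifold that starts at the identity, is supported over `O`,
moves the points of the cylinder upwards, and moves those with coordinates in `K` by at least the
time. -/
structure IsPush (O : Set M) (K : Set (Fin (m + 1) → ℝ)) (Ψ : C(i.Hat × ℝ≥0, i.Hat)) : Prop where
  zero : ∀ p, Ψ (p, 0) = p
  retr_eq : ∀ p δ, i.retr p ∈ i.D → i.retr (Ψ (p, δ)) = i.retr p
  le : ∀ p δ, i.retr p ∈ i.D → i.height p ≤ i.height (Ψ (p, δ))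
  add_le : ∀ p δ, i.retr p ∈ i.D → i.coord (i.retr p) ∈ K → i.height p + δ ≤ i.height (Ψ (p, δ))
  eq_self : ∀ p δ, i.retr p ∉ O → Ψ (p, δ) = p
  mem : ∀ p δ, i.retr p ∈ O → i.retr (Ψ (p, δ)) ∈ O

variable [T2Space M] [IsManifold (modelWithCornersEuclideanHalfSpace (m + 2)) ∞ M]

/-- In a collar chart, a point at distance `ν` from the disc moves towards the disc, and when it has
covered the distance `ν` the remaining time raises it in the cylinder. Truncated subtraction encodes
both phases: `ν - α` is the distance that is left and `α - ν` the height that is gained. The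
effective time `α` is the time damped by a cutoff function supported in the chart. -/
theorem exists_local_push {O : Set M} (hO : IsOpen O) (hDO : i.D ⊆ O) {y₀ : Fin (m + 1) → ℝ}
    (hy₀ : y₀ ∈ cube m) : ∃ K ∈ 𝓝 y₀, ∃ Ψ, i.IsPush O K Ψ := by
  obtain ⟨e, hey, he0, he⟩ := exists_collarChart i.disc_emb y₀
  have hnh : e.source ∩ e ⁻¹' O ∈ 𝓝 (y₀, (0 : ℝ≥0)) := by
    refine (e.isOpen_inter_preimage hO).mem_nhds ⟨hey, ?_⟩
    rw [Set.mem_preimage, he0 _ hey]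
    exact hDO (i.disc_mem_D hy₀)
  obtain ⟨ε, hε, hεe⟩ := Metric.mem_nhds_iff.1 hnh
  let η := ε / 2
  have hη : 0 < η := by positivity
  let g : (Fin (m + 1) → ℝ) × ℝ≥0 → ℝ := fun x => max ‖x.1 - y₀‖ x.2
  have hg : Continuous g := by fun_prop
  have hbox : ∀ x, g x < 2 * η → x ∈ e.source ∧ e x ∈ O := by
    intro x hx
    refine hεe ?_
    rw [Metric.mem_ball, Prod.dist_eq, max_lt_iff]
    have h2 : 2 * η = ε := by simp only [η]; ring
    rw [h2] at hx
    refine ⟨by rw [dist_eq_norm]; exact (le_max_left _ _).trans_lt hx, ?_⟩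
    rw [NNReal.dist_eq]
    simp only [NNReal.coe_zero, sub_zero, NNReal.abs_eq]
    exact (le_max_right _ _).trans_lt hx
  -- The cutoff is `1` up to size `η` and `0` from size `3 / 2 * η` on, which leaves a margin to the
  -- box of size `2 * η` on which the chart is available.
  let β : (Fin (m + 1) → ℝ) × ℝ≥0 → ℝ≥0 := fun x => min 1 (Real.toNNReal (3 - 2 * (g x / η)))
  have hβ : Continuous β := by fun_prop
  have hβ1 : ∀ x, g x ≤ η → β x = 1 := by
    intro x hx
    refine min_eq_left ?_
    rw [Real.one_le_toNNReal]
    have : g x / η ≤ 1 := (div_le_one hη).2 hx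
    linarith
  have hβ0 : ∀ x, 3 / 2 * η ≤ g x → β x = 0 := by
    intro x hx
    have : 3 / 2 ≤ g x / η := (le_div_iff₀ hη).2 hx
    simp only [β]
    rw [Real.toNNReal_of_nonpos (by linarith)]
    simp
  let V : Set M := e.target ∩ e.symm ⁻¹' {x | g x < 2 * η}
  have hV : IsOpen V := e.symm.isOpen_inter_preimage (isOpen_lt hg continuous_const)
  let W : Set M := e '' {x | g x ≤ 3 / 2 * η}
  have hWV : W ⊆ V := by
    rintro _ ⟨x, hx, rfl⟩
    have hx' : g x < 2 * η := lt_of_le_of_lt hx (by linarith)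
    refine ⟨e.map_source (hbox x hx').1, ?_⟩
    rw [Set.mem_preimage, e.left_inv (hbox x hx').1]
    exact hx'
  -- A compact image in a Hausdorff space. The homotopy is the identity outside `W`, which makes it
  -- continuous at points outside the chart.
  have hW : IsClosed W := by
    have hc : IsCompact {x | g x ≤ 3 / 2 * η} := by
      have : {x | g x ≤ 3 / 2 * η} ⊆ Metric.closedBall (y₀, (0 : ℝ≥0)) (3 / 2 * η) := by
        intro x hx
        rw [Metric.mem_closedBall, Prod.dist_eq, max_le_iff, dist_eq_norm, NNReal.dist_eq]
        simp only [NNReal.coe_zero, sub_zero, NNReal.abs_eq]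
        exact max_le_iff.1 hx
      exact (isCompact_closedBall _ _).of_isClosed_subset
        (isClosed_le hg continuous_const) this
    refine (hc.image_of_continuousOn (e.continuousOn.mono fun x hx => ?_)).isClosed
    exact (hbox x (lt_of_le_of_lt hx (by linarith))).1
  have hgc : ∀ (r s : ℝ≥0) x, g (clampTo r x.1, min x.2 s) ≤ g x := fun r s x =>
    max_le_max (norm_clampTo_sub_le hy₀ r x.1) (by exact_mod_cast min_le_left _ _)
  -- coordinates
  let x : i.Hat → (Fin (m + 1) → ℝ) × ℝ≥0 := fun p => e.symm (i.retr p)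
  let α : i.Hat × ℝ≥0 → ℝ≥0 := fun q => q.2 * β (x q.1)
  let ν : i.Hat → ℝ≥0 := fun p => cubeDist (x p).1 (x p).2
  let z : i.Hat × ℝ≥0 → (Fin (m + 1) → ℝ) × ℝ≥0 := fun q =>
    (clampTo (ν q.1 - α q) (x q.1).1, min (x q.1).2 (ν q.1 - α q))
  let F : i.Hat × ℝ≥0 → M × ℝ≥0 := fun q => (e (z q), i.height q.1 + (α q - ν q.1))
  have hx : ∀ p, i.retr p ∈ V → x p ∈ e.source ∧ e (x p) = i.retr p ∧ g (x p) < 2 * η :=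
    fun p hp => ⟨e.map_target hp.1, e.right_inv hp.1, hp.2⟩
  have hz : ∀ q : i.Hat × ℝ≥0, i.retr q.1 ∈ V → g (z q) < 2 * η := fun q hq =>
    (hgc _ _ _).trans_lt (hx q.1 hq).2.2
  have hxD : ∀ p, i.retr p ∈ V → i.retr p ∈ i.D →
      x p = (i.coord (i.retr p), 0) ∧ (x p).1 ∈ cube m := by
    intro p hp hD
    have hu : (x p).2 = 0 := by
      by_contra hu
      have h1 := he (x p).1 (x p).2 (hx p hp).1 (pos_iff_ne_zero.2 hu)
      rw [Prod.mk.eta, (hx p hp).2.1] at h1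
      exact i.notMem_D h1 hD
    have h2 : x p = ((x p).1, 0) := Prod.ext rfl hu
    have h3 := he0 (x p).1 (h2 ▸ (hx p hp).1)
    rw [← h2, (hx p hp).2.1] at h3
    refine ⟨?_, ?_⟩
    · rw [h3, coord_disc]
      exact h2
    · rw [← i.disc_mem_D_iff, ← h3]
      exact hD
  have hFD : ∀ q : i.Hat × ℝ≥0, i.retr q.1 ∈ V → i.retr q.1 ∈ i.D →
      F q = (i.retr q.1, i.height q.1 + α q) := by
    intro q hq hD
    obtain ⟨h1, h2⟩ := hxD q.1 hq hD
    have hu : (x q.1).2 = 0 := by rw [h1]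
    have hν : ν q.1 = 0 := by
      simp only [ν, hu]
      exact cubeDist_eq_zero h2
    have hzx : z q = x q.1 := by
      simp only [z, hν, zero_tsub, clampTo_zero, clamp_eq h2, hu, min_self]
      exact Prod.ext rfl hu.symm
    simp only [F, hzx, hν, tsub_zero, (hx q.1 hq).2.1]
  have hF0 : ∀ q : i.Hat × ℝ≥0, i.retr q.1 ∈ V → α q = 0 → F q = (i.retr q.1, i.height q.1) := by
    intro q hq hα
    have hzx : z q = x q.1 := by
      simp only [z, hα, tsub_zero]
      refine Prod.ext (clampTo_cubeDist _ _) (min_eq_left (le_max_right _ _))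
    simp only [F, hzx, hα, zero_tsub, add_zero, (hx q.1 hq).2.1]
  have hFmem : ∀ q : i.Hat × ℝ≥0, i.retr q.1 ∈ V → ((F q).2 = 0 ∨ (F q).1 ∈ i.D) := by
    intro q hq
    by_cases hD : i.retr q.1 ∈ i.D
    · right
      rw [hFD q hq hD]
      exact hD
    rcases le_total (α q) (ν q.1) with h | h
    · left
      simp only [F, height_eq_zero hD, tsub_eq_zero_of_le h, add_zero]
    · right
      have h1 : z q = (clamp (x q.1).1, 0) := by
        simp only [z, tsub_eq_zero_of_le h, clampTo_zero]
        rw [min_eq_right (zero_le)]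
      simp only [F, h1]
      have h2 := (hbox _ (hz q hq)).1
      rw [h1] at h2
      rw [he0 _ h2]
      exact i.disc_mem_D (clamp_mem _)
  classical
  let Ψ : i.Hat × ℝ≥0 → i.Hat := fun q => if h : i.retr q.1 ∈ V then ⟨F q, hFmem q h⟩ else q.1
  have hΨV : ∀ q (h : i.retr q.1 ∈ V), Ψ q = ⟨F q, hFmem q h⟩ := fun q h => dif_pos h
  have hΨ0 : ∀ q : i.Hat × ℝ≥0, (i.retr q.1 ∈ V → α q = 0) → Ψ q = q.1 := by
    intro q hq
    by_cases h : i.retr q.1 ∈ V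
    · rw [hΨV q h]
      exact Subtype.ext (hF0 q h (hq h))
    · exact dif_neg h
  have hΨD : ∀ q : i.Hat × ℝ≥0, i.retr q.1 ∈ i.D → i.retr (Ψ q) = i.retr q.1 ∧
      (i.retr q.1 ∈ V → i.height (Ψ q) = i.height q.1 + α q) ∧ i.height q.1 ≤ i.height (Ψ q) := by
    intro q hD
    by_cases h : i.retr q.1 ∈ V
    · have h1 : Ψ q = ⟨(i.retr q.1, i.height q.1 + α q), Or.inr hD⟩ := by
        rw [hΨV q h]
        exact Subtype.ext (hFD q h hD)
      rw [h1]
      exact ⟨rfl, fun _ => rfl, le_self_add⟩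
    · have h1 : Ψ q = q.1 := dif_neg h
      rw [h1]
      exact ⟨rfl, fun h' => absurd h' h, le_rfl⟩
  have hcont : Continuous Ψ := by
    rw [continuous_iff_continuousAt]
    intro q
    by_cases h : i.retr q.1 ∈ V
    · have hVo : IsOpen {q : i.Hat × ℝ≥0 | i.retr q.1 ∈ V} :=
        hV.preimage (i.continuous_retr.comp continuous_fst)
      have hx' : ContinuousOn (fun q : i.Hat × ℝ≥0 => x q.1) {q | i.retr q.1 ∈ V} :=
        e.continuousOn_symm.comp (i.continuous_retr.comp continuous_fst).continuousOn
          fun q hq => hq.1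
      have hα : ContinuousOn α {q | i.retr q.1 ∈ V} :=
        continuous_snd.continuousOn.mul (hβ.comp_continuousOn hx')
      have hν : ContinuousOn (fun q : i.Hat × ℝ≥0 => ν q.1) {q | i.retr q.1 ∈ V} :=
        continuous_cubeDist.comp_continuousOn hx'
      have hz' : ContinuousOn z {q | i.retr q.1 ∈ V} :=
        (continuous_clampTo.comp_continuousOn ((hν.sub hα).prodMk
          (continuous_fst.comp_continuousOn hx'))).prodMk
          (continuous_min.comp_continuousOn
              ((continuous_snd.comp_continuousOn hx').prodMk (hν.sub hα)))
      have hF : ContinuousOn F {q | i.retr q.1 ∈ V} :=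
        (e.continuousOn.comp hz' fun q hq => (hbox _ (hz q hq)).1).prodMk
          ((i.continuous_height.comp continuous_fst).continuousOn.add (hα.sub hν))
      have hF' : ContinuousOn Ψ {q | i.retr q.1 ∈ V} := by
        refine Topology.IsInducing.subtypeVal.continuousOn_iff.2 (hF.congr fun q hq => ?_)
        change (Ψ q).1 = F q
        rw [hΨV q hq]
      exact hF'.continuousAt (hVo.mem_nhds h)
    · have hWo : IsOpen {q : i.Hat × ℝ≥0 | i.retr q.1 ∉ W} :=
        hW.isOpen_compl.preimage (i.continuous_retr.comp continuous_fst)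
      have hev : Ψ =ᶠ[𝓝 q] Prod.fst := by
        filter_upwards [hWo.mem_nhds fun h' => h (hWV h')] with q' hq'
        refine hΨ0 q' fun hq'' => ?_
        simp only [α]
        rw [hβ0, mul_zero]
        by_contra hlt
        exact hq' ⟨x q'.1, (not_le.1 hlt).le, (hx q'.1 hq'').2.1⟩
      exact continuousAt_fst.congr hev.symm
  have hα0 : ∀ p, α (p, 0) = 0 := fun p => by simp [α]
  refine ⟨{y | ‖y - y₀‖ < η}, ?_, ⟨Ψ, hcont⟩, fun p => hΨ0 _ fun _ => hα0 p,
    fun p δ hp => (hΨD (p, δ) hp).1, fun p δ hp => (hΨD (p, δ) hp).2.2, fun p δ hp hK => ?_,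
    fun p δ hp => ?_, fun p δ hp => ?_⟩
  · exact (isOpen_lt (by fun_prop) continuous_const).mem_nhds (by simpa using hη)
  · change ‖i.coord (i.retr p) - y₀‖ < η at hK
    have hgK : g (i.coord (i.retr p), 0) ≤ η := max_le hK.le hη.le
    have hs := (hbox (i.coord (i.retr p), 0) (lt_of_le_of_lt hgK (by linarith))).1
    have h2 : e (i.coord (i.retr p), 0) = i.retr p := by rw [he0 _ hs, i.disc_coord hp]
    have hV' : i.retr p ∈ V := hWV ⟨_, le_trans hgK (by linarith), h2⟩
    change _ ≤ i.height (Ψ (p, δ))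
    rw [(hΨD (p, δ) hp).2.1 hV']
    refine add_le_add_right ?_ _
    simp only [α]
    rw [(hxD p hV' hp).1, hβ1 _ hgK, mul_one]
  · refine hΨ0 _ fun h => absurd ?_ hp
    have := (hbox _ (hx p h).2.2).2
    rwa [(hx p h).2.1] at this
  · change i.retr (Ψ (p, δ)) ∈ O
    by_cases h : i.retr p ∈ V
    · rw [hΨV (p, δ) h]
      exact (hbox _ (hz (p, δ) h)).2
    · have h1 : Ψ (p, δ) = p := dif_neg h
      rwa [h1]

/-- There is a homotopy of the extended manifold that pushes a small neighbourhood of the disc into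
the cylinder, and the cylinder upwards. -/
theorem exists_push {O : Set M} (hO : IsOpen O) (hDO : i.D ⊆ O) :
    ∃ Ψ, i.IsPush O (cube m) Ψ := by
  -- Local pushes are composed. Since no push lowers the cylinder, the composite raises the points
  -- over `K` and those over `K'` by at least the time.
  refine (isCompact_cube m).induction_on (p := fun K => ∃ Ψ, i.IsPush O K Ψ) ?_ ?_ ?_ ?_
  · exact ⟨⟨Prod.fst, continuous_fst⟩, fun _ => rfl, fun _ _ _ => rfl, fun _ _ _ => le_rfl,
      fun _ _ _ h => h.elim, fun _ _ _ => rfl, fun _ _ h => h⟩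
  · rintro K K' hK ⟨Ψ, h⟩
    exact ⟨Ψ, h.zero, h.retr_eq, h.le, fun p δ hp hc => h.add_le p δ hp (hK hc), h.eq_self, h.mem⟩
  · rintro K K' ⟨Ψ, h⟩ ⟨Ψ', h'⟩
    refine ⟨⟨fun q => Ψ' (Ψ q, q.2), by fun_prop⟩, fun p => ?_, fun p δ hp => ?_, fun p δ hp => ?_,
      fun p δ hp hc => ?_, fun p δ hp => ?_, fun p δ hp => h'.mem _ _ (h.mem p δ hp)⟩
    · simp [h.zero, h'.zero]
    · have h1 := h.retr_eq p δ hp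
      exact (h'.retr_eq _ _ (h1 ▸ hp)).trans h1
    · have h1 := h.retr_eq p δ hp
      exact (h.le p δ hp).trans (h'.le _ _ (h1 ▸ hp))
    · have h1 := h.retr_eq p δ hp
      have hD : i.retr (Ψ (p, δ)) ∈ i.D := h1 ▸ hp
      rcases hc with hc | hc
      · exact (h.add_le p δ hp hc).trans (h'.le _ _ hD)
      · exact (add_le_add_left (h.le p δ hp) δ).trans (h'.add_le _ _ hD (h1 ▸ hc))
    · change Ψ' (Ψ (p, δ), δ) = p
      rw [h.eq_self p δ hp, h'.eq_self p δ hp]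
  · intro y hy
    obtain ⟨K, hK, hΨ⟩ := i.exists_local_push hO hDO hy
    exact ⟨K, mem_nhdsWithin_of_mem_nhds hK, hΨ⟩

end Inputs

end Push


/-! ### Moving points -/

section Moves

open scoped unitInterval

variable {Y : Type u} [TopologicalSpace Y]

/-- The coordinates given by an embedded ball. -/
theorem exists_coordinates {F : Type*} [TopologicalSpace F] [Nonempty F] {χ : F → Y} {S : Set F}
    (hχ : IsOpenEmbedding fun x : S => χ x) :
    ∃ c : Y → F, ContinuousOn c (χ '' S) ∧ ∀ x ∈ S, c (χ x) = x := by
  rcases isEmpty_or_nonempty S with hS | hS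
  · rw [Set.isEmpty_coe_sort] at hS
    subst hS
    exact ⟨fun _ => Classical.arbitrary F, by simp, by simp⟩
  let e := hχ.toOpenPartialHomeomorph
  have ht : e.target = χ '' S := by simp [e, Set.image_eq_range]
  refine ⟨fun y => e.symm y, ?_, fun x hx => ?_⟩
  · rw [← ht]
    exact continuous_subtype_val.comp_continuousOn e.continuousOn_symm
  · exact congrArg Subtype.val (hχ.toOpenPartialHomeomorph_left_inv (x := ⟨x, hx⟩))

/-- In a chart, the points near the centre can be moved to each other. -/
theorem exists_pointMove [T2Space Y] {d : ℕ} {χ : EuclideanSpace ℝ (Fin d) → Y}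
    (hχ : IsOpenEmbedding fun x : Metric.ball (0 : EuclideanSpace ℝ (Fin d)) 2 => χ x) :
    ∃ V : Set Y, IsOpen V ∧ χ 0 ∈ V ∧ V ⊆ χ '' Metric.ball 0 2 ∧ ∃ Φ : (Y × Y) × I × Y → Y,
      ContinuousOn Φ {x | x.1.1 ∈ V ∧ x.1.2 ∈ V} ∧
      (∀ q q' y, Φ ((q, q'), 0, y) = y) ∧ (∀ q s y, Φ ((q, q), s, y) = y) ∧
      (∀ q q' s y, y ∉ χ '' Metric.ball 0 2 → Φ ((q, q'), s, y) = y) ∧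
      (∀ q ∈ V, ∀ q' ∈ V, ∀ s, ∀ y ∈ χ '' Metric.ball 0 2,
        Φ ((q, q'), s, y) ∈ χ '' Metric.ball 0 2) ∧
      ∀ q ∈ V, ∀ q' ∈ V, ∀ y, Φ ((q, q'), 1, y) = q → y = q' := by
  obtain ⟨c, hc, hcχ⟩ := exists_coordinates hχ
  set R := χ '' Metric.ball 0 2 with hR
  have hχc : ∀ y ∈ R, c y ∈ Metric.ball (0 : EuclideanSpace ℝ (Fin d)) 2 ∧ χ (c y) = y := by
    rintro _ ⟨x, hx, rfl⟩
    rw [hcχ x hx]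
    exact ⟨hx, rfl⟩
  have hopen : ∀ S : Set (EuclideanSpace ℝ (Fin d)), IsOpen S → S ⊆ Metric.ball 0 2 →
      IsOpen (χ '' S) := by
    intro S hS hS2
    convert hχ.isOpenMap _ (hS.preimage continuous_subtype_val) using 1
    ext y
    constructor
    · rintro ⟨x, hx, rfl⟩
      exact ⟨⟨x, hS2 hx⟩, hx, rfl⟩
    · rintro ⟨x, hx, rfl⟩
      exact ⟨x.1, hx, rfl⟩
  have hRo : IsOpen R := hopen _ Metric.isOpen_ball subset_rfl
  have hχcont : ContinuousOn χ (Metric.ball 0 2) := by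
    rw [continuousOn_iff_continuous_domRestrict]
    exact hχ.continuous
  let β : EuclideanSpace ℝ (Fin d) → ℝ := fun x => max 0 (min 1 (2 - 2 * ‖x‖))
  have hβ : Continuous β := by fun_prop
  have hβ0 : ∀ x, 0 ≤ β x := fun x => le_max_left _ _
  have hβ1 : ∀ x, β x ≤ 1 := fun x => max_le zero_le_one (min_le_left _ _)
  have hβout : ∀ x, 1 ≤ ‖x‖ → β x = 0 := fun x hx =>
    max_eq_left ((min_le_right _ _).trans (by linarith))
  have hβin : ∀ x, ‖x‖ ≤ 1 / 2 → β x = 1 := fun x hx => by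
    simp only [β]
    rw [min_eq_left (by linarith), max_eq_right zero_le_one]
  -- For `q` and `q'` in `V` the displacement has norm at most `1 / 4`. So a point that lands at `q`
  -- at time one starts within radius `1 / 2`, where `β` is one and the map is a translation; hence
  -- it is `q'`. Injectivity elsewhere is not needed.
  let V : Set Y := χ '' Metric.ball 0 (1 / 8)
  have hsub : Metric.ball (0 : EuclideanSpace ℝ (Fin d)) (1 / 8) ⊆ Metric.ball 0 2 :=
    Metric.ball_subset_ball (by norm_num)
  have hVR : V ⊆ R := Set.image_mono hsub
  have hcV : ∀ q ∈ V, ‖c q‖ < 1 / 8 := by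
    rintro _ ⟨x, hx, rfl⟩
    rw [hcχ x (hsub hx)]
    simpa using hx
  let φ : (Y × Y) × I × Y → EuclideanSpace ℝ (Fin d) := fun x =>
    c x.2.2 + ((x.2.1 : ℝ) * β (c x.2.2)) • (c x.1.1 - c x.1.2)
  have hφ : ∀ q ∈ V, ∀ q' ∈ V, ∀ (s : I), ∀ y ∈ R, φ ((q, q'), s, y) ∈ Metric.ball 0 2 := by
    intro q hq q' hq' s y hy
    have h1 := hcV q hq
    have h2 := hcV q' hq'
    have h3 := (hχc y hy).1
    rw [mem_ball_zero_iff] at h3 ⊢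
    simp only [φ]
    by_cases h4 : 1 ≤ ‖c y‖
    · rw [hβout _ h4]; simpa using h3
    · have h5 : ‖((s : ℝ) * β (c y)) • (c q - c q')‖ ≤ 1 / 4 := by
        rw [norm_smul, Real.norm_eq_abs, abs_of_nonneg (mul_nonneg s.2.1 (hβ0 _))]
        have h6 : (s : ℝ) * β (c y) ≤ 1 := mul_le_one₀ s.2.2 (hβ0 _) (hβ1 _)
        have h7 : ‖c q - c q'‖ ≤ 1 / 4 := (norm_sub_le _ _).trans (by linarith)
        calc _ ≤ 1 * (1 / 4 : ℝ) := mul_le_mul h6 h7 (norm_nonneg _) zero_le_one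
          _ = _ := one_mul _
      have := norm_add_le (c y) (((s : ℝ) * β (c y)) • (c q - c q'))
      linarith
  classical
  let Φ : (Y × Y) × I × Y → Y := fun x => if x.2.2 ∈ R then χ (φ x) else x.2.2
  have hΦR : ∀ x, x.2.2 ∈ R → Φ x = χ (φ x) := fun x hx => if_pos hx
  have hΦn : ∀ x, (x.2.2 ∈ R → φ x = c x.2.2) → Φ x = x.2.2 := by
    intro x hx
    by_cases h : x.2.2 ∈ R
    · rw [hΦR x h, hx h, (hχc _ h).2]
    · exact if_neg h
  refine ⟨V, hopen _ Metric.isOpen_ball hsub, ⟨0, by simp, rfl⟩, hVR, Φ, ?_,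
    fun q q' y => hΦn _ fun _ => by simp [φ], fun q s y => hΦn _ fun _ => by simp [φ],
    fun q q' s y hy => if_neg hy, fun q hq q' hq' s y hy => ?_, fun q hq q' hq' y hy => ?_⟩
  · rintro ⟨⟨q, q'⟩, s, y⟩ ⟨hq, hq'⟩
    by_cases hy : y ∈ R
    · have h1 : ContinuousOn φ {x | (x.1.1 ∈ V ∧ x.1.2 ∈ V) ∧ x.2.2 ∈ R} := by
        have e1 : ContinuousOn (fun x : (Y × Y) × I × Y => c x.2.2)
            {x | (x.1.1 ∈ V ∧ x.1.2 ∈ V) ∧ x.2.2 ∈ R} :=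
          hc.comp (by fun_prop) fun x hx => hx.2
        have e2 : ContinuousOn (fun x : (Y × Y) × I × Y => c x.1.1)
            {x | (x.1.1 ∈ V ∧ x.1.2 ∈ V) ∧ x.2.2 ∈ R} :=
          hc.comp (by fun_prop) fun x hx => hVR hx.1.1
        have e3 : ContinuousOn (fun x : (Y × Y) × I × Y => c x.1.2)
            {x | (x.1.1 ∈ V ∧ x.1.2 ∈ V) ∧ x.2.2 ∈ R} :=
          hc.comp (by fun_prop) fun x hx => hVR hx.1.2
        exact e1.add ((ContinuousOn.mul (by fun_prop) (hβ.comp_continuousOn e1)).smul (e2.sub e3))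
      have h2 : ContinuousOn Φ {x | (x.1.1 ∈ V ∧ x.1.2 ∈ V) ∧ x.2.2 ∈ R} :=
        (hχcont.comp h1 fun x hx => hφ _ hx.1.1 _ hx.1.2 _ _ hx.2).congr fun x hx => hΦR x hx.2
      refine (h2 _ ⟨⟨hq, hq'⟩, hy⟩).mono_of_mem_nhdsWithin ?_
      exact inter_mem_nhdsWithin _ ((hRo.preimage (by fun_prop : Continuous
        fun x : (Y × Y) × I × Y => x.2.2)).mem_nhds hy)
    · have hK : IsClosed (χ '' Metric.closedBall 0 1) :=
        ((isCompact_closedBall _ _).image_of_continuousOn (hχcont.mono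
          (Metric.closedBall_subset_ball (by norm_num)))).isClosed
      have hyK : y ∉ χ '' Metric.closedBall 0 1 := fun h =>
        hy (Set.image_mono (Metric.closedBall_subset_ball (by norm_num)) h)
      have hev : Φ =ᶠ[𝓝 ((q, q'), s, y)] fun x => x.2.2 := by
        filter_upwards [(hK.isOpen_compl.preimage (by fun_prop : Continuous
          fun x : (Y × Y) × I × Y => x.2.2)).mem_nhds hyK] with x hx
        refine hΦn x fun hR => ?_
        simp only [φ]
        rw [hβout, mul_zero, zero_smul, add_zero]
        by_contra hlt
        exact hx ⟨c x.2.2, by simpa using (not_le.1 hlt).le, (hχc _ hR).2⟩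
      exact ((by fun_prop : Continuous fun x : (Y × Y) × I × Y => x.2.2).continuousAt.congr
        hev.symm).continuousWithinAt
  · rw [hΦR _ hy]
    exact ⟨_, hφ q hq q' hq' s y hy, rfl⟩
  · by_cases h : y ∈ R
    · rw [hΦR _ h] at hy
      have h1 : φ ((q, q'), 1, y) = c q := by
        rw [← hcχ _ (hφ q hq q' hq' 1 y h), hy]
      replace h1 : c y + β (c y) • (c q - c q') = c q := by simpa [φ] using h1
      have h2 := hcV q hq
      have h3 := hcV q' hq'
      have h7 : ‖c q - c q'‖ ≤ 1 / 4 := (norm_sub_le _ _).trans (by linarith)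
      have h5 : ‖β (c y) • (c q - c q')‖ ≤ 1 / 4 := by
        rw [norm_smul, Real.norm_eq_abs, abs_of_nonneg (hβ0 _)]
        calc _ ≤ 1 * (1 / 4 : ℝ) := mul_le_mul (hβ1 _) h7 (norm_nonneg _) zero_le_one
          _ = _ := one_mul _
      have h6 : ‖c y‖ ≤ 1 / 2 := by
        have e : c y = c q - β (c y) • (c q - c q') := eq_sub_of_add_eq h1
        rw [e]
        refine (norm_sub_le _ _).trans ?_
        linarith
      rw [hβin _ h6, one_smul] at h1
      have h8 : c y = c q' := by
        have := congrArg (fun v => v - (c q - c q')) h1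
        simpa using this
      rw [← (hχc y h).2, h8, (hχc q' (hVR hq')).2]
    · have h1 : Φ ((q, q'), 1, y) = y := if_neg h
      have h2 : y ∈ V := by rw [← h1, hy]; exact hq
      exact absurd (hVR h2) h

/-- A family of isotopies that move the points `q' j` of `V j`, for `j ∈ J`, to the
points `q j` of `V j`, and are supported in the sets `N j`. -/
structure IsMove {κ : Type*} (V N : κ → Set Y) (J : Set κ) (Φ : ((κ → Y) × (κ → Y)) × I × Y → Y) :
    Prop where
  continuousOn : ContinuousOn Φ {x | ∀ j, x.1.1 j ∈ V j ∧ x.1.2 j ∈ V j}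
  subset : ∀ j, V j ⊆ N j
  zero : ∀ q q' y, Φ ((q, q'), 0, y) = y
  diag : ∀ q s y, Φ ((q, q), s, y) = y
  eq_self : ∀ q q' s y, (∀ j ∈ J, y ∉ N j) → Φ ((q, q'), s, y) = y
  mem : ∀ q q', (∀ j, q j ∈ V j) → (∀ j, q' j ∈ V j) → ∀ s j, ∀ y ∈ N j, Φ ((q, q'), s, y) ∈ N j
  one : ∀ q q', (∀ j, q j ∈ V j) → (∀ j, q' j ∈ V j) → ∀ j ∈ J, ∀ y,
    Φ ((q, q'), 1, y) = q j → y = q' j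

/-- The moves of single points are composed one after the other. Since the charts have disjoint
images, each move preserves all supports and fixes the targets of the others. -/
theorem exists_isMove [T2Space Y] {κ : Type*} [Finite κ] {d : ℕ}
    {χ : κ → EuclideanSpace ℝ (Fin d) → Y}
    (hχ : ∀ j, IsOpenEmbedding fun x : Metric.ball (0 : EuclideanSpace ℝ (Fin d)) 2 => χ j x)
    (hd : Pairwise fun j k => Disjoint (χ j '' Metric.ball 0 2) (χ k '' Metric.ball 0 2)) :
    ∃ V : κ → Set Y, (∀ j, IsOpen (V j) ∧ χ j 0 ∈ V j) ∧
      ∃ Φ, IsMove V (fun j => χ j '' Metric.ball 0 2) Set.univ Φ := by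
  choose V hVo h0V hVN Φ hΦ hz hdi ho hm h1 using fun j => exists_pointMove (hχ j)
  refine ⟨V, fun j => ⟨hVo j, h0V j⟩, ?_⟩
  induction (Set.univ : Set κ), Set.finite_univ (α := κ) using Set.Finite.induction_on with
  | empty =>
    exact ⟨fun x => x.2.2, by fun_prop, hVN, fun _ _ _ => rfl, fun _ _ _ => rfl, fun _ _ _ _ _ =>
        rfl,
      fun _ _ _ _ _ _ _ h => h, fun _ _ _ _ _ h => h.elim⟩
  | @insert a J ha _ ih =>
    obtain ⟨Ψ, hΨ⟩ := ih
    have hdis : ∀ {j k y}, y ∈ χ j '' Metric.ball 0 2 → y ∈ χ k '' Metric.ball 0 2 → j = k := by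
      intro j k y hj hk
      by_contra hjk
      exact Set.disjoint_left.1 (hd hjk) hj hk
    have hm' : ∀ q q' : κ → Y, (∀ j, q j ∈ V j) → (∀ j, q' j ∈ V j) → ∀ s j,
        ∀ y ∈ χ j '' Metric.ball 0 2, Φ a ((q a, q' a), s, y) ∈ χ j '' Metric.ball 0 2 := by
      intro q q' hq hq' s j y hy
      by_cases hja : j = a
      · subst hja
        exact hm j _ (hq j) _ (hq' j) s y hy
      · rw [ho a _ _ _ _ fun h => hja (hdis hy h)]
        exact hy
    refine ⟨fun x => Ψ (x.1, x.2.1, Φ a ((x.1.1 a, x.1.2 a), x.2)), ?_, hVN,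
      fun q q' y => ?_,
      fun q s y => ?_, fun q q' s y hy => ?_, fun q q' hq hq' s j y hy => ?_,
      fun q q' hq hq' j hj y hy => ?_⟩
    · refine hΨ.continuousOn.comp (ContinuousOn.prodMk (by fun_prop)
        (ContinuousOn.prodMk (by fun_prop) ((hΦ a).comp (by fun_prop) fun x hx => hx a)))
        fun x hx => hx
    · simp only [hz, hΨ.zero]
    · simp only [hdi, hΨ.diag]
    · simp only [ho a _ _ _ _ (hy a (Set.mem_insert _ _))]
      exact hΨ.eq_self _ _ _ _ fun j hj => hy j (Set.mem_insert_of_mem _ hj)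
    · exact hΨ.mem q q' hq hq' s j _ (hm' q q' hq hq' s j y hy)
    · simp only at hy
      set w := Φ a ((q a, q' a), 1, y) with hw
      rcases hj with rfl | hj
      · refine h1 j _ (hq j) _ (hq' j) y ?_
        rw [← hw, ← hy, eq_comm]
        refine hΨ.eq_self _ _ _ _ fun k hk hwk => ?_
        have h2 := hΨ.mem q q' hq hq' 1 k w hwk
        rw [hy] at h2
        exact ha (hdis (hVN _ (hq j)) h2 ▸ hk)
      · have h2 : w = q' j := hΨ.one q q' hq hq' j hj w hy
        have h3 : y ∉ χ a '' Metric.ball 0 2 := fun h => by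
          have h4 : w ∈ χ a '' Metric.ball 0 2 := hm a _ (hq a) _ (hq' a) 1 y h
          rw [h2] at h4
          exact ha (hdis (hVN _ (hq' j)) h4 ▸ hj)
        rw [← h2, hw, ho a _ _ _ _ h3]

end Moves


/-! ### Local slicing of the space of configuration-sections -/

section Slicing

open scoped unitInterval

namespace Inputs

variable {m : ℕ} {M : Type u} [TopologicalSpace M] [ChartedSpace (EuclideanHalfSpace (m + 2)) M]
  {E : Type v} [TopologicalSpace E] {X : Type w} [TopologicalSpace X] (i : Inputs m M E X)

theorem continuous_proj : Continuous i.proj := by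
  rw [continuous_iff_continuousAt]
  intro e
  obtain ⟨τ, hτ⟩ := i.locTriv (i.proj e)
  exact τ.continuousAt_proj (τ.mem_source.2 hτ)

/-- The projection of the bundle as a continuous map. -/
def projMap : C(E, M) := ⟨i.proj, i.continuous_proj⟩

/-- Points move between fibres by keeping the fibre coordinate of a local trivialisation. -/
theorem hasLocalSlicing_proj : HasLocalSlicing i.projMap := by
  intro x
  obtain ⟨τ, hτ⟩ := i.locTriv x
  refine ⟨τ.baseSet, τ.open_baseSet, hτ, fun q => τ.toOpenPartialHomeomorph.symm (q.2, (τ q.1).2),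
    ?_, fun e b he hb => ?_, fun e he => ?_⟩
  · have h : ContinuousOn (fun q : E × M => τ q.1) {q | i.proj q.1 ∈ τ.baseSet ∧ q.2 ∈ τ.baseSet} :=
      τ.toOpenPartialHomeomorph.continuousOn.comp continuousOn_fst fun q hq => τ.mem_source.2 hq.1
    exact τ.toOpenPartialHomeomorph.continuousOn_symm.comp (continuousOn_snd.prodMk
      (continuous_snd.comp_continuousOn h)) fun q hq => τ.mem_target.2 hq.2
  · exact τ.proj_symm_apply (τ.mem_target.2 hb)
  · have h := τ.mem_source.2 he
    have : (i.proj e, (τ e).2) = τ e := Prod.ext (τ.coe_fst h).symm rfl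
    change τ.toOpenPartialHomeomorph.symm (i.proj e, (τ e).2) = e
    rw [this]
    exact τ.left_inv h

/-- Configuration-sections of the extended bundle with their configurations in the interior
of `M̂_t`, which are constant at `x₀` over `D × [t, ∞)`, together with `t`. -/
def Free : Type (max u v) :=
  {x : ConfSection i.hatProj × ℝ≥0 // (∀ p ∈ x.1.cfg.carrier, p ∈ i.hatInt x.2) ∧
    ∀ p (h : i.retr p ∈ i.D) hp, x.2 ≤ i.height p → x.1.sec ⟨p, hp⟩ = i.triv p h i.x₀}

instance : TopologicalSpace i.Free :=
  inferInstanceAs (TopologicalSpace {_x : ConfSection i.hatProj × ℝ≥0 // _})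

/-- The map that forgets the section. -/
def freeForget : C(i.Free, i.Cdot) where
  toFun x := ⟨x.1.1.cfg, x.1.2, x.2.1⟩
  continuous_toFun := Cdot.continuous_iff.2
    ⟨(ConfSection.continuous_cfg _).comp (continuous_fst.comp continuous_subtype_val),
      continuous_snd.comp continuous_subtype_val⟩

/-- A homotopy of the extended manifold that moves the points of the cylinder of height at
least `b` upwards by at least the time, and is supported in `W`. -/
structure IsShift (b : ℝ≥0) (W : Set i.Hat) (Ψ : C(i.Hat × ℝ≥0, i.Hat)) : Prop where
  zero : ∀ p, Ψ (p, 0) = p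
  retr_eq : ∀ p δ, i.retr p ∈ i.D → i.retr (Ψ (p, δ)) = i.retr p
  add_le : ∀ p δ, i.retr p ∈ i.D → b ≤ i.height p → i.height p + δ ≤ i.height (Ψ (p, δ))
  eq_self : ∀ p δ, p ∉ W → Ψ (p, δ) = p
  mem : ∀ p δ, p ∈ W → Ψ (p, δ) ∈ W
  subset : ∀ p, i.retr p ∈ i.D → b ≤ i.height p → p ∈ W

variable {i} in
theorem Cdot.height_lt (z : i.Cdot) {p : i.Hat} (hp : p ∈ z.cfg.carrier) (h : i.retr p ∈ i.D) :
    i.height p < z.len := by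
  rcases z.mem p hp with h' | ⟨_, h'⟩
  · exact absurd h (i.notMem_D h')
  · exact h'

variable [T2Space M] [IsManifold (modelWithCornersEuclideanHalfSpace (m + 2)) ∞ M]

/-- The shift absorbs differences of length without touching the configuration. If the length is
positive, there is room in the cylinder between the highest point of the configuration and the
length. If it is zero, there is no such room, and a neighbourhood of the disc in `M` is pushed into
the cylinder instead. -/
theorem exists_shift (z : i.Cdot) : ∃ b : ℝ≥0, ∃ W, (b = 0 ∨ b < z.len) ∧
    (∀ p ∈ z.cfg.carrier, Wᶜ ∈ 𝓝 p) ∧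
    ∃ Ψ, i.IsShift b W Ψ := by
  rcases eq_or_ne z.len 0 with hz | hz
  · have hdis : Disjoint i.D (i.retr '' z.cfg.carrier) := by
      rw [Set.disjoint_left]
      rintro _ hD ⟨p, hp, rfl⟩
      exact not_lt_zero (hz ▸ z.height_lt hp hD)
    obtain ⟨O, O', hO, hO', hDO, hzO, hOO⟩ := SeparatedNhds.of_isCompact_isCompact i.isCompact_D
      (z.cfg.finite.image i.retr).isCompact hdis
    obtain ⟨Ψ, h⟩ := i.exists_push hO hDO
    refine ⟨0, i.retr ⁻¹' O, Or.inl rfl, fun p hp => ?_, Ψ, h.zero, h.retr_eq,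
      fun p δ hp _ => h.add_le p δ hp (i.coord_mem hp), h.eq_self, h.mem, fun p hp _ => hDO hp⟩
    refine Filter.mem_of_superset ((hO'.preimage i.continuous_retr).mem_nhds
      (hzO ⟨p, hp, rfl⟩)) fun q hq hq' => ?_
    exact Set.disjoint_left.1 hOO hq' hq
  · have hpos : 0 < z.len := pos_iff_ne_zero.2 hz
    obtain ⟨a₀, ha₀, haz⟩ : ∃ a < z.len, ∀ p ∈ z.cfg.carrier, i.retr p ∈ i.D → i.height p ≤ a := by
      classical
      let S := z.cfg.finite.toFinset.filter fun p => i.retr p ∈ i.D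
      refine ⟨S.sup i.height, (Finset.sup_lt_iff hpos).2 fun p hp => ?_, fun p hp h => ?_⟩
      · simp only [S, Finset.mem_filter, Set.Finite.mem_toFinset] at hp
        exact z.height_lt hp.1 hp.2
      · exact Finset.le_sup (f := i.height) (by simp [S, hp, h])
    obtain ⟨a, ha, haz'⟩ := exists_between ha₀
    obtain ⟨b, hab, hb⟩ := exists_between haz'
    -- The speed of the shift: zero up to height `a`, which exceeds all heights of the configuration
    -- in the cylinder, and one from height `b < z.len` on.
    let lam : ℝ≥0 → ℝ≥0 := fun h => min 1 (Real.toNNReal ((h - a : ℝ) / (b - a)))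
    have hlam : Continuous lam := by fun_prop
    have hba : (0 : ℝ) < b - a := by
      have : (a : ℝ) < b := by exact_mod_cast hab
      linarith
    have hlam0 : ∀ h ≤ a, lam h = 0 := by
      intro h hh
      have h1 : ((h : ℝ) - a) / (b - a) ≤ 0 :=
        div_nonpos_of_nonpos_of_nonneg (by simpa using hh) hba.le
      simp [lam, Real.toNNReal_of_nonpos h1]
    have hlam1 : ∀ h, b ≤ h → lam h = 1 := by
      intro h hh
      have h1 : (1 : ℝ) ≤ ((h : ℝ) - a) / (b - a) := by
        rw [one_le_div hba]
        have : (b : ℝ) ≤ h := by exact_mod_cast hh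
        linarith
      exact min_eq_left (by simpa using h1)
    have hmem : ∀ q : i.Hat × ℝ≥0, i.height q.1 + lam (i.height q.1) * q.2 = 0 ∨
        i.retr q.1 ∈ i.D := by
      intro q
      by_cases h : i.retr q.1 ∈ i.D
      · exact Or.inr h
      · left
        simp only [height_eq_zero h, hlam0 0 zero_le, zero_mul, add_zero]
    let Ψ : C(i.Hat × ℝ≥0, i.Hat) := ⟨fun q => ⟨(i.retr q.1, i.height q.1 +
      lam (i.height q.1) * q.2), hmem q⟩, Continuous.subtype_mk (by fun_prop) _⟩
    have hΨr : ∀ q, i.retr (Ψ q) = i.retr q.1 := fun q => rfl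
    have hΨh : ∀ q, i.height (Ψ q) = i.height q.1 + lam (i.height q.1) * q.2 := fun q => rfl
    refine ⟨b, {p | i.retr p ∈ i.D ∧ a ≤ i.height p}, Or.inr hb, fun p hp => ?_, Ψ,
      fun p => Hat.ext (hΨr _) (by simp [hΨh]), fun p δ _ => hΨr _, fun p δ _ h => ?_,
      fun p δ hp => Hat.ext (hΨr _) ?_, fun p δ hp => ⟨hp.1, hp.2.trans ?_⟩,
      fun p hp h => ⟨hp, hab.le.trans h⟩⟩
    · refine IsOpen.mem_nhds ?_ fun h => absurd ((haz p hp h.1).trans_lt ha) (not_lt.2 h.2)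
      exact ((i.isClosed_D.preimage i.continuous_retr).inter
        (isClosed_le continuous_const i.continuous_height)).isOpen_compl
    · rw [hΨh, hlam1 _ h, one_mul]
    · rw [hΨh, hlam0, zero_mul, add_zero]
      by_cases h : i.retr p ∈ i.D
      · exact (not_le.1 fun h' => hp ⟨h, h'⟩).le
      · rw [height_eq_zero h]
        exact zero_le
    · rw [hΨh]
      exact le_self_add

omit [T2Space M] [IsManifold (modelWithCornersEuclideanHalfSpace (m + 2)) ∞ M] in
theorem hatInt_subset (t : ℝ≥0) : i.hatInt t ⊆ i.hatInterior :=
  fun _ h => h.imp id And.left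

/-- Configurations near `z₀` can be moved to each other by isotopies of the extended manifold. -/
theorem exists_isotopy (z₀ : i.Cdot) : ∃ U : Set i.Cdot, IsOpen U ∧ z₀ ∈ U ∧
    ∃ Ψ : (i.Cdot × i.Cdot) × I × i.Hat → i.Hat, ContinuousOn Ψ {x | x.1.1 ∈ U ∧ x.1.2 ∈ U} ∧
      (∀ z z' y, Ψ ((z, z'), 0, y) = y) ∧ (∀ z s y, Ψ ((z, z), s, y) = y) ∧
      (∀ z ∈ U, ∀ z' ∈ U, ∀ y, Ψ ((z, z'), 1, y) ∈ z.cfg.carrier → y ∈ z'.cfg.carrier) ∧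
      ∀ z ∈ U, ∀ z' ∈ U, ∀ y, i.retr y ∈ i.D → z'.len ≤ i.height y →
        (∀ s, i.retr (Ψ ((z, z'), s, y)) = i.retr y) ∧
        z.len ≤ i.height (Ψ ((z, z'), 1, y)) := by
  obtain ⟨b, W, hb, hW, S, hS⟩ := i.exists_shift z₀
  obtain ⟨k, f, hf⟩ := z₀.cfg.exists_ofInj
  have hfz : ∀ j, f.1 j ∈ z₀.cfg.carrier := fun j => by rw [hf]; exact ⟨j, rfl⟩
  obtain ⟨V, hV, hVd⟩ := Cfg.exists_disjoint_nhds f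
  obtain ⟨U₀, hU₀, hfU, c, hc, hcf, hcU⟩ := Cfg.exists_local_order f
  -- The charts avoid `W`, so that moving the points and shifting the cylinder have disjoint
  -- supports and do not interact.
  choose χ hχ hχm hχ0 using fun j => i.exists_chart (i.hatInt_subset _ (z₀.mem _ (hfz j)))
    (Filter.inter_mem ((hV j).1.mem_nhds (hV j).2) (hW _ (hfz j)))
  have hd : Pairwise fun j k => Disjoint (χ j '' Metric.ball 0 2) (χ k '' Metric.ball 0 2) := by
    intro j k hjk
    refine (Set.disjoint_left.2 fun y hj hk => hjk (hVd j k y hj hk)).mono ?_ ?_ <;>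
    · rintro _ ⟨x, hx, rfl⟩
      exact (hχm _ x hx).2.1
  obtain ⟨V', hV', Φ, hΦ⟩ := exists_isMove hχ hd
  have hN : ∀ y ∈ W, ∀ j ∈ Set.univ, y ∉ χ j '' Metric.ball 0 2 := by
    rintro _ hy j - ⟨x, hx, rfl⟩
    exact (hχm _ x hx).2.2 hy
  let U : Set i.Cdot := {z | (z.cfg ∈ U₀ ∧ c z.cfg ∈ Set.univ.pi V') ∧ (b = 0 ∨ b < z.len)}
  have hU : IsOpen U := by
    refine IsOpen.inter ?_ (isOpen_const.union
        (isOpen_lt (α := ℝ≥0) continuous_const Cdot.continuous_len))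
    exact (hc.isOpen_inter_preimage hU₀
        (isOpen_set_pi Set.finite_univ fun j _ => (hV' j).1)).preimage
      Cdot.continuous_cfg
  have hble : ∀ z ∈ U, b ≤ z.len := by
    rintro z ⟨-, rfl | h⟩
    · exact zero_le
    · exact h.le
  have hUV : ∀ z ∈ U, ∀ j, c z.cfg j ∈ V' j := fun z hz j => hz.1.2 j trivial
  -- The truncated difference of lengths. If `z` is not longer than `z'`, no shift is needed, since
  -- a point of height at least `z'.len` also has height at least `z.len`.
  let δ : (i.Cdot × i.Cdot) × I × i.Hat → ℝ≥0 := fun x =>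
    Real.toNNReal x.2.1 * (x.1.1.len - x.1.2.len)
  refine ⟨U, hU, ⟨⟨hf ▸ hfU, fun j _ => ?_⟩, hb⟩, fun x =>
    Φ ((c x.1.1.cfg, c x.1.2.cfg), x.2.1, S (x.2.2, δ x)), ?_, fun z z' y => ?_, fun z s y => ?_,
    fun z hz z' hz' y hy => ?_, fun z hz z' hz' y hD hy => ?_⟩
  · rw [hf, hcf, ← hχ0 j]
    exact (hV' j).2
  · refine hΦ.continuousOn.comp (ContinuousOn.prodMk (ContinuousOn.prodMk ?_ ?_)
      (ContinuousOn.prodMk (by fun_prop) ?_)) fun x hx j => ⟨hUV _ hx.1 j, hUV _ hx.2 j⟩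
    · exact hc.comp (by fun_prop) fun x hx => hx.1.1.1
    · exact hc.comp (by fun_prop) fun x hx => hx.2.1.1
    · have : Continuous δ := by fun_prop
      fun_prop
  · simp [δ, hΦ.zero, hS.zero]
  · simp [δ, hΦ.diag, hS.zero]
  · simp only [(hcU _ hz.1.1).2] at hy
    obtain ⟨j, hj⟩ := hy
    have h1 := hΦ.one _ _ (hUV z hz) (hUV z' hz') j trivial _ hj.symm
    have h2 : y ∉ W := fun hyW => by
      have h3 := hS.mem y (δ ((z, z'), 1, y)) hyW
      have h4 : c z.cfg j ∈ W := by
        rw [hj]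
        rw [hΦ.eq_self _ _ _ _ (hN _ h3)]
        exact h3
      have h5 : c z'.cfg j ∈ W := by rw [← h1]; exact h3
      obtain ⟨x, hx, hx'⟩ := hΦ.subset j (hUV z hz j)
      exact (hχm j x hx).2.2 (by rw [hx']; exact h4)
    rw [hS.eq_self _ _ h2] at h1
    rw [(hcU _ hz'.1.1).2]
    exact ⟨j, h1.symm⟩
  · have hyW := hS.subset y hD ((hble z' hz').trans hy)
    have h1 : ∀ s, Φ ((c z.cfg, c z'.cfg), s, S (y, δ ((z, z'), s, y))) =
        S (y, δ ((z, z'), s, y)) := fun s => hΦ.eq_self _ _ _ _ (hN _ (hS.mem _ _ hyW))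
    refine ⟨fun s => ?_, ?_⟩
    · simp only [h1]
      exact hS.retr_eq _ _ hD
    · simp only [h1]
      refine le_trans ?_ (hS.add_le _ _ hD ((hble z' hz').trans hy))
      simp only [δ, Set.Icc.coe_one, Real.toNNReal_one, one_mul]
      exact le_add_tsub.trans (add_le_add_left hy _)

/-- Elements of the space of configuration-sections and of the base that lie over `U`. -/
abbrev SlicePair (U : Set i.Cdot) := {x : i.Free × i.Cdot // i.freeForget x.1 ∈ U ∧ x.2 ∈ U}

/-- Elements over `U` with a point in the complement of the second configuration. -/
abbrev SlicePoint (U : Set i.Cdot) := {x : i.SlicePair U × i.Hat // x.2 ∉ x.1.1.2.cfg.carrier}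

/-- The new section at `y` is the old one at the point `Ψ₁(y)`, transported back to the fibre over
`y` along the reversed track of `y` in `M`. The new section is defined off the new configuration
because only its points are sent to the old one. On the cylinder above the new length the track is
constant in `M` and `Ψ₁(y)` lies above the old length, so the value `x₀` is preserved by a path
lifting that is constant on constant paths; the same property shows that points that need not move
stay. -/
theorem hasLocalSlicing_freeForget [SecondCountableTopology M] :
    HasLocalSlicing i.freeForget := by
  have hmet : TopologicalSpace.MetrizableSpace M := by
    have := (modelWithCornersEuclideanHalfSpace (m + 2)).locallyCompactSpace
    have := ChartedSpace.locallyCompactSpace (EuclideanHalfSpace (m + 2)) M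
    exact TopologicalSpace.metrizableSpace_of_t3_secondCountable M
  intro z₀
  obtain ⟨U, hU, hzU, Ψ, hΨ, hΨ0, hΨd, hΨm, hΨD⟩ := i.exists_isotopy z₀
  obtain ⟨Λ, hΛ, hΛp, hΛ0, hΛc⟩ := i.hasLocalSlicing_proj.exists_lifting
  let Ψ' : i.SlicePair U → I → i.Hat → i.Hat := fun a s y => Ψ ((i.freeForget a.1.1, a.1.2), s, y)
  have hΨc : Continuous fun x : i.SlicePair U × I × i.Hat => Ψ' x.1 x.2.1 x.2.2 :=
    hΨ.comp_continuous (f := fun x : i.SlicePair U × I × i.Hat =>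
      ((i.freeForget x.1.1.1, x.1.1.2), x.2.1, x.2.2)) (by fun_prop) fun x => (x.1.2 :)
  let γ : C(i.SlicePair U × i.Hat, C(I, M)) := ContinuousMap.curry
    ⟨fun x : (i.SlicePair U × i.Hat) × I => i.retr (Ψ' x.1.1 (unitInterval.symm x.2) x.1.2),
        by fun_prop⟩
  have hγ : ∀ a y s, γ (a, y) s = i.retr (Ψ' a (unitInterval.symm s) y) := fun a y s => rfl
  have hmem : ∀ x : i.SlicePoint U, Ψ' x.1.1 1 x.1.2 ∉ x.1.1.1.1.1.1.cfg.carrier := fun x h =>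
    x.2 (hΨm _ x.1.1.2.1 _ x.1.1.2.2 _ h)
  let s₁ : i.SlicePoint U → i.HatE := fun x => x.1.1.1.1.1.1.sec ⟨Ψ' x.1.1 1 x.1.2, hmem x⟩
  have hs₁ : Continuous s₁ := ConfSection.continuous_sec.comp
    (f := fun x : i.SlicePoint U => (⟨(x.1.1.1.1.1.1, Ψ' x.1.1 1 x.1.2), hmem x⟩ :
      {x : ConfSection i.hatProj × i.Hat // x.2 ∉ x.1.cfg.carrier}))
    (Continuous.subtype_mk (by
      have h1 : Continuous fun x : i.SlicePoint U => Ψ' x.1.1 1 x.1.2 :=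
        hΨc.comp (f := fun x : i.SlicePoint U => (x.1.1, (1 : I), x.1.2)) (by fun_prop)
      have hF : Continuous fun y : i.Free => y.1.1 := continuous_fst.comp continuous_subtype_val
      have h0 : Continuous fun x : i.SlicePoint U => x.1.1.1.1.1.1 :=
        hF.comp (f := fun x : i.SlicePoint U => x.1.1.1.1) (by fun_prop)
      exact h0.prodMk h1) _)
  have hs₁p : ∀ x : i.SlicePoint U, i.proj (s₁ x).1.2 = γ x.1 0 := by
    intro x
    rw [(s₁ x).2, hγ, unitInterval.symm_zero]
    exact congrArg i.retr (x.1.1.1.1.1.1.isSec ⟨_, hmem x⟩)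
  have hγ1 : ∀ x : i.SlicePair U × i.Hat, γ x 1 = i.retr x.2 := fun x => by
    rw [hγ, unitInterval.symm_one]
    simp only [Ψ', hΨ0]
  let s₂ : i.SlicePoint U → i.HatE := fun x => ⟨(x.1.2, Λ ((γ x.1, (s₁ x).1.2), 1)), by
    exact (hΛp (γ x.1) (s₁ x).1.2 (hs₁p x) 1).trans (hγ1 x.1)⟩
  have hs₂ : Continuous s₂ := by
    refine Continuous.subtype_mk (Continuous.prodMk (by fun_prop) ?_) _
    have hQ : Continuous fun x : i.SlicePoint U => x.1 := continuous_subtype_val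
    refine hΛ.comp_continuous (f := fun x : i.SlicePoint U => ((γ x.1, (s₁ x).1.2), (1 : I)))
        ?_ hs₁p
    have : Continuous fun x => (s₁ x).1.2 := continuous_snd.comp (continuous_subtype_val.comp hs₁)
    fun_prop
  let c : i.SlicePair U → ConfSection i.hatProj := fun a => ⟨a.1.2.cfg,
    ⟨fun y => s₂ ⟨(a, y.1), y.2⟩, hs₂.comp (Continuous.subtype_mk (by fun_prop) _)⟩, fun y => rfl⟩
  have hc : Continuous c := ConfSection.continuous_mk (Cdot.continuous_cfg.comp
    (continuous_snd.comp continuous_subtype_val)) hs₂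
  have hcD : ∀ a p (h : i.retr p ∈ i.D) hp, a.1.2.len ≤ i.height p →
      (c a).sec ⟨p, hp⟩ = i.triv p h i.x₀ := by
    intro a p h hp hl
    obtain ⟨h1, h2⟩ := hΨD _ a.2.1 _ a.2.2 p h hl
    have h3 : i.retr (Ψ' a 1 p) ∈ i.D := by
      have := h1 1
      simp only [Ψ', this, h]
    have h4 : s₁ ⟨(a, p), hp⟩ = i.triv _ h3 i.x₀ := a.1.1.2.2 _ h3 _ h2
    refine Subtype.ext (Prod.ext rfl ?_)
    change Λ ((γ (a, p), (s₁ ⟨(a, p), hp⟩).1.2), 1) = _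
    rw [hΛc]
    · rw [h4]
      have h5 : i.retr (Ψ' a 1 p) = i.retr p := h1 1
      have h6 : (⟨i.retr (Ψ' a 1 p), h3⟩ : {x // x ∈ i.D}) = ⟨i.retr p, h⟩ := Subtype.ext h5
      exact congrArg (fun d => (i.θ.symm (d, i.x₀)).1) h6
    · intro s
      change γ (a, p) s = i.proj _
      rw [hs₁p ⟨(a, p), hp⟩, hγ, hγ]
      exact (h1 _).trans (h1 _).symm
  let g₀ : i.SlicePair U → i.Free := fun a => ⟨(c a, a.1.2.len), a.1.2.mem, hcD a⟩
  have hg₀ : Continuous g₀ := Continuous.subtype_mk (hc.prodMk (by fun_prop)) _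
  classical
  let g : i.Free × i.Cdot → i.Free := fun x => if h : i.freeForget x.1 ∈ U ∧ x.2 ∈ U then
    g₀ ⟨x, h⟩ else x.1
  refine ⟨U, hU, hzU, g, ?_, fun e z he hz => ?_, fun e he => ?_⟩
  · rw [continuousOn_iff_continuous_domRestrict]
    convert hg₀ using 1
    funext a
    exact dif_pos a.2
  · have h : g (e, z) = g₀ ⟨(e, z), he, hz⟩ := dif_pos (⟨he, hz⟩ : _ ∧ _)
    rw [h]
    rfl
  · have h : g (e, i.freeForget e) = g₀ ⟨(e, i.freeForget e), he, he⟩ :=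
      dif_pos (⟨he, he⟩ : _ ∧ _)
    rw [h]
    refine Subtype.ext (Prod.ext (ConfSection.ext' rfl fun y hy hy' => ?_) rfl)
    have h1 : ∀ s, Ψ' ⟨(e, i.freeForget e), he, he⟩ s y = y := fun s => hΨd _ _ _
    let x : i.SlicePoint U := ⟨(⟨(e, i.freeForget e), he, he⟩, y), hy⟩
    have h2 : s₁ x = e.1.1.sec ⟨y, hy'⟩ := by
      simp only [s₁]
      congr 1
      exact Subtype.ext (h1 1)
    change s₂ x = _
    refine Subtype.ext (Prod.ext ?_ ?_)
    · exact (congrArg (fun y => y) (e.1.1.isSec ⟨y, hy'⟩)).symm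
    · change Λ ((γ x.1, (s₁ x).1.2), 1) = _
      rw [hΛc, h2]
      intro s
      change γ x.1 s = i.proj _
      rw [hs₁p x, hγ, hγ, h1, h1]

end Inputs

end Slicing


/-! ### The components of local sections -/

section Germs

variable {Y : Type u} [TopologicalSpace Y] {T : Type v} [TopologicalSpace T]
variable {d : ℕ} {π : T → Y} {I : Set Y}

theorem isOpen_image_chart {F : Type*} [TopologicalSpace F] {χ : F → Y} {B S : Set F}
    (hχ : IsOpenEmbedding fun x : B => χ x) (hS : IsOpen S) (hSB : S ⊆ B) : IsOpen (χ '' S) := by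
  convert hχ.isOpenMap _ (hS.preimage continuous_subtype_val) using 1
  ext y
  constructor
  · rintro ⟨x, hx, rfl⟩
    exact ⟨⟨x, hSB hx⟩, hx, rfl⟩
  · rintro ⟨x, hx, rfl⟩
    exact ⟨x.1, hx, rfl⟩

theorem chart_inj {F : Type*} [TopologicalSpace F] {χ : F → Y} {B : Set F}
    (hχ : IsOpenEmbedding fun x : B => χ x) {x x' : F} (hx : x ∈ B) (hx' : x' ∈ B)
    (h : χ x = χ x') : x = x' :=
  congrArg Subtype.val (hχ.injective (a₁ := ⟨x, hx⟩) (a₂ := ⟨x', hx'⟩) h)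

theorem continuousOn_chart {F : Type*} [TopologicalSpace F] {χ : F → Y} {B : Set F}
    (hχ : IsOpenEmbedding fun x : B => χ x) : ContinuousOn χ B := by
  rw [continuousOn_iff_continuous_domRestrict]
  exact hχ.continuous

namespace LocalSection

theorem isOpen_inner (L : LocalSection d π I) : IsOpen L.inner :=
  isOpen_image_chart L.chart_emb Metric.isOpen_ball (Metric.ball_subset_ball (by norm_num))

theorem inner_subset (L : LocalSection d π I) : L.inner ⊆ I := by
  rintro _ ⟨x, hx, rfl⟩
  exact L.chart_mem x (Metric.ball_subset_ball (by norm_num) hx)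

theorem inner_subset_ball (L : LocalSection d π I) : L.inner ⊆ L.ball :=
  Set.image_mono Metric.ball_subset_closedBall

theorem chart_notMem_inner (L : LocalSection d π I)
    (y : Metric.sphere (0 : EuclideanSpace ℝ (Fin d)) 1) : L.chart y ∉ L.inner := by
  rintro ⟨x, hx, hxy⟩
  have hy : ‖y.1‖ = 1 := by simp
  have hx' : ‖x‖ < 1 := by simpa using hx
  have := chart_inj L.chart_emb (x := x) (x' := y.1) (by simp; linarith) (by simp [hy]) hxy
  rw [this, hy] at hx'
  exact lt_irrefl _ hx'

theorem chart_mem_ball (L : LocalSection d π I)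
    (y : Metric.sphere (0 : EuclideanSpace ℝ (Fin d)) 1) : L.chart y ∈ L.ball :=
  ⟨y, Metric.sphere_subset_closedBall y.2, rfl⟩

theorem germ_eq_of_nested {L L' : LocalSection d π I} (h : L.Nested L') (p : I)
    (hp : p.1 ∈ L.inner) (hp' : p.1 ∈ L'.inner) : L.germ p hp = L'.germ p hp' :=
  congrArg (Sigma.mk p) (Quot.sound h)

/-- A chain of nestings involves finitely many balls, and it is equally valid at all points in the
interiors of all these balls. -/
theorem eventually_germ_eq {L L' : LocalSection d π I} {p : I} {hp : p.1 ∈ L.inner}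
    {hp' : p.1 ∈ L'.inner} (h : L.germ p hp = L'.germ p hp') :
    ∀ᶠ q in 𝓝 p, ∃ h h', L.germ q h = L'.germ q h' := by
  have h1 := Quot.eqvGen_exact (eq_of_heq (Sigma.mk.inj h).2)
  have key : ∀ a b : {L : LocalSection d π I // p.1 ∈ L.inner},
      Relation.EqvGen (fun L L' => L.1.Nested L'.1) a b →
      ∀ᶠ q in 𝓝 p, ∃ h h', a.1.germ q h = b.1.germ q h' := by
    have hin : ∀ a : {L : LocalSection d π I // p.1 ∈ L.inner}, ∀ᶠ q : I in 𝓝 p, q.1 ∈ a.1.inner :=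
      fun a => (a.1.isOpen_inner.preimage continuous_subtype_val).mem_nhds a.2
    intro a b hab
    induction hab with
    | rel a b hab =>
      filter_upwards [hin a, hin b] with q ha hb
      exact ⟨ha, hb, germ_eq_of_nested hab q ha hb⟩
    | refl a =>
      filter_upwards [hin a] with q ha
      exact ⟨ha, ha, rfl⟩
    | symm a b _ ih =>
      filter_upwards [ih] with q ⟨ha, hb, h⟩
      exact ⟨hb, ha, h.symm⟩
    | trans a b c _ _ ih ih' =>
      filter_upwards [ih, ih'] with q ⟨ha, hb, h⟩ ⟨hb', hc, h'⟩
      exact ⟨ha, hc, h.trans h'⟩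
  exact key _ _ h1

theorem continuous_germ (L : LocalSection d π I) :
    Continuous fun p : {p : I // p.1 ∈ L.inner} => L.germ p.1 p.2 := by
  refine continuous_generateFrom_iff.2 ?_
  rintro _ ⟨L', rfl⟩
  rw [isOpen_iff_mem_nhds]
  rintro ⟨p, hp⟩ ⟨hp', h⟩
  have h1 := eventually_germ_eq (L := L) (L' := L') (hp := hp) (hp' := hp') h
  have h2 := (continuous_subtype_val.tendsto (⟨p, hp⟩ : {p : I // p.1 ∈ L.inner})).eventually h1
  filter_upwards [h2] with q ⟨hq, hq', hqq⟩
  exact ⟨hq', hqq⟩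

/-- The germ of `L` varies continuously over the connected interior of its ball. -/
theorem comp_eq_of_mem (L : LocalSection d π I) (p q : I) (hp : p.1 ∈ L.inner)
    (hq : q.1 ∈ L.inner) : L.comp p hp = L.comp q hq := by
  have h1 : IsPreconnected L.inner := by
    refine (convex_ball _ _).isPreconnected.image _ ((continuousOn_chart L.chart_emb).mono ?_)
    exact Metric.ball_subset_ball (by norm_num)
  have h2 : Continuous fun p : L.inner => L.germ ⟨p.1, L.inner_subset p.2⟩ p.2 :=
    L.continuous_germ.comp (f := fun p : L.inner =>
      (⟨⟨p.1, L.inner_subset p.2⟩, p.2⟩ : {p : I // p.1 ∈ L.inner})) (by fun_prop)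
  have : PreconnectedSpace L.inner := Subtype.preconnectedSpace h1
  have h3 := isPreconnected_range h2
  refine ConnectedComponents.coe_eq_coe'.2 ?_
  exact h3.subset_connectedComponent (x := L.germ q hq) ⟨⟨q.1, hq⟩, rfl⟩ ⟨⟨p.1, hp⟩, rfl⟩

end LocalSection

end Germs

/-! ### Charges in families -/

section Charges

namespace Inputs

variable {m : ℕ} {M : Type u} [TopologicalSpace M] [ChartedSpace (EuclideanHalfSpace (m + 2)) M]
  {E : Type v} [TopologicalSpace E] {X : Type w} [TopologicalSpace X] (i : Inputs m M E X)

/-- A family, parametrised by `ℝ`, of sections of the extended bundle over punctured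
neighbourhoods of points in the interior. -/
structure PuncturedFamily where
  /-- the points -/
  pt : ℝ → i.hatInterior
  continuous_pt : Continuous pt
  /-- the neighbourhoods -/
  dom : Set (ℝ × i.Hat)
  isOpen_dom : IsOpen dom
  mem_dom : ∀ s, (s, (pt s).1) ∈ dom
  /-- the sections -/
  sec : {x : ℝ × i.Hat // x ∈ dom ∧ x.2 ≠ pt x.1} → i.HatE
  continuous_sec : Continuous sec
  isSec : ∀ x, i.hatProj (sec x) = x.1.2

namespace PuncturedFamily

variable {i} (F : i.PuncturedFamily)

/-- A local section that comes from a family of sections at the parameter `s`. -/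
structure Fits (s : ℝ) (L : LocalSection (m + 2) i.hatProj i.hatInterior) : Prop where
  mem : (F.pt s).1 ∈ L.inner
  subset : ∀ y ∈ L.ball, (s, y) ∈ F.dom
  eq : ∀ y h, L.sec y = F.sec ⟨(s, L.chart y), h⟩

theorem Fits.sec_dom {F : i.PuncturedFamily} {s : ℝ}
    {L : LocalSection (m + 2) i.hatProj i.hatInterior} (hL : F.Fits s L)
    (y : Metric.sphere (0 : EuclideanSpace ℝ (Fin (m + 2))) 1) :
    (s, L.chart y) ∈ F.dom ∧ L.chart y ≠ F.pt s :=
  ⟨hL.subset _ (L.chart_mem_ball y), fun h => L.chart_notMem_inner y (h ▸ hL.mem)⟩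

/-- The local section over the boundary of a ball that comes from a family of sections. -/
def localSection (s : ℝ) (χ : EuclideanSpace ℝ (Fin (m + 2)) → i.Hat)
    (hχ : IsOpenEmbedding fun x : Metric.ball (0 : EuclideanSpace ℝ (Fin (m + 2))) 2 => χ x)
    (hI : ∀ x ∈ Metric.ball (0 : EuclideanSpace ℝ (Fin (m + 2))) 2, χ x ∈ i.hatInterior)
    (h : ∀ y : Metric.sphere (0 : EuclideanSpace ℝ (Fin (m + 2))) 1,
      (s, χ y) ∈ F.dom ∧ χ y ≠ F.pt s) :
    LocalSection (m + 2) i.hatProj i.hatInterior where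
  chart := χ
  chart_emb := hχ
  chart_mem := hI
  sec := ⟨fun y => F.sec ⟨(s, χ y), h y⟩, F.continuous_sec.comp (Continuous.subtype_mk
    (continuous_const.prodMk ((continuousOn_chart hχ).comp_continuous continuous_subtype_val
      fun y => Metric.closedBall_subset_ball (by norm_num)
        (Metric.sphere_subset_closedBall y.2))) _)⟩
  isSec y := F.isSec _

variable [T2Space M] [IsManifold (modelWithCornersEuclideanHalfSpace (m + 2)) ∞ M]

omit [T2Space M] in
/-- There are local sections of arbitrarily small size that come from a family of sections. -/
theorem exists_fits (s : ℝ) {N : Set i.Hat} (hN : N ∈ 𝓝 (F.pt s).1) :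
    ∃ L, F.Fits s L ∧ L.ball ⊆ N := by
  have h1 : {y | (s, y) ∈ F.dom} ∈ 𝓝 (F.pt s).1 :=
    (F.isOpen_dom.preimage (by fun_prop : Continuous fun y => (s, y))).mem_nhds (F.mem_dom s)
  obtain ⟨χ, hχ, hm, h0⟩ := i.exists_chart (F.pt s).2 (Filter.inter_mem hN h1)
  have hb : Metric.closedBall (0 : EuclideanSpace ℝ (Fin (m + 2))) 1 ⊆ Metric.ball 0 2 :=
    Metric.closedBall_subset_ball (by norm_num)
  refine ⟨F.localSection s χ hχ (fun x hx => (hm x hx).1) fun y => ⟨?_, fun h => ?_⟩,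
    ⟨⟨0, by simp, h0⟩, ?_, fun y h => rfl⟩, ?_⟩
  · exact (hm _ (hb (Metric.sphere_subset_closedBall y.2))).2.2
  · rw [← h0] at h
    have h2 := chart_inj hχ (hb (Metric.sphere_subset_closedBall y.2)) (by simp) h
    have h3 : ‖y.1‖ = 1 := by simp
    rw [h2] at h3
    simp at h3
  · rintro _ ⟨x, hx, rfl⟩
    exact (hm _ (hb hx)).2.2
  · rintro _ ⟨x, hx, rfl⟩
    exact (hm _ (hb hx)).2.1

omit [T2Space M] [IsManifold (modelWithCornersEuclideanHalfSpace (m + 2)) ∞ M] in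
theorem Fits.nested {s : ℝ} {L L' : LocalSection (m + 2) i.hatProj i.hatInterior}
    (h : F.Fits s L) (h' : F.Fits s L') (hLL : L.ball ⊆ L'.inner) : L.Nested L' := by
  have hd : ∀ y : ↥(L'.ball \ L.inner), (s, y.1) ∈ F.dom ∧ y.1 ≠ F.pt s :=
    fun y => ⟨h'.subset _ y.2.1, fun hy => y.2.2 (hy ▸ h.mem)⟩
  exact ⟨hLL, ⟨fun y => F.sec ⟨(s, y.1), hd y⟩, F.continuous_sec.comp (by fun_prop)⟩,
    fun y => F.isSec _, fun x hx => (h.eq x _).symm, fun x hx => (h'.eq x _).symm⟩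

/-- Both balls contain a smaller one in their interiors, and the given section itself extends the
boundary values over the regions in between. -/
theorem Fits.comp_eq_of_eq {s : ℝ} {L L' : LocalSection (m + 2) i.hatProj i.hatInterior}
    (h : F.Fits s L) (h' : F.Fits s L') : L.comp (F.pt s) h.mem = L'.comp (F.pt s) h'.mem := by
  obtain ⟨L₀, h₀, hs⟩ := F.exists_fits s ((L.isOpen_inner.inter L'.isOpen_inner).mem_nhds
    ⟨h.mem, h'.mem⟩)
  refine congrArg ConnectedComponents.mk ?_
  rw [← LocalSection.germ_eq_of_nested (h₀.nested F h fun y hy => (hs hy).1) _ h₀.mem,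
    LocalSection.germ_eq_of_nested (h₀.nested F h' fun y hy => (hs hy).2) _ h₀.mem]

omit [T2Space M] [IsManifold (modelWithCornersEuclideanHalfSpace (m + 2)) ∞ M] in
theorem isOpenEmbedding_smul {χ : EuclideanSpace ℝ (Fin (m + 2)) → i.Hat}
    (hχ : IsOpenEmbedding fun x : Metric.ball (0 : EuclideanSpace ℝ (Fin (m + 2))) 2 => χ x) :
    IsOpenEmbedding fun x : Metric.ball (0 : EuclideanSpace ℝ (Fin (m + 2))) 2 =>
      χ ((1 / 2 : ℝ) • x.1) := by
  have hm : ∀ x : Metric.ball (0 : EuclideanSpace ℝ (Fin (m + 2))) 2,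
      (1 / 2 : ℝ) • x.1 ∈ Metric.ball (0 : EuclideanSpace ℝ (Fin (m + 2))) 2 := by
    intro x
    have := x.2
    simp only [mem_ball_zero_iff, norm_smul] at this ⊢
    norm_num
    linarith [norm_nonneg x.1]
  have h1 : IsOpenEmbedding fun x : Metric.ball (0 : EuclideanSpace ℝ (Fin (m + 2))) 2 =>
      (⟨(1 / 2 : ℝ) • x.1, hm x⟩ : Metric.ball (0 : EuclideanSpace ℝ (Fin (m + 2))) 2) := by
    refine IsOpenEmbedding.of_comp _ Metric.isOpen_ball.isOpenEmbedding_subtypeVal ?_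
    exact (Homeomorph.smulOfNeZero (1 / 2 : ℝ) (by norm_num)).isOpenEmbedding.comp
      Metric.isOpen_ball.isOpenEmbedding_subtypeVal
  exact hχ.comp h1

/-- In one chart, the sphere of radius `1 / 2` with parameter `s'` is compared with the unit sphere
with parameter `s`. The parameter runs from `s'` to `s` as the radius grows from `1 / 2` to `1`;
this gives a section over the annulus, because for all these parameters the puncture is in the
smaller ball. -/
theorem eventually_comp_eq (s : ℝ) : ∃ c, ∀ᶠ s' in 𝓝 s, ∀ L (h : F.Fits s' L),
    L.comp (F.pt s') h.mem = c := by
  have hd : ∀ᶠ x : ℝ × i.Hat in 𝓝 s ×ˢ 𝓝 (F.pt s).1, x ∈ F.dom := by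
    rw [← nhds_prod_eq]
    exact F.isOpen_dom.mem_nhds (F.mem_dom s)
  obtain ⟨P, hP, N, hN, hPN⟩ := Filter.eventually_prod_iff.1 hd
  obtain ⟨χ, hχ, hm, h0⟩ := i.exists_chart (F.pt s).2 hN
  have hpt : ∀ᶠ s' in 𝓝 s, (F.pt s').1 ∈ χ '' Metric.ball 0 (1 / 2) := by
    refine (continuous_subtype_val.comp F.continuous_pt).continuousAt.preimage_mem_nhds
      ((isOpen_image_chart hχ Metric.isOpen_ball (Metric.ball_subset_ball (by norm_num))).mem_nhds
        ⟨0, by simp, h0⟩)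
  obtain ⟨ε, hε, hball⟩ := Metric.eventually_nhds_iff_ball.1 (hP.and hpt)
  obtain ⟨c, hc, hcχ⟩ := exists_coordinates hχ
  have hin : ∀ r ∈ Metric.ball s ε, ∀ x ∈ Metric.ball (0 : EuclideanSpace ℝ (Fin (m + 2))) 2,
      1 / 2 ≤ ‖x‖ → (r, χ x) ∈ F.dom ∧ χ x ≠ F.pt r := by
    refine fun r hr x hx hx2 => ⟨hPN (hball r hr).1 (hm x hx).2, fun h => ?_⟩
    obtain ⟨x', hx', hxx⟩ := (hball r hr).2
    have h2 := chart_inj hχ (Metric.ball_subset_ball (by norm_num) hx') hx (hxx.trans h.symm)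
    rw [h2, mem_ball_zero_iff] at hx'
    linarith
  have hsphere : ∀ y : Metric.sphere (0 : EuclideanSpace ℝ (Fin (m + 2))) 1, ‖y.1‖ = 1 :=
    fun y => by simp
  let L₀ : LocalSection (m + 2) i.hatProj i.hatInterior :=
    F.localSection s χ hχ (fun x hx => (hm x hx).1) fun y =>
      hin s (Metric.mem_ball_self hε) y (by simp [hsphere y]) (by rw [hsphere y]; norm_num)
  have hpL : (F.pt s).1 ∈ L₀.inner := ⟨0, by simp, h0⟩
  refine ⟨L₀.comp (F.pt s) hpL, Filter.eventually_of_mem (Metric.ball_mem_nhds s hε) ?_⟩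
  intro s' hs' L hL
  have hhalf : ∀ x : EuclideanSpace ℝ (Fin (m + 2)), ‖(1 / 2 : ℝ) • x‖ = ‖x‖ / 2 := by
    intro x
    rw [norm_smul]
    norm_num
    ring
  let L₁ : LocalSection (m + 2) i.hatProj i.hatInterior :=
    F.localSection s' (fun x => χ ((1 / 2 : ℝ) • x)) (isOpenEmbedding_smul hχ)
      (fun x hx => (hm _ (by
        rw [mem_ball_zero_iff] at hx ⊢
        rw [hhalf]; linarith)).1) fun y =>
      hin s' hs' _ (by rw [mem_ball_zero_iff, hhalf, hsphere]; norm_num)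
        (by rw [hhalf, hsphere])
  have hball' : ∀ y ∈ L₁.ball, ∃ x, ‖x‖ ≤ 1 / 2 ∧ y = χ x := by
    rintro _ ⟨x, hx, rfl⟩
    refine ⟨(1 / 2 : ℝ) • x, ?_, rfl⟩
    rw [hhalf]
    have : ‖x‖ ≤ 1 := by simpa using hx
    linarith
  have hinner' : ∀ x, ‖x‖ < 1 / 2 → χ x ∈ L₁.inner := by
    intro x hx
    refine ⟨(2 : ℝ) • x, ?_, ?_⟩
    · rw [mem_ball_zero_iff, norm_smul]
      norm_num
      linarith
    · change χ ((1 / 2 : ℝ) • (2 : ℝ) • x) = χ x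
      rw [smul_smul]
      norm_num
  have h₁ : F.Fits s' L₁ := by
    refine ⟨?_, ?_, fun y h => rfl⟩
    · obtain ⟨x, hx, hxx⟩ := (hball s' hs').2
      rw [← hxx]
      exact hinner' x (by simpa using hx)
    · intro y hy
      obtain ⟨x, hx, rfl⟩ := hball' y hy
      exact hPN (hball s' hs').1 (hm x (by rw [mem_ball_zero_iff]; linarith)).2
  have hsub : L₁.ball ⊆ L₀.inner := by
    intro y hy
    obtain ⟨x, hx, rfl⟩ := hball' y hy
    exact ⟨x, by rw [mem_ball_zero_iff]; linarith, rfl⟩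
  -- interpolate between the parameters
  let μ : i.Hat → ℝ := fun y => s + (2 - 2 * ‖c y‖) * (s' - s)
  have hann : ∀ y : ↥(L₀.ball \ L₁.inner), 1 / 2 ≤ ‖c y.1‖ ∧ ‖c y.1‖ ≤ 1 ∧ χ (c y.1) = y.1 := by
    rintro ⟨_, ⟨x, hx, rfl⟩, hy⟩
    have hx1 : ‖x‖ ≤ 1 := by simpa using hx
    have hcx : c (χ x) = x := hcχ x (by rw [mem_ball_zero_iff]; linarith)
    have e : L₀.chart x = χ x := rfl
    simp only [e, hcx]
    exact ⟨not_lt.1 fun h => hy (hinner' x h), hx1, trivial⟩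
  have hμ : ∀ y : ↥(L₀.ball \ L₁.inner), μ y.1 ∈ Metric.ball s ε := by
    intro y
    obtain ⟨h1, h2, -⟩ := hann y
    rw [Metric.mem_ball, Real.dist_eq] at hs' ⊢
    simp only [μ, add_sub_cancel_left, abs_mul]
    refine lt_of_le_of_lt (mul_le_of_le_one_left (abs_nonneg _) ?_) hs'
    rw [abs_le]
    constructor <;> linarith
  have hdm : ∀ y : ↥(L₀.ball \ L₁.inner), (μ y.1, y.1) ∈ F.dom ∧ y.1 ≠ F.pt (μ y.1) := by
    intro y
    obtain ⟨h1, h2, h3⟩ := hann y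
    have := hin _ (hμ y) (c y.1) (by rw [mem_ball_zero_iff]; linarith) h1
    rwa [h3] at this
  have hcc : Continuous fun y : ↥(L₀.ball \ L₁.inner) => c y.1 :=
    hc.comp_continuous continuous_subtype_val fun y => by
      obtain ⟨h1, h2, h3⟩ := hann y
      exact ⟨c y.1, by rw [mem_ball_zero_iff]; linarith, h3⟩
  have hμc : Continuous fun y : ↥(L₀.ball \ L₁.inner) => μ y.1 :=
    continuous_const.add ((continuous_const.sub
        (continuous_const.mul hcc.norm)).mul continuous_const)
  have hval : ∀ (r : ℝ) (y : i.Hat) (r' : ℝ) (h : (r, y) ∈ F.dom ∧ y ≠ F.pt r)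
      (h' : (r', y) ∈ F.dom ∧ y ≠ F.pt r'), r = r' → F.sec ⟨(r, y), h⟩ = F.sec ⟨(r', y), h'⟩ := by
    rintro r y _ h h' rfl
    rfl
  have hnest : L₁.Nested L₀ := by
    refine ⟨hsub, ⟨fun y => F.sec ⟨(μ y.1, y.1), hdm y⟩, F.continuous_sec.comp
      ((hμc.prodMk continuous_subtype_val).subtype_mk _)⟩,
      fun y => F.isSec _, fun x hx => hval _ _ _ _ _ ?_, fun x hx => hval _ _ _ _ _ ?_⟩
    · change s + (2 - 2 * ‖c (χ ((1 / 2 : ℝ) • x.1))‖) * (s' - s) = s'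
      rw [hcχ _ (by rw [mem_ball_zero_iff, hhalf, hsphere]; norm_num), hhalf, hsphere]
      ring
    · change s + (2 - 2 * ‖c (χ x.1)‖) * (s' - s) = s
      rw [hcχ _ (by rw [mem_ball_zero_iff, hsphere]; norm_num), hsphere]
      ring
  have hmem : (F.pt s').1 ∈ L₀.inner := hsub (L₁.inner_subset_ball h₁.mem)
  rw [hL.comp_eq_of_eq F h₁, ← L₀.comp_eq_of_mem (F.pt s') (F.pt s) hmem]
  exact congrArg ConnectedComponents.mk (LocalSection.germ_eq_of_nested hnest _ _ _)

/-- The component of the local sections that come from a family of sections is constant. -/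
theorem Fits.comp_eq {s s' : ℝ} {L L' : LocalSection (m + 2) i.hatProj i.hatInterior}
    (h : F.Fits s L) (h' : F.Fits s' L') : L.comp (F.pt s) h.mem = L'.comp (F.pt s') h'.mem := by
  choose K hK _ using fun s => F.exists_fits s Filter.univ_mem
  have hloc : IsLocallyConstant fun s => (K s).comp (F.pt s) (hK s).mem := by
    rw [IsLocallyConstant.iff_eventually_eq]
    intro s
    obtain ⟨c, hc⟩ := F.eventually_comp_eq s
    filter_upwards [hc] with s' hs'
    rw [hs' _ (hK s'), hc.self_of_nhds _ (hK s)]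
  rw [h.comp_eq_of_eq F (hK s), h'.comp_eq_of_eq F (hK s')]
  exact hloc.apply_eq_of_preconnectedSpace s s'

end PuncturedFamily

end Inputs

end Charges


/-! ### The fibration property -/

section Fibration

open scoped unitInterval

namespace Inputs

variable {m : ℕ} {M : Type u} [TopologicalSpace M] [ChartedSpace (EuclideanHalfSpace (m + 2)) M]
  {E : Type v} [TopologicalSpace E] {X : Type w} [TopologicalSpace X] (i : Inputs m M E X)

theorem isEmbedding_cdot : IsEmbedding fun z : i.Cdot => (z.cfg, z.len) :=
  ⟨⟨rfl⟩, fun _ _ h => Cdot.ext (congrArg Prod.fst h) (congrArg Prod.snd h)⟩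

instance [T2Space M] [SecondCountableTopology M] : SecondCountableTopology i.Cdot :=
  i.isEmbedding_cdot.secondCountableTopology

/-- Needed for `HasLocalSlicing.exists_lifting`, which uses partitions of unity on the base and on
its path space. -/
instance [T2Space M] [SecondCountableTopology M] : TopologicalSpace.MetrizableSpace i.Cdot := by
  have := i.isEmbedding_cdot.t3Space
  exact TopologicalSpace.metrizableSpace_of_t3_secondCountable i.Cdot

variable {i}

theorem Free.continuous_val : Continuous (Subtype.val : i.Free → ConfSection i.hatProj × ℝ≥0) :=
  continuous_subtype_val

theorem Free.continuous_conf : Continuous fun x : i.Free => x.1.1 :=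
  continuous_fst.comp continuous_subtype_val

theorem Free.continuous_len : Continuous fun x : i.Free => x.1.2 :=
  continuous_snd.comp continuous_subtype_val

variable [T2Space M]

theorem Free.continuous_sec : Continuous fun x :
    {x : i.Free × i.Hat // x.2 ∉ x.1.1.1.cfg.carrier} =>
    x.1.1.1.1.sec ⟨x.1.2, x.2⟩ :=
  ConfSection.continuous_sec.comp (f := fun x : {x : i.Free × i.Hat // x.2 ∉ x.1.1.1.cfg.carrier} =>
    (⟨(x.1.1.1.1, x.1.2), x.2⟩ : {x : ConfSection i.hatProj × i.Hat // x.2 ∉ x.1.cfg.carrier}))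
    (((Free.continuous_conf.comp (continuous_fst.comp continuous_subtype_val)).prodMk
      (continuous_snd.comp continuous_subtype_val)).subtype_mk _)

omit [T2Space M] in
theorem notMem_of_ne {x : i.Free} {k : ℕ} {f : OrdCfg k i.Hat} (h : x.1.1.cfg = Cfg.ofInj k f)
    {j : Fin k} {y : i.Hat} (hy : ∀ j', j' ≠ j → y ≠ f.1 j') (hj : y ≠ f.1 j) :
    y ∉ x.1.1.cfg.carrier := by
  rw [h]
  rintro ⟨j', rfl⟩
  by_cases h : j' = j
  · subst h
    exact hj rfl
  · exact hy j' h rfl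

/-- The sections near a point of a moving configuration. -/
noncomputable def pathFamily (G : C(I, i.Free)) {k : ℕ} (c : C(I, OrdCfg k i.Hat))
    (hc : ∀ s, (G s).1.1.cfg = Cfg.ofInj k (c s)) (j : Fin k) : i.PuncturedFamily where
  pt r := ⟨(c (Set.projIcc 0 1 zero_le_one r)).1 j, i.hatInt_subset _ ((G _).2.1 _ (by
    rw [hc]; exact ⟨j, rfl⟩))⟩
  continuous_pt := by
    refine Continuous.subtype_mk ?_ _
    exact (continuous_apply j).comp (continuous_subtype_val.comp (c.continuous.comp
      continuous_projIcc))
  dom := {x | ∀ j', j' ≠ j → x.2 ≠ (c (Set.projIcc 0 1 zero_le_one x.1)).1 j'}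
  isOpen_dom := by
    simp only [Set.ofPred_forall]
    refine isOpen_iInter_of_finite fun j' => isOpen_iInter_of_finite fun _ => ?_
    exact isOpen_ne_fun continuous_snd ((continuous_apply j').comp (continuous_subtype_val.comp
      (c.continuous.comp (continuous_projIcc.comp continuous_fst))))
  mem_dom s j' hj' h := hj' ((c _).2 h).symm
  sec x := (G (Set.projIcc 0 1 zero_le_one x.1.1)).1.1.sec ⟨x.1.2,
    notMem_of_ne (hc _) x.2.1 x.2.2⟩
  continuous_sec := by
    have h1 : Continuous (Set.projIcc (0 : ℝ) 1 zero_le_one) := continuous_projIcc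
    have h2 : Continuous fun x : ℝ × i.Hat => (G (Set.projIcc 0 1 zero_le_one x.1), x.2) := by
      fun_prop
    exact Free.continuous_sec.comp (Continuous.subtype_mk (h2.comp continuous_subtype_val)
      fun x => notMem_of_ne (hc _) x.2.1 x.2.2)
  isSec x := ConfSection.isSec _ _

variable [IsManifold (modelWithCornersEuclideanHalfSpace (m + 2)) ∞ M]

/-- A point of the configuration is followed back to time zero by ordering the configurations
continuously. The sections near this moving point form a punctured family, along which the class of
the charge is constant. -/
theorem charged_of_path (G : C(I, i.Free)) (h0 : i.Charged (G 0).1.1) (s : I) :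
    i.Charged (G s).1.1 := by
  obtain ⟨k, c, hc⟩ := Cfg.exists_tracks
    ⟨fun s => (G s).1.1.cfg, (ConfSection.continuous_cfg _).comp
      (Free.continuous_conf.comp G.continuous)⟩
  intro p L hp hL hs
  have hpj : p.1 ∈ (G s).1.1.cfg.carrier := by
    have : p.1 ∈ L.ball ∩ (G s).1.1.cfg.carrier := by rw [hL]; rfl
    exact this.2
  obtain ⟨j, hj⟩ : ∃ j, (c s).1 j = p.1 := by
    have h1 : (G s).1.1.cfg = Cfg.ofInj k (c s) := hc s
    rw [h1] at hpj
    exact hpj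
  let F := pathFamily G c hc j
  have hproj : ∀ s : I, Set.projIcc (0 : ℝ) 1 zero_le_one s = s := fun s => Set.projIcc_val _ s
  have hpt : ∀ s : I, (F.pt s).1 = (c s).1 j := fun s => by
    change (c (Set.projIcc 0 1 zero_le_one s)).1 j = _
    rw [hproj]
  have hpp : F.pt s = p := Subtype.ext ((hpt s).trans hj)
  have hsec : ∀ (s : I) y h h', F.sec ⟨((s : ℝ), y), h⟩ = (G s).1.1.sec ⟨y, h'⟩ := by
    intro s y h h'
    have : ∀ (s' : I) h'', s' = s → (G s').1.1.sec ⟨y, h''⟩ = (G s).1.1.sec ⟨y, h'⟩ := by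
      rintro s' h'' rfl
      rfl
    exact this _ _ (hproj s)
  have hfit : F.Fits s L := by
    refine ⟨by rw [hpp]; exact hp, fun y hy j' hj' h => ?_, fun y h => ?_⟩
    · replace h : y = (c s).1 j' := by rw [← hproj s]; exact h
      have h1 : y ∈ L.ball ∩ (G s).1.1.cfg.carrier := by
        refine ⟨hy, ?_⟩
        have h2 : (G s).1.1.cfg = Cfg.ofInj k (c s) := hc s
        rw [h2, h]
        exact ⟨j', rfl⟩
      rw [hL] at h1
      have h2 : (c s).1 j' = (c s).1 j := by
        rw [hj, ← show y = p.1 from h1, h]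
      exact hj' ((c s).2 h2)
    · have h' : L.chart y ∉ (G s).1.1.cfg.carrier := by
        intro h'
        have h1 : L.chart y ∈ L.ball ∩ (G s).1.1.cfg.carrier := ⟨L.chart_mem_ball y, h'⟩
        rw [hL] at h1
        have h2 : L.chart y = p.1 := h1
        exact L.chart_notMem_inner y (by rw [h2]; exact hp)
      rw [hs y h', hsec s _ h h']
  obtain ⟨L₀, h₀, -⟩ := F.exists_fits (0 : I) Filter.univ_mem
  have hcomp := h₀.comp_eq F hfit
  have hmem : L₀.comp (F.pt (0 : I)) h₀.mem ∈ i.cHat := by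
    have h2 : (G 0).1.1.cfg = Cfg.ofInj k (c 0) := hc 0
    refine h0 _ L₀ h₀.mem ?_ fun y hy => ?_
    · ext y
      rw [h2]
      constructor
      · rintro ⟨hy, j', rfl⟩
        by_cases hj' : j' = j
        · rw [hj', ← hpt 0]
          rfl
        · refine absurd ?_ (h₀.subset _ hy j' hj')
          rw [hproj]
      · rintro rfl
        exact ⟨L₀.inner_subset_ball h₀.mem, j, (hpt 0).symm⟩
    · rw [h₀.eq y (h₀.sec_dom y), hsec 0 _ _ hy]
  rw [hcomp] at hmem
  have : ∀ q (hq : q.1 ∈ L.inner), q = p → L.comp q hq ∈ i.cHat → L.comp p hp ∈ i.cHat := by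
    rintro q hq rfl h
    exact h
  exact this _ _ hpp hmem

variable (i)

/-- The inclusion of the charged configuration-sections. -/
def toFree : C(i.CGdot, i.Free) :=
  ⟨fun x => ⟨x.1, x.2.1, x.2.2.2⟩, Continuous.subtype_mk continuous_subtype_val _⟩

variable {i} in
/-- A charged configuration-section. -/
def Free.toCGdot (x : i.Free) (h : i.Charged x.1.1) : i.CGdot := ⟨x.1, x.2.1, h, x.2.2⟩

/-- The adjoint of the homotopy is a map to the path space, and the continuous choice of path lifts
applies to it in `Free`. Each lifted path starts at a charged element, so all of it is charged. -/
theorem isHurewiczFibration_forget [SecondCountableTopology M] :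
    IsHurewiczFibration i.forget := by
  intro A _ H f hf
  obtain ⟨Λ, hΛ, hΛp, hΛ0, -⟩ := i.hasLocalSlicing_freeForget.exists_lifting
  let γ : C(A, C(I, i.Cdot)) := H.curry
  have hstart : ∀ a, i.freeForget (i.toFree (f a)) = γ a 0 := fun a => hf a
  have hG : Continuous fun x : A × I => Λ ((γ x.1, i.toFree (f x.1)), x.2) :=
    hΛ.comp_continuous (f := fun x : A × I => ((γ x.1, i.toFree (f x.1)), x.2)) (by fun_prop)
      fun x => hstart x.1
  have hch : ∀ x : A × I, i.Charged (Λ ((γ x.1, i.toFree (f x.1)), x.2)).1.1 := by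
    rintro ⟨a, s⟩
    refine charged_of_path ⟨fun s => Λ ((γ a, i.toFree (f a)), s),
      hG.comp (f := fun s : I => (a, s)) (by fun_prop)⟩ ?_ s
    simp only [ContinuousMap.coe_mk]
    rw [hΛ0 _ _ (hstart a)]
    exact (f a).2.2.1
  refine ⟨⟨fun x => Free.toCGdot _ (hch x), Continuous.subtype_mk
    (continuous_subtype_val.comp hG) _⟩, fun a => ?_, fun x => ?_⟩
  · refine Subtype.ext ?_
    change (Λ ((γ a, i.toFree (f a)), 0)).1 = (f a).1
    rw [hΛ0 _ _ (hstart a)]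
    rfl
  · exact hΛp _ _ (hstart x.1) x.2

end Inputs

end Fibration


/-! ### Extending maps from the punctured ball -/

section Extension

namespace Inputs

variable {m : ℕ}

theorem pull_last (q : EuclideanSpace ℝ (Fin (m + 2))) : pull q (Fin.last _) =
    max (-√(1 - ‖flat q‖ ^ 2)) (min (q (Fin.last _)) √(1 - ‖flat q‖ ^ 2)) := by
  simp [pull]

theorem pull_of_ne (q : EuclideanSpace ℝ (Fin (m + 2))) {j : Fin (m + 2)} (hj : j ≠ Fin.last _) :
    pull q j = q j := by
  simp [pull, hj]

theorem flat_of_ne (q : EuclideanSpace ℝ (Fin (m + 2))) {j : Fin (m + 2)} (hj : j ≠ Fin.last _) :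
    flat q j = q j := by
  simp [flat, hj]

theorem flat_last (q : EuclideanSpace ℝ (Fin (m + 2))) : flat q (Fin.last _) = 0 := by
  simp [flat]

theorem norm_sq_eq_flat {q q' : EuclideanSpace ℝ (Fin (m + 2))}
    (h : ∀ j, j ≠ Fin.last _ → q' j = q j) :
    ‖q'‖ ^ 2 = ‖flat q‖ ^ 2 + q' (Fin.last _) ^ 2 := by
  rw [EuclideanSpace.real_norm_sq_eq, EuclideanSpace.real_norm_sq_eq, Fin.sum_univ_castSucc,
    Fin.sum_univ_castSucc (f := fun j => flat q j ^ 2), flat_last]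
  simp only [ne_eq, OfNat.ofNat_ne_zero, not_false_eq_true, zero_pow, add_zero]
  congr 1
  refine Finset.sum_congr rfl fun j _ => ?_
  rw [h _ (Fin.castSucc_lt_last j).ne, flat_of_ne _ (Fin.castSucc_lt_last j).ne]

theorem continuous_flat : Continuous (flat (m := m)) := by
  unfold flat
  refine (PiLp.continuous_toLp 2 _).comp (continuous_pi fun j => ?_)
  by_cases hj : j = Fin.last _
  · subst hj
    simpa using continuous_const
  · simpa [hj] using by fun_prop

theorem continuous_pull : Continuous (pull (m := m)) := by
  have := continuous_flat (m := m)
  unfold pull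
  refine (PiLp.continuous_toLp 2 _).comp (continuous_pi fun j => ?_)
  by_cases hj : j = Fin.last _
  · subst hj
    simp only [Function.update_self]
    fun_prop
  · simpa [hj] using by fun_prop

/-- Coordinate `0` is the height; as the dimension is at least two, it is not the last, vertical
coordinate, and `flat` keeps it. -/
theorem abs_le_norm_flat (q : EuclideanSpace ℝ (Fin (m + 2))) : |q 0| ≤ ‖flat q‖ := by
  have h := PiLp.norm_apply_le (flat q) 0
  rwa [flat_of_ne _ (by simp [Fin.ext_iff]), Real.norm_eq_abs] at h

theorem pull_eq_flat {q : EuclideanSpace ℝ (Fin (m + 2))} (h : 1 ≤ ‖flat q‖) : pull q = flat q := by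
  ext j
  by_cases hj : j = Fin.last _
  · subst hj
    have h1 : √(1 - ‖flat q‖ ^ 2) = 0 := Real.sqrt_eq_zero_of_nonpos (by nlinarith)
    rw [pull_last, flat_last, h1, neg_zero]
    exact max_eq_left (min_le_right _ _)
  · rw [pull_of_ne _ hj, flat_of_ne _ hj]

theorem pull_eq_self {q : EuclideanSpace ℝ (Fin (m + 2))} (h : ‖q‖ ≤ 1) : pull q = q := by
  ext j
  by_cases hj : j = Fin.last _
  · subst hj
    have h1 := norm_sq_eq_flat (q := q) (q' := q) fun _ _ => rfl
    have h2 : q (Fin.last _) ^ 2 ≤ 1 - ‖flat q‖ ^ 2 := by nlinarith [norm_nonneg q]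
    have h3 := abs_le.1 (Real.abs_le_sqrt h2)
    rw [pull_last, min_eq_left h3.2, max_eq_right h3.1]
  · rw [pull_of_ne _ hj]

theorem norm_pull_le {q : EuclideanSpace ℝ (Fin (m + 2))} (h : ‖flat q‖ ≤ 1) : ‖pull q‖ ≤ 1 := by
  have h1 := norm_sq_eq_flat (q := q) (q' := pull q) fun _ hj => pull_of_ne q hj
  have h0 : 0 ≤ 1 - ‖flat q‖ ^ 2 := by nlinarith [norm_nonneg (flat q)]
  have h2 : pull q (Fin.last _) ^ 2 ≤ 1 - ‖flat q‖ ^ 2 := by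
    rw [← Real.sq_sqrt h0]
    refine sq_le_sq' ?_ ?_ <;> rw [pull_last]
    · exact le_max_left _ _
    · exact max_le (by linarith [Real.sqrt_nonneg (1 - ‖flat q‖ ^ 2)]) (min_le_right _ _)
  have h3 : ‖pull q‖ ^ 2 ≤ 1 := by linarith
  nlinarith [norm_nonneg (pull q)]

/-- A point that is pulled to the origin lies on the vertical axis, where `pull` truncates to `[-1,
1]`. -/
theorem pull_ne_zero {q : EuclideanSpace ℝ (Fin (m + 2))} (hq : q ≠ 0) : pull q ≠ 0 := by
  intro h
  have hj : ∀ j, j ≠ Fin.last _ → q j = 0 := fun j hj => by rw [← pull_of_ne q hj, h]; rfl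
  have hf : flat q = 0 := by
    ext j
    by_cases hjl : j = Fin.last _
    · rw [hjl, flat_last]; rfl
    · rw [flat_of_ne _ hjl, hj j hjl]; rfl
  have h1 := pull_last q
  rw [h, hf] at h1
  simp only [norm_zero, ne_eq, OfNat.ofNat_ne_zero, not_false_eq_true, zero_pow, sub_zero,
    Real.sqrt_one, PiLp.zero_apply] at h1
  refine hq ?_
  ext j
  by_cases hjl : j = Fin.last _
  · subst hjl
    rcases le_total (q (Fin.last _)) 1 with h2 | h2
    · rw [min_eq_left h2] at h1
      rcases le_total (-1) (q (Fin.last _)) with h3 | h3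
      · rw [max_eq_right h3] at h1
        exact h1.symm
      · rw [max_eq_left h3] at h1
        norm_num at h1
    · rw [min_eq_right h2] at h1
      norm_num at h1
  · exact hj j hjl

/-- The punctured closed unit ball. -/
abbrev PBall (m : ℕ) := {q : EuclideanSpace ℝ (Fin (m + 2)) // q ≠ 0 ∧ ‖q‖ ≤ 1}

variable {M : Type u} [TopologicalSpace M] [ChartedSpace (EuclideanHalfSpace (m + 2)) M]
  {E : Type v} [TopologicalSpace E] {X : Type w} [TopologicalSpace X] (i : Inputs m M E X)

open Classical in
/-- The extension of a map on the punctured ball. -/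
noncomputable def extOf (f : PBall m → X) (q : EuclideanSpace ℝ (Fin (m + 2))) : X :=
  if h : pull q ≠ 0 ∧ ‖pull q‖ ≤ 1 then f ⟨pull q, h⟩ else i.x₀

variable {i}

theorem extOf_of_flat_le {f : PBall m → X} {q : EuclideanSpace ℝ (Fin (m + 2))} (hq : q ≠ 0)
    (h : ‖flat q‖ ≤ 1) : i.extOf f q = f ⟨pull q, pull_ne_zero hq, norm_pull_le h⟩ :=
  dif_pos _

theorem extOf_of_norm_le {f : PBall m → X} {q : EuclideanSpace ℝ (Fin (m + 2))} (hq : q ≠ 0)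
    (h : ‖q‖ ≤ 1) : i.extOf f q = f ⟨q, hq, h⟩ := by
  have h1 := pull_eq_self h
  have h2 : pull q ≠ 0 ∧ ‖pull q‖ ≤ 1 := by rw [h1]; exact ⟨hq, h⟩
  rw [extOf, dif_pos h2]
  congr 1
  exact Subtype.ext h1

/-- Here `pull q` equals `flat q`, which is in the unit ball only if it lies on the equator, and the
equator belongs to the closed southern hemisphere. -/
theorem extOf_eq_base {f : PBall m → X}
    (hf : ∀ q, ‖q.1‖ = 1 → q.1 (Fin.last _) ≤ 0 → f q = i.x₀) {q : EuclideanSpace ℝ (Fin (m + 2))}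
    (h : 1 ≤ ‖flat q‖) : i.extOf f q = i.x₀ := by
  rw [extOf]
  split_ifs with h'
  · refine hf _ ?_ ?_
    · refine le_antisymm h'.2 ?_
      change 1 ≤ ‖pull q‖
      rwa [pull_eq_flat h]
    · change pull q _ ≤ 0
      rw [pull_eq_flat h, flat_last]
  · rfl

/-- A function is continuous on a set covered by two closed sets if it is continuous on the
intersections with these sets. -/
theorem continuousOn_of_isClosed_cover {A B : Type*} [TopologicalSpace A] [TopologicalSpace B]
    {f : A → B} {S K K' : Set A} (hK : IsClosed K) (hK' : IsClosed K') (hS : S ⊆ K ∪ K')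
    (h : ContinuousOn f (S ∩ K)) (h' : ContinuousOn f (S ∩ K')) : ContinuousOn f S := by
  intro x hx
  have e : S = (S ∩ K) ∪ (S ∩ K') := by
    rw [← Set.inter_union_distrib_left, Set.inter_eq_left.2 hS]
  have key : ∀ K : Set A, IsClosed K → ContinuousOn f (S ∩ K) →
      ContinuousWithinAt f (S ∩ K) x := by
    intro K hK h
    by_cases hxK : x ∈ K
    · exact h x ⟨hx, hxK⟩
    · refine continuousWithinAt_of_notMem_closure fun hc => hxK ?_
      exact hK.closure_subset_iff.2 Set.inter_subset_right hc
  rw [e]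
  exact (key K hK h).union (key K' hK' h')

/-- Inside the closed vertical cylinder over the ball, the extension is `f` after the continuous map
`pull`; outside it is `x₀`. The parameter in `Q` allows homotopies of `f`. -/
theorem continuousOn_extOf {Q : Type*} [TopologicalSpace Q] {f : Q × PBall m → X}
    (hf : Continuous f)
    (hs : ∀ u q, ‖q.1‖ = 1 → q.1 (Fin.last _) ≤ 0 → f (u, q) = i.x₀) :
    ContinuousOn (fun x : Q × EuclideanSpace ℝ (Fin (m + 2)) => i.extOf (fun q => f (x.1, q)) x.2)
      {x | x.2 ≠ 0} := by
  have hc : Continuous fun x : Q × EuclideanSpace ℝ (Fin (m + 2)) => ‖flat x.2‖ :=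
    (continuous_flat.comp continuous_snd).norm
  refine continuousOn_of_isClosed_cover (K := {x | ‖flat x.2‖ ≤ 1}) (K' := {x | 1 ≤ ‖flat x.2‖})
    (isClosed_le hc continuous_const) (isClosed_le continuous_const hc)
    (fun x _ => le_total ‖flat x.2‖ 1) ?_ ?_
  · rw [continuousOn_iff_continuous_domRestrict]
    have h1 : Continuous fun x : ↥({x : Q × EuclideanSpace ℝ (Fin (m + 2)) | x.2 ≠ 0} ∩
        {x | ‖flat x.2‖ ≤ 1}) =>
        f (x.1.1, ⟨pull x.1.2, pull_ne_zero x.2.1, norm_pull_le x.2.2⟩) := by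
      have := continuous_pull (m := m)
      fun_prop
    convert h1 using 1
    funext x
    exact extOf_of_flat_le (i := i) (f := fun q => f (x.1.1, q)) x.2.1 x.2.2
  · refine (continuousOn_const (c := i.x₀)).congr fun x hx => ?_
    exact extOf_eq_base (hs x.1) hx.2

end Inputs

end Extension


/-! ### Gluing in sections over the cylinder -/

section Gluing

namespace Inputs

variable {m : ℕ} {M : Type u} [TopologicalSpace M] [ChartedSpace (EuclideanHalfSpace (m + 2)) M]
  {E : Type v} [TopologicalSpace E] {X : Type w} [TopologicalSpace X] (i : Inputs m M E X)

/-- A family of configurations in rectangles with a family of maps from the complements in the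
cylinder to the fibre, which are constant at the ends. -/
structure GlueData (Q : Type*) [TopologicalSpace Q] where
  /-- the configurations -/
  slab : Q → Slab
  continuous_slab : Continuous slab
  /-- the maps to the fibre -/
  field : Q × (Fin (m + 1) → ℝ) × ℝ≥0 → X
  continuousOn_field : ContinuousOn field {x | x.2.1 ∈ cube m ∧
    ∀ z ∈ (slab x.1).cfg.carrier, ¬(x.2.1 = Pi.single 0 z.1.1 ∧ x.2.2 = z.2)}
  field_zero : ∀ q y, field (q, y, 0) = i.x₀
  field_top : ∀ q y τ, (slab q).len ≤ τ → field (q, y, τ) = i.x₀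

variable {i}

theorem mem_D_of_height {p : i.Hat} {t : ℝ≥0} (h : ¬i.height p ≤ t) : i.retr p ∈ i.D :=
  p.2.resolve_left fun h' => h (by
    change p.1.2 ≤ t
    rw [h']
    exact zero_le)

theorem strip_eq_iff {z : Strip} {t : ℝ≥0} {p : i.Hat} (hp : i.retr p ∈ i.D) (ht : t ≤ i.height p) :
    i.strip z t = p ↔ i.coord (i.retr p) = Pi.single 0 z.1.1 ∧ i.height p - t = z.2 := by
  constructor
  · rintro rfl
    rw [retr_strip, coord_disc]
    refine ⟨rfl, ?_⟩
    change z.2 + t - t = z.2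
    simp
  · rintro ⟨h1, h2⟩
    refine Hat.ext ?_ ?_
    · rw [retr_strip, ← h1, i.disc_coord hp]
    · change z.2 + t = _
      rw [← h2, tsub_add_cancel_of_le ht]

namespace GlueData

variable {Q : Type*} [TopologicalSpace Q] (F : i.GlueData Q)

theorem notMem_left {x : i.Free} {q : Q} {p : i.Hat}
    (hp : p ∉ (F.slab q • i.freeForget x).cfg.carrier) : p ∉ x.1.1.cfg.carrier :=
  fun h => hp (Or.inl h)

open Classical in
/-- The section that agrees with the given one on `M̂_t`, and with the given map to the fibre
on the rest of the cylinder. -/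
noncomputable def glueSec (x : i.Free) (q : Q) (p : i.Hat)
    (hp : p ∉ (F.slab q • i.freeForget x).cfg.carrier) : i.HatE :=
  if h : i.height p ≤ x.1.2 then x.1.1.sec ⟨p, F.notMem_left hp⟩
  else i.triv p (mem_D_of_height h) (F.field (q, i.coord (i.retr p), i.height p - x.1.2))

theorem glueSec_of_le {x : i.Free} {q : Q} {p : i.Hat}
    (hp : p ∉ (F.slab q • i.freeForget x).cfg.carrier) (h : i.height p ≤ x.1.2) :
    F.glueSec x q p hp = x.1.1.sec ⟨p, F.notMem_left hp⟩ := dif_pos h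

/-- At the height where the two pieces meet, both give `x₀`: the old section by its condition over
the end of the cylinder, and the new field by `field_zero`. -/
theorem glueSec_of_ge {x : i.Free} {q : Q} {p : i.Hat}
    (hp : p ∉ (F.slab q • i.freeForget x).cfg.carrier) (hD : i.retr p ∈ i.D)
    (h : x.1.2 ≤ i.height p) : F.glueSec x q p hp =
      i.triv p hD (F.field (q, i.coord (i.retr p), i.height p - x.1.2)) := by
  by_cases h' : i.height p ≤ x.1.2
  · rw [F.glueSec_of_le hp h', x.2.2 p hD _ h, tsub_eq_zero_of_le h', F.field_zero]
  · exact dif_neg h'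

variable [T2Space M]

theorem continuous_glueSec : Continuous
    fun x : {x : (i.Free × Q) × i.Hat // x.2 ∉ (F.slab x.1.2 • i.freeForget x.1.1).cfg.carrier} =>
      F.glueSec x.1.1.1 x.1.1.2 x.1.2 x.2 := by
  have hpr : Continuous fun x : {x : (i.Free × Q) × i.Hat //
    x.2 ∉ (F.slab x.1.2 • i.freeForget x.1.1).cfg.carrier} => x.1 := continuous_subtype_val
  have hh : Continuous fun x : {x : (i.Free × Q) × i.Hat //
      x.2 ∉ (F.slab x.1.2 • i.freeForget x.1.1).cfg.carrier} => i.height x.1.2 := by fun_prop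
  have hl : Continuous fun x : {x : (i.Free × Q) × i.Hat //
      x.2 ∉ (F.slab x.1.2 • i.freeForget x.1.1).cfg.carrier} => x.1.1.1.1.2 :=
    Free.continuous_len.comp (by fun_prop)
  have hr : Continuous fun x : {x : (i.Free × Q) × i.Hat //
      x.2 ∉ (F.slab x.1.2 • i.freeForget x.1.1).cfg.carrier} => i.retr x.1.2 := by fun_prop
  rw [← continuousOn_univ]
  refine continuousOn_of_isClosed_cover (K := {x | i.height x.1.2 ≤ x.1.1.1.1.2})
    (K' := {x | i.retr x.1.2 ∈ i.D ∧ x.1.1.1.1.2 ≤ i.height x.1.2}) (isClosed_le (α := ℝ≥0) hh hl)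
    ((i.isClosed_D.preimage hr).inter (isClosed_le (α := ℝ≥0) hl hh)) (fun x _ => ?_) ?_ ?_
  · by_cases h : i.height x.1.2 ≤ x.1.1.1.1.2
    · exact Or.inl h
    · exact Or.inr ⟨mem_D_of_height h, (not_le.1 h).le⟩
  · have h1 : Continuous fun x : {x : (i.Free × Q) × i.Hat //
        x.2 ∉ (F.slab x.1.2 • i.freeForget x.1.1).cfg.carrier} =>
        x.1.1.1.1.1.sec ⟨x.1.2, F.notMem_left x.2⟩ :=
      Free.continuous_sec.comp (f := fun x : {x : (i.Free × Q) × i.Hat //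
        x.2 ∉ (F.slab x.1.2 • i.freeForget x.1.1).cfg.carrier} =>
        (⟨(x.1.1.1, x.1.2), F.notMem_left x.2⟩ :
          {x : i.Free × i.Hat // x.2 ∉ x.1.1.1.cfg.carrier})) (by fun_prop)
    exact h1.continuousOn.congr fun x hx => F.glueSec_of_le x.2 hx.2
  · rw [continuousOn_iff_continuous_domRestrict]
    have hc : Continuous fun x : ↥((Set.univ : Set {x : (i.Free × Q) × i.Hat //
        x.2 ∉ (F.slab x.1.2 • i.freeForget x.1.1).cfg.carrier}) ∩
        {x | i.retr x.1.2 ∈ i.D ∧ x.1.1.1.1.2 ≤ i.height x.1.2}) => i.coord (i.retr x.1.1.2) :=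
      i.continuousOn_coord.comp_continuous (hr.comp continuous_subtype_val) fun x => x.2.2.1
    have hf : Continuous fun x : ↥((Set.univ : Set {x : (i.Free × Q) × i.Hat //
        x.2 ∉ (F.slab x.1.2 • i.freeForget x.1.1).cfg.carrier}) ∩
        {x | i.retr x.1.2 ∈ i.D ∧ x.1.1.1.1.2 ≤ i.height x.1.2}) =>
        F.field (x.1.1.1.2, i.coord (i.retr x.1.1.2), i.height x.1.1.2 - x.1.1.1.1.1.2) := by
      refine F.continuousOn_field.comp_continuous ?_ fun x => ⟨i.coord_mem x.2.2.1, ?_⟩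
      · exact (by fun_prop : Continuous _).prodMk (hc.prodMk
          ((hh.comp continuous_subtype_val).sub (hl.comp continuous_subtype_val)))
      · rintro z hz hzp
        exact x.1.2 (Or.inr ⟨z, hz, (strip_eq_iff x.2.2.1 x.2.2.2).2 hzp⟩)
    have h2 := i.continuous_triv.comp (f := fun x : ↥((Set.univ : Set {x : (i.Free × Q) × i.Hat //
        x.2 ∉ (F.slab x.1.2 • i.freeForget x.1.1).cfg.carrier}) ∩
        {x | i.retr x.1.2 ∈ i.D ∧ x.1.1.1.1.2 ≤ i.height x.1.2}) =>
        (⟨(x.1.1.2, _), x.2.2.1⟩ : {x : i.Hat × X // i.retr x.1 ∈ i.D}))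
        (((by fun_prop : Continuous _).prodMk hf).subtype_mk _)
    convert h2 using 1
    funext x
    exact F.glueSec_of_ge x.1.2 x.2.2.1 x.2.2.2

/-- Extending a configuration-section by the given data. -/
noncomputable def glue : C(i.Free × Q, i.Free) where
  toFun x := ⟨(⟨(F.slab x.2 • i.freeForget x.1).cfg, ⟨fun p => F.glueSec x.1 x.2 p.1 p.2,
      F.continuous_glueSec.comp (f := fun p :
          {p // p ∉ (F.slab x.2 • i.freeForget x.1).cfg.carrier} =>
        (⟨(x, p.1), p.2⟩ : {x : (i.Free × Q) × i.Hat //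
          x.2 ∉ (F.slab x.1.2 • i.freeForget x.1.1).cfg.carrier})) (by fun_prop)⟩, fun p => by
        change i.hatProj (F.glueSec x.1 x.2 p.1 p.2) = p.1
        by_cases h : i.height p.1 ≤ x.1.1.2
        · rw [F.glueSec_of_le p.2 h]
          exact x.1.1.1.isSec _
        · rw [F.glueSec_of_ge p.2 (mem_D_of_height h) (not_le.1 h).le]
          rfl⟩, (F.slab x.2 • i.freeForget x.1).len),
    (F.slab x.2 • i.freeForget x.1).mem, fun p hD hp hl => by
      have h1 : x.1.1.2 + (F.slab x.2).len ≤ i.height p := hl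
      refine (F.glueSec_of_ge hp hD (le_self_add.trans h1)).trans ?_
      rw [F.field_top _ _ _ (le_tsub_of_add_le_left h1)]⟩
  continuous_toFun := by
    have h := F.continuous_slab
    have h' : Continuous fun x : i.Free × Q => F.slab x.2 • i.freeForget x.1 := by fun_prop
    exact Continuous.subtype_mk (Continuous.prodMk (ConfSection.continuous_mk
      (Cdot.continuous_cfg.comp h') F.continuous_glueSec) (Cdot.continuous_len.comp h')) _

theorem glue_sec_of_le {x : i.Free} {q : Q} {p : i.Hat} (hp hp') (h : i.height p ≤ x.1.2) :
    (F.glue (x, q)).1.1.sec ⟨p, hp⟩ = x.1.1.sec ⟨p, hp'⟩ := F.glueSec_of_le hp h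

theorem glue_sec_of_ge {x : i.Free} {q : Q} {p : i.Hat} (hp) (hD : i.retr p ∈ i.D)
    (h : x.1.2 ≤ i.height p) : (F.glue (x, q)).1.1.sec ⟨p, hp⟩ =
      i.triv p hD (F.field (q, i.coord (i.retr p), i.height p - x.1.2)) :=
  F.glueSec_of_ge hp hD h

/-- The result of gluing is characterised by its configuration and its values. -/
theorem eq_glue {x y : i.Free} {q : Q} (h : i.freeForget y = F.slab q • i.freeForget x)
    (hle : ∀ p hp hp', i.height p ≤ x.1.2 → y.1.1.sec ⟨p, hp⟩ = x.1.1.sec ⟨p, hp'⟩)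
    (hge : ∀ p hp (hD : i.retr p ∈ i.D), x.1.2 ≤ i.height p → y.1.1.sec ⟨p, hp⟩ =
      i.triv p hD (F.field (q, i.coord (i.retr p), i.height p - x.1.2))) :
    y = F.glue (x, q) := by
  have h1 : y.1.1.cfg = (F.slab q • i.freeForget x).cfg := congrArg Cdot.cfg h
  have h2 : y.1.2 = (F.slab q • i.freeForget x).len := congrArg Cdot.len h
  refine Subtype.ext (Prod.ext (ConfSection.ext' h1 fun p hp hp' => ?_) h2)
  by_cases h : i.height p ≤ x.1.2
  · rw [hle p hp (F.notMem_left hp') h, F.glue_sec_of_le hp' _ h]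
  · rw [hge p hp (mem_D_of_height h) (not_le.1 h).le,
      F.glue_sec_of_ge hp' (mem_D_of_height h) (not_le.1 h).le]

end GlueData

end Inputs

end Gluing


/-! ### The stabilisation map -/

section Stabilisation

namespace Inputs

variable {m : ℕ}

/-- The coordinates with respect to the ball of radius `ρ` around the point of height `h` over the
point with first coordinate `a`. -/
noncomputable def rescale (h a ρ : ℝ) (y : Fin (m + 1) → ℝ) (τ : ℝ) :
    EuclideanSpace ℝ (Fin (m + 2)) :=
  WithLp.toLp 2 (Fin.cons ((τ - h) / ρ) fun j => (y j - (Pi.single 0 a : Fin (m + 1) → ℝ) j) / ρ)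

@[simp]
theorem rescale_apply_zero (h a ρ : ℝ) (y : Fin (m + 1) → ℝ) (τ : ℝ) :
    rescale h a ρ y τ 0 = (τ - h) / ρ := rfl

@[simp]
theorem rescale_apply_succ (h a ρ : ℝ) (y : Fin (m + 1) → ℝ) (τ : ℝ) (j : Fin (m + 1)) :
    rescale h a ρ y τ j.succ = (y j - (Pi.single 0 a : Fin (m + 1) → ℝ) j) / ρ := rfl

theorem rescale_ne_zero {h a ρ : ℝ} (hρ : ρ ≠ 0) {y : Fin (m + 1) → ℝ} {τ : ℝ}
    (hn : ¬(y = Pi.single 0 a ∧ τ = h)) : rescale h a ρ y τ ≠ 0 := by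
  intro h0
  refine hn ⟨funext fun j => ?_, ?_⟩
  · have h1 := congrArg (fun q => q j.succ) h0
    simp only [rescale_apply_succ, PiLp.zero_apply, div_eq_zero_iff, hρ, or_false] at h1
    linarith
  · have h1 := congrArg (fun q => q 0) h0
    simp only [rescale_apply_zero, PiLp.zero_apply, div_eq_zero_iff, hρ, or_false] at h1
    linarith

theorem continuous_rescale {A : Type*} [TopologicalSpace A] {h a ρ τ : A → ℝ}
    {y : A → Fin (m + 1) → ℝ} (hh : Continuous h) (ha : Continuous a) (hρ : Continuous ρ)
    (hy : Continuous y) (hτ : Continuous τ) (h0 : ∀ x, ρ x ≠ 0) :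
    Continuous fun x => rescale (h x) (a x) (ρ x) (y x) (τ x) := by
  refine (PiLp.continuous_toLp 2 _).comp (continuous_pi fun j => ?_)
  refine Fin.cases ?_ (fun j => ?_) j
  · exact (hτ.sub hh).div hρ h0
  · refine Continuous.div (((continuous_apply j).comp hy).sub ?_) hρ h0
    exact (continuous_apply j).comp ((continuous_single (A := fun _ : Fin (m + 1) => ℝ) 0).comp ha)

theorem rescale_zero_single (h ρ : ℝ) (y : Fin (m + 1) → ℝ) (τ : ℝ) :
    rescale h 0 ρ y τ = WithLp.toLp 2 (Fin.cons ((τ - h) / ρ) fun j => y j / ρ) := by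
  simp [rescale]

theorem base_one_carrier : (Slab.base 1).cfg.carrier = {(⟨0, by simp⟩, 1 / 2)} := by
  have : Set.Iio 1 = {0} := by
    ext n
    simp
  simp [Slab.base, this]

variable {M : Type u} [TopologicalSpace M] [ChartedSpace (EuclideanHalfSpace (m + 2)) M]
  {E : Type v} [TopologicalSpace E] {X : Type w} [TopologicalSpace X] {i : Inputs m M E X}

/-- A difference in height of at least the radius puts the point outside the open vertical cylinder
over the ball. This gives the conditions at both ends of a slice of the cylinder. -/
theorem extOf_rescale_eq_base {f : PBall m → X}
    (hf : ∀ q, ‖q.1‖ = 1 → q.1 (Fin.last _) ≤ 0 → f q = i.x₀) {h a ρ : ℝ} (hρ : 0 < ρ)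
    {y : Fin (m + 1) → ℝ} {τ : ℝ} (hτ : ρ ≤ |τ - h|) : i.extOf f (rescale h a ρ y τ) = i.x₀ := by
  refine extOf_eq_base hf (le_trans ?_ (abs_le_norm_flat _))
  rw [rescale_apply_zero, abs_div, abs_of_pos hρ]
  exact (one_le_div hρ).2 hτ

theorem continuousOn_stabField {Q : Type*} [TopologicalSpace Q] {r : ℝ} (hr : 0 < r)
    {f : Q × PBall m → X} (hf : Continuous f)
    (hs : ∀ u q, ‖q.1‖ = 1 → q.1 (Fin.last _) ≤ 0 → f (u, q) = i.x₀) :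
    ContinuousOn (fun x : Q × (Fin (m + 1) → ℝ) × ℝ≥0 => i.extOf (fun q => f (x.1, q))
      (rescale (1 / 2) 0 r x.2.1 x.2.2)) {x | ¬(x.2.1 = 0 ∧ x.2.2 = 1 / 2)} := by
  have hw : Continuous fun x : Q × (Fin (m + 1) → ℝ) × ℝ≥0 =>
      rescale (1 / 2) 0 r x.2.1 (x.2.2 : ℝ) :=
    continuous_rescale (A := Q × (Fin (m + 1) → ℝ) × ℝ≥0) (h := fun _ => 1 / 2) (a := fun _ => 0)
      (ρ := fun _ => r) (y := fun x => x.2.1) (τ := fun x => (x.2.2 : ℝ)) continuous_const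
      continuous_const continuous_const (by fun_prop) (by fun_prop) fun _ => hr.ne'
  have h := continuousOn_extOf (i := i) hf hs
  refine h.comp (f := fun x : Q × (Fin (m + 1) → ℝ) × ℝ≥0 =>
    (x.1, rescale (1 / 2) 0 r x.2.1 (x.2.2 : ℝ))) (continuous_fst.prodMk hw).continuousOn ?_
  intro x hx
  refine (rescale_ne_zero hr.ne' fun h => hx ⟨?_, ?_⟩ : rescale (1 / 2) 0 r x.2.1 (x.2.2 : ℝ) ≠ 0)
  · rw [h.1, Pi.single_zero]
  · rw [← NNReal.coe_inj, h.2]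
    simp

/-- The data for stabilising, for a family of maps on the punctured ball. -/
noncomputable def stabData {Q : Type*} [TopologicalSpace Q] {r : ℝ} (hr : 0 < r) (hr' : r ≤ 1 / 2)
    {f : Q × PBall m → X} (hf : Continuous f)
    (hs : ∀ u q, ‖q.1‖ = 1 → q.1 (Fin.last _) ≤ 0 → f (u, q) = i.x₀) : i.GlueData Q where
  slab _ := Slab.base 1
  continuous_slab := continuous_const
  field x := i.extOf (fun q => f (x.1, q)) (rescale (1 / 2) 0 r x.2.1 x.2.2)
  continuousOn_field := (continuousOn_stabField hr hf hs).mono fun x hx h =>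
    hx.2 (⟨0, by simp⟩, 1 / 2) (by rw [base_one_carrier]; rfl) ⟨by rw [h.1, Pi.single_zero], h.2⟩
  field_zero q y := by
    change i.extOf _ (rescale (1 / 2) 0 r y ((0 : ℝ≥0) : ℝ)) = _
    refine extOf_rescale_eq_base (f := fun p => f (q, p)) (hs q) hr ?_
    rw [NNReal.coe_zero, zero_sub, abs_neg, abs_of_pos (by norm_num : (0 : ℝ) < 1 / 2)]
    exact hr'
  field_top q y τ hτ := by
    refine extOf_rescale_eq_base (f := fun p => f (q, p)) (hs q) hr ?_
    have h1 : (1 : ℝ) ≤ τ := by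
      have : ((1 : ℕ) : ℝ≥0) ≤ τ := hτ
      rw [Nat.cast_one] at this
      exact_mod_cast this
    exact (le_trans hr' (by linarith)).trans (le_abs_self _)

/-- The sections near a point of a configuration. -/
def constFamily [T2Space M] (x : ConfSection i.hatProj) (p : i.hatInterior) :
    i.PuncturedFamily where
  pt _ := p
  continuous_pt := continuous_const
  dom := {y | y.2 ∉ x.cfg.carrier \ {p.1}}
  isOpen_dom := ((x.cfg.finite.subset Set.sdiff_subset).isClosed.preimage
    continuous_snd).isOpen_compl
  mem_dom s h := h.2 rfl
  sec y := x.sec ⟨y.1.2, fun h => y.2.1 ⟨h, y.2.2⟩⟩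
  continuous_sec := x.sec.continuous.comp (by fun_prop)
  isSec y := x.isSec _

variable [T2Space M]

theorem constFamily_fits_iff {x : ConfSection i.hatProj} {p : i.hatInterior}
    (hp : p.1 ∈ x.cfg.carrier) {s : ℝ} {L : LocalSection (m + 2) i.hatProj i.hatInterior} :
    (constFamily x p).Fits s L ↔ p.1 ∈ L.inner ∧ L.ball ∩ x.cfg.carrier = {p.1} ∧
      ∀ y hy, L.sec y = x.sec ⟨L.chart y.1, hy⟩ := by
  constructor
  · refine fun h => ⟨h.mem, ?_, fun y hy => h.eq y (h.sec_dom y)⟩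
    ext q
    constructor
    · rintro ⟨hq, hq'⟩
      by_contra hqp
      exact h.subset q hq ⟨hq', hqp⟩
    · rintro rfl
      exact ⟨L.inner_subset_ball h.mem, hp⟩
  · rintro ⟨h1, h2, h3⟩
    refine ⟨h1, fun q hq hq' => hq'.2 ?_, fun y h => h3 y _⟩
    rw [← h2]
    exact ⟨hq, hq'.1⟩

variable [IsManifold (modelWithCornersEuclideanHalfSpace (m + 2)) ∞ M]

/-- All admissible local sections near a point of the configuration represent the same class, so
testing one of them is enough. -/
theorem charged_of_exists {x : ConfSection i.hatProj}
    (h : ∀ p : i.hatInterior, p.1 ∈ x.cfg.carrier → ∃ s L, ∃ hL : (constFamily x p).Fits s L,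
      L.comp p hL.mem ∈ i.cHat) : i.Charged x := by
  intro p L hpL hL hs
  have hp : p.1 ∈ x.cfg.carrier := by
    have : p.1 ∈ L.ball ∩ x.cfg.carrier := by rw [hL]; rfl
    exact this.2
  obtain ⟨s, L', hL', hc⟩ := h p hp
  have h1 : (constFamily x p).Fits s L := (constFamily_fits_iff hp).2 ⟨hpL, hL, hs⟩
  exact (h1.comp_eq _ hL' : L.comp p hpL = L'.comp p hL'.mem) ▸ hc

/-- The parameter of an interpolation between `0` and `1`. -/
noncomputable def unitTime (s : ℝ) : ℝ≥0 := min s.toNNReal 1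

omit [T2Space M] [IsManifold (modelWithCornersEuclideanHalfSpace (m + 2)) ∞ M] in
theorem radius_pos {r : ℝ} (hr : 0 < r) (s : ℝ) :
    0 < (1 - (unitTime s : ℝ)) / 4 + unitTime s * r := by
  have h1 : (unitTime s : ℝ) ≤ 1 := by exact_mod_cast min_le_right _ _
  have h0 : (0 : ℝ) ≤ unitTime s := NNReal.coe_nonneg _
  rcases h0.eq_or_lt with h | h
  · rw [← h]; norm_num
  · have := mul_pos h hr
    linarith

omit [T2Space M] [IsManifold (modelWithCornersEuclideanHalfSpace (m + 2)) ∞ M] in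
theorem continuous_unitTime : Continuous unitTime := by
  unfold unitTime
  fun_prop

/-- The sections near the new point, while it is moved from the standard ball. -/
noncomputable def stdFamily {r : ℝ} (hr : 0 < r) {f : PBall m → X} (hf : Continuous f)
    (hs : ∀ q, ‖q.1‖ = 1 → q.1 (Fin.last _) ≤ 0 → f q = i.x₀) (t : ℝ≥0) : i.PuncturedFamily where
  pt s := ⟨i.cyl 0 (1 / 2 + unitTime s * t), Or.inr ⟨0, fun _ => by simp,
    i.retr_cyl (fun _ => by simp) _⟩⟩
  continuous_pt := by
    have := continuous_unitTime
    exact Continuous.subtype_mk (i.continuous_cyl.comp (f := fun s : ℝ =>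
      ((0 : Fin (m + 1) → ℝ), 1 / 2 + unitTime s * t)) (by fun_prop)) _
  dom := {x | 0 < i.height x.2}
  isOpen_dom := isOpen_lt (α := ℝ≥0) continuous_const (by fun_prop)
  mem_dom s := by
    change 0 < 1 / 2 + unitTime s * t
    positivity
  sec x := i.triv x.1.2 (mem_D_of_height (not_le.2 x.2.1)) (i.extOf f
    (rescale (1 / 2 + unitTime x.1.1 * t) 0 ((1 - unitTime x.1.1) / 4 + unitTime x.1.1 * r)
      (i.coord (i.retr x.1.2)) (i.height x.1.2)))
  continuous_sec := by
    have hu := continuous_unitTime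
    have hc : Continuous fun x : {x : ℝ × i.Hat // x ∈ {x | 0 < i.height x.2} ∧
        x.2 ≠ i.cyl 0 (1 / 2 + unitTime x.1 * t)} => i.coord (i.retr x.1.2) :=
      i.continuousOn_coord.comp_continuous (by fun_prop) fun x =>
        mem_D_of_height (not_le.2 x.2.1)
    have hw : Continuous fun x : {x : ℝ × i.Hat // x ∈ {x | 0 < i.height x.2} ∧
        x.2 ≠ i.cyl 0 (1 / 2 + unitTime x.1 * t)} => rescale (1 / 2 + unitTime x.1.1 * t) 0
          ((1 - unitTime x.1.1) / 4 + unitTime x.1.1 * r)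
          (i.coord (i.retr x.1.2)) (i.height x.1.2) :=
      continuous_rescale (by fun_prop) (by fun_prop) (by fun_prop) hc (by fun_prop)
        fun x => (radius_pos hr _).ne'
    have he := (continuousOn_extOf (i := i) (f := fun x : Unit × PBall m => f x.2) (by fun_prop)
      fun _ => hs).comp_continuous (f := fun x => ((), _)) (continuous_const.prodMk hw) fun x => by
        refine rescale_ne_zero (radius_pos hr _).ne' ?_
        rintro ⟨h1, h2⟩
        refine x.2.2 (Hat.ext ?_ ?_)
        · rw [i.retr_cyl (fun _ => by simp), ← i.disc_coord (mem_D_of_height (not_le.2 x.2.1)), h1,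
            Pi.single_zero]
        · rw [height_cyl, ← NNReal.coe_inj, h2]
          push_cast
          rfl
    exact i.continuous_triv.comp (f := fun x : {x : ℝ × i.Hat // x ∈ {x | 0 < i.height x.2} ∧
        x.2 ≠ i.cyl 0 (1 / 2 + unitTime x.1 * t)} =>
        (⟨(x.1.2, _), mem_D_of_height (not_le.2 x.2.1)⟩ : {x : i.Hat × X // i.retr x.1 ∈ i.D}))
      (((by fun_prop : Continuous _).prodMk he).subtype_mk _)
  isSec x := rfl

omit [T2Space M] [IsManifold (modelWithCornersEuclideanHalfSpace (m + 2)) ∞ M] in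
-- At parameter `0` the centre has height `1 / 2` and the radius is `1 / 4`, which is the standard
-- ball in the definition of `cD`.
theorem stdFamily_fits {r : ℝ} (hr : 0 < r) {f : PBall m → X} (hf : Continuous f)
    (hs : ∀ q, ‖q.1‖ = 1 → q.1 (Fin.last _) ≤ 0 → f q = i.x₀) (t : ℝ≥0)
    {g : C(Metric.sphere (0 : EuclideanSpace ℝ (Fin (m + 2))) 1, X)} (hg : g ∈ i.cD)
    (hfg : ∀ y h, g y = f ⟨y.1, h⟩) : ∃ L, ∃ h : (stdFamily hr hf hs t).Fits 0 L,
      L.comp _ h.mem ∈ i.cHat := by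
  obtain ⟨L, p, hp, hch, hsec, hc⟩ := hg
  have hu : unitTime 0 = 0 := by simp [unitTime]
  have hle : ∀ x : EuclideanSpace ℝ (Fin (m + 2)), ‖x‖ ≤ 1 → ∀ j, |x j| ≤ 1 := fun x hx j =>
    (PiLp.norm_apply_le x j).trans hx
  have hheight : ∀ x : EuclideanSpace ℝ (Fin (m + 2)), ‖x‖ ≤ 1 →
      (i.height (i.stdChart x) : ℝ) = 1 / 2 + x 0 / 4 := by
    intro x hx
    have := abs_le.1 (hle x hx 0)
    exact Real.coe_toNNReal _ (by linarith)
  have hfit : (stdFamily hr hf hs t).Fits 0 L := by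
    refine ⟨⟨0, by simp, ?_⟩, ?_, fun y h => ?_⟩
    · rw [hch]
      change i.stdChart 0 = i.cyl 0 (1 / 2 + unitTime 0 * t)
      rw [hu, zero_mul, add_zero, stdChart]
      congr 1
      · funext j
        simp
      · rw [← NNReal.coe_inj]
        simp
    · rintro _ ⟨x, hx, rfl⟩
      have hx' : ‖x‖ ≤ 1 := by simpa using hx
      change 0 < i.height (L.chart x)
      rw [hch, ← NNReal.coe_pos, hheight x hx']
      have := abs_le.1 (hle x hx' 0)
      linarith
    · have hy : ‖y.1‖ = 1 := by simp
      have hy0 : y.1 ≠ 0 := fun h => by rw [h] at hy; simp at hy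
      rw [hsec y, hfg y ⟨hy0, hy.le⟩]
      change _ = i.triv (L.chart y) _ _
      have hcoord : i.coord (i.retr (i.stdChart y)) = fun j => y.1 j.succ / 4 :=
        i.coord_cyl (fun j => by
          have := abs_le.1 (hle y.1 hy.le j.succ)
          constructor <;> linarith) _
      have hw : rescale (1 / 2 + (unitTime 0 : ℝ) * t) 0 ((1 - unitTime 0) / 4 + unitTime 0 * r)
          (i.coord (i.retr (i.stdChart y))) (i.height (i.stdChart y)) = y.1 := by
        rw [hu, hcoord, hheight _ hy.le]
        ext j
        refine Fin.cases ?_ (fun j => ?_) j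
        · simp
        · simp
      have e : ∀ (p : i.Hat) h h', p = i.stdChart y → i.triv (i.stdChart y) h (f
          ⟨y.1, ⟨hy0, hy.le⟩⟩) =
          i.triv p h' (i.extOf f (rescale (1 / 2 + (unitTime 0 : ℝ) * t) 0
            ((1 - unitTime 0) / 4 + unitTime 0 * r) (i.coord (i.retr p)) (i.height p))) := by
        rintro _ h h' rfl
        rw [hw, extOf_of_norm_le hy0 hy.le]
      exact e _ _ _ (by rw [hch])
  exact ⟨L, hfit, L.comp_eq_of_mem p _ hp hfit.mem ▸ hc⟩

/-- Near an old point, a small ball avoids the cylinder above the old length and sees the old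
section only. Near the new point, the glued section is the member of `stdFamily` with parameter `1`;
its class is that of the member with parameter `0`, which is known from `cD`. -/
theorem charged_glue_stabData {Q : Type*} [TopologicalSpace Q] {r : ℝ} (hr : 0 < r)
    (hr' : r ≤ 1 / 2) {f : Q × PBall m → X} (hf : Continuous f)
    (hs : ∀ u q, ‖q.1‖ = 1 → q.1 (Fin.last _) ≤ 0 → f (u, q) = i.x₀) (u : Q)
    {g : C(Metric.sphere (0 : EuclideanSpace ℝ (Fin (m + 2))) 1, X)} (hg : g ∈ i.cD)
    (hfg : ∀ y h, g y = f (u, ⟨y.1, h⟩)) (x : i.Free) (hx : i.Charged x.1.1) :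
    i.Charged ((stabData hr hr' hf hs).glue (x, u)).1.1 := by
  set F := stabData hr hr' hf hs with hF
  refine charged_of_exists fun p hp => ?_
  rcases hp with hp | ⟨z, hz, hzp⟩
  · have hpN : {q | i.retr q ∈ i.D ∧ x.1.2 ≤ i.height q}ᶜ ∈ 𝓝 p.1 := by
      refine ((i.isClosed_D.preimage i.continuous_retr).inter
        (isClosed_le (α := ℝ≥0) continuous_const i.continuous_height)).isOpen_compl.mem_nhds ?_
      exact fun h => not_lt.2 h.2 (Cdot.height_lt (i.freeForget x) hp h.1)
    obtain ⟨L, hL, hLN⟩ := (constFamily (F.glue (x, u)).1.1 p).exists_fits 0 hpN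
    have hp' : p.1 ∈ (F.glue (x, u)).1.1.cfg.carrier := Or.inl hp
    obtain ⟨h1, h2, h3⟩ := (constFamily_fits_iff hp').1 hL
    refine ⟨0, L, hL, hx p L h1 ?_ fun y hy => ?_⟩
    · refine Set.Subset.antisymm (fun q hq => h2 ▸ ⟨hq.1, Or.inl hq.2⟩) ?_
      rintro _ rfl
      exact ⟨L.inner_subset_ball h1, hp⟩
    · rw [h3 y fun h => (hL.sec_dom y).1 ⟨h, (hL.sec_dom y).2⟩]
      refine F.glue_sec_of_le _ _ ?_
      have h4 := hLN (L.chart_mem_ball y)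
      by_contra h5
      exact h4 ⟨mem_D_of_height h5, (not_le.1 h5).le⟩
  · have hz' : z = (⟨0, by simp⟩, 1 / 2) := by
      have : z ∈ (Slab.base 1).cfg.carrier := hz
      rw [base_one_carrier] at this
      exact this
    have hu1 : unitTime 1 = 1 := by simp [unitTime]
    let G := stdFamily hr (f := fun q => f (u, q)) (by fun_prop) (hs u) x.1.2
    have hpt : G.pt 1 = p := by
      refine Subtype.ext (Eq.trans ?_ hzp)
      change i.cyl 0 (1 / 2 + unitTime 1 * x.1.2) = i.strip z x.1.2
      rw [hu1, hz', one_mul]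
      simp [strip]
    obtain ⟨L₀, h₀, hc⟩ := stdFamily_fits hr (f := fun q => f (u, q)) (by fun_prop)
        (hs u) x.1.2 hg hfg
    have hN : {q | x.1.2 < i.height q} ∈ 𝓝 (G.pt 1).1 := by
      refine (isOpen_lt (α := ℝ≥0) continuous_const i.continuous_height).mem_nhds ?_
      change x.1.2 < 1 / 2 + unitTime 1 * x.1.2
      rw [hu1, one_mul]
      simp
    obtain ⟨L, hL, hLN⟩ := G.exists_fits 1 hN
    have hfit : (constFamily (F.glue (x, u)).1.1 p).Fits 0 L := by
      have hp' : p.1 ∈ (F.glue (x, u)).1.1.cfg.carrier := Or.inr ⟨z, hz, hzp⟩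
      refine (constFamily_fits_iff hp').2 ⟨hpt ▸ hL.mem, ?_, fun y hy => ?_⟩
      · refine Set.Subset.antisymm ?_ ?_
        · rintro q ⟨hq, hq' | ⟨z', hz', hzq⟩⟩
          · have h1 : x.1.2 < i.height q := hLN hq
            exact absurd h1 (not_lt.2 (Cdot.height_lt (i.freeForget x) hq'
              (mem_D_of_height (not_le.2 h1))).le)
          · have h2 : z' = z := by
              have h3 : z' ∈ (Slab.base 1).cfg.carrier := hz'
              have h4 : z ∈ (Slab.base 1).cfg.carrier := hz
              rw [base_one_carrier] at h3 h4
              exact h3.trans h4.symm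
            rw [h2] at hzq
            exact hzq.symm.trans hzp
        · rintro _ rfl
          exact ⟨L.inner_subset_ball (hpt ▸ hL.mem), Or.inr ⟨z, hz, hzp⟩⟩
      · have h1 : x.1.2 < i.height (L.chart y) := hLN (L.chart_mem_ball y)
        rw [hL.eq y (hL.sec_dom y), F.glue_sec_of_ge hy (mem_D_of_height (not_le.2 h1)) h1.le]
        change i.triv _ _ (i.extOf (fun q => f (u, q)) (rescale (1 / 2 + unitTime 1 * x.1.2) 0
            ((1 - unitTime 1) / 4 + unitTime 1 * r) (i.coord (i.retr (L.chart y)))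
            (i.height (L.chart y)))) =
          i.triv _ _ (i.extOf (fun q => f (u, q)) (rescale (1 / 2) 0 r
            (i.coord (i.retr (L.chart y))) ((i.height (L.chart y) - x.1.2 : ℝ≥0) : ℝ)))
        congr 2
        rw [hu1, NNReal.coe_sub h1.le]
        simp only [rescale, NNReal.coe_one, one_mul, sub_self, zero_div, zero_add]
        congr 3
        ring
    refine ⟨0, L, hfit, ?_⟩
    rw [h₀.comp_eq G hL] at hc
    have : ∀ q (hq : q.1 ∈ L.inner), q = p → L.comp q hq ∈ i.cHat → L.comp p hfit.mem ∈ i.cHat := by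
      rintro q hq rfl h
      exact h
    exact this _ _ hpt hc

/-- The stabilisation map exists. -/
theorem StabChoice.exists_isStab (σ : i.StabChoice) : ∃ S, σ.IsStab S := by
  obtain ⟨g, hg, hfg⟩ := σ.charge
  have hf : Continuous fun x : Unit × PBall m => σ.f x.2 := by fun_prop
  let F := stabData (i := i) σ.r_pos σ.r_le hf fun _ => σ.south
  have hch : ∀ x : i.CGdot, i.Charged (F.glue (i.toFree x, ())).1.1 := fun x =>
    charged_glue_stabData σ.r_pos σ.r_le hf _ () hg hfg _ x.2.2.1
  let S : C(i.CGdot, i.CGdot) := ⟨fun x => Free.toCGdot _ (hch x),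
    Continuous.subtype_mk (Free.continuous_val.comp (F.glue.continuous.comp (by fun_prop))) _⟩
  refine ⟨S, fun x => rfl, fun x p h h' hp => ?_, fun x y hy τ h => ?_⟩
  · exact F.glue_sec_of_le (x := i.toFree x) h h' hp
  · refine (F.glue_sec_of_ge (x := i.toFree x) (q := ()) h (i.retr_cyl_mem _ _) le_self_add).trans
      ?_
    change i.triv _ _ (i.extOf _ (rescale _ _ _ (i.coord _) ((_ - _ : ℝ≥0) : ℝ))) = _
    rw [i.coord_cyl hy, height_cyl, rescale_zero_single]
    change i.triv _ _ (σ.ext _) = _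
    congr 6
    change (((x.1.2 + τ - x.1.2 : ℝ≥0) : ℝ)) = τ
    rw [add_tsub_cancel_left]

end Inputs

end Stabilisation


/-! ### Deforming the stabilisation map -/

section Deformation

open scoped unitInterval

namespace Inputs

variable {m : ℕ} {M : Type u} [TopologicalSpace M] [ChartedSpace (EuclideanHalfSpace (m + 2)) M]
  {E : Type v} [TopologicalSpace E] {X : Type w} [TopologicalSpace X] {i : Inputs m M E X}

theorem StabChoice.IsStab.sec_of_ge {κ : StabChoice i} {S : C(i.CGdot, i.CGdot)} (hS : κ.IsStab S)
    (x : i.CGdot) {p : i.Hat} (hp) (hD : i.retr p ∈ i.D) (h : x.1.2 ≤ i.height p) :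
    (S x).1.1.sec ⟨p, hp⟩ = i.triv p hD (i.extOf κ.f (rescale (1 / 2) 0 κ.r (i.coord (i.retr p))
      ((i.height p - x.1.2 : ℝ≥0) : ℝ))) := by
  have h1 : i.cyl (i.coord (i.retr p)) (x.1.2 + (i.height p - x.1.2)) = p := by
    rw [add_tsub_cancel_of_le h, i.cyl_coord hD]
  have h2 := hS.new x (i.coord (i.retr p)) (i.coord_mem hD) (i.height p - x.1.2)
  have h3 : ∀ (v : X) p' (hD' : i.retr p' ∈ i.D), p' = p →
      (∀ h, (S x).1.1.sec ⟨p', h⟩ = i.triv p' hD' v) → (S x).1.1.sec ⟨p, hp⟩ = i.triv p hD v := by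
    rintro v _ _ rfl h
    exact h _
  rw [rescale_zero_single]
  exact h3 _ _ _ h1 h2

theorem StabChoice.IsStab.toFree_eq [T2Space M]
    [IsManifold (modelWithCornersEuclideanHalfSpace (m + 2)) ∞ M]
    {κ : StabChoice i} {S : C(i.CGdot, i.CGdot)} (hS : κ.IsStab S)
    {Q : Type*} [TopologicalSpace Q] {f : Q × PBall m → X} (hf : Continuous f)
    (hs : ∀ u q, ‖q.1‖ = 1 → q.1 (Fin.last _) ≤ 0 → f (u, q) = i.x₀) {u : Q}
    (hu : ∀ q, f (u, q) = κ.f q) (x : i.CGdot) :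
    i.toFree (S x) = (stabData κ.r_pos κ.r_le hf hs).glue (i.toFree x, u) := by
  refine GlueData.eq_glue _ (hS.forget_eq x) (fun p hp hp' h => hS.old x p hp hp' h)
    fun p hp hD h => (hS.sec_of_ge x hp hD h).trans ?_
  change _ = i.triv _ _ (i.extOf (fun q => f (u, q)) (rescale _ _ _ _ _))
  rw [show (fun q => f (u, q)) = κ.f from funext hu]
  rfl

/-- Homotopic choices lead to homotopic stabilisation maps. -/
theorem StabChoice.IsStab.homotopic [T2Space M]
    [IsManifold (modelWithCornersEuclideanHalfSpace (m + 2)) ∞ M]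
    {κ κ' : StabChoice i} {S S' : C(i.CGdot, i.CGdot)} (hS : κ.IsStab S) (hS' : κ'.IsStab S')
    (hr : κ'.r = κ.r) {f : I × PBall m → X} (hf : Continuous f)
    (hs : ∀ u q, ‖q.1‖ = 1 → f (u, q) = κ.f q) (h0 : ∀ q, f (0, q) = κ.f q)
    (h1 : ∀ q, f (1, q) = κ'.f q) (k : ℕ) : (hS.fibreMap k).Homotopic (hS'.fibreMap k) := by
  obtain ⟨g, hg, hfg⟩ := κ.charge
  have hs' : ∀ u q, ‖q.1‖ = 1 → q.1 (Fin.last _) ≤ 0 → f (u, q) = i.x₀ := fun u q hq hq' =>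
    (hs u q hq).trans (κ.south q hq hq')
  let F := stabData (i := i) κ.r_pos κ.r_le hf hs'
  -- The homotopy is constant on the unit sphere, so the charge at the new point is the same at all
  -- times.
  have hch : ∀ (x : i.CGdot) u, i.Charged (F.glue (i.toFree x, u)).1.1 := fun x u =>
    charged_glue_stabData κ.r_pos κ.r_le hf hs' u hg
      (fun y h => (hfg y h).trans (hs u ⟨y.1, h⟩ (by simp)).symm) _ x.2.2.1
  have e0 : ∀ x, i.toFree (S x) = F.glue (i.toFree x, 0) := hS.toFree_eq hf hs' h0
  have e1 : ∀ x, i.toFree (S' x) = F.glue (i.toFree x, 1) := by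
    have h2 : ∀ (r : ℝ) (hr0 : 0 < r) (hr1 : r ≤ 1 / 2), r = κ.r → ∀ x,
        (stabData (i := i) hr0 hr1 hf hs').glue x = F.glue x := by
      rintro _ _ _ rfl x
      rfl
    exact fun x => (hS'.toFree_eq hf hs' h1 x).trans (h2 _ _ _ hr _)
  refine ⟨{ toFun := fun x => ⟨Free.toCGdot _ (hch x.2.1 x.1), ?_⟩
            continuous_toFun := ?_
            map_zero_left := fun x => Subtype.ext (Subtype.ext
              (congrArg Subtype.val (e0 x.1)).symm)
            map_one_left := fun x => Subtype.ext (Subtype.ext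
              (congrArg Subtype.val (e1 x.1)).symm) }⟩
  · change Slab.base 1 • i.forget x.2.1 = _
    rw [x.2.2]
    exact (IsActBase.add (b := Slab.base) 1 k).symm
  · refine Continuous.subtype_mk (Continuous.subtype_mk (Free.continuous_val.comp
      (F.glue.continuous.comp (f := fun x : I × Fibre i.forget (i.base k) =>
        (i.toFree x.2.1, x.1)) ?_)) _) _
    have : Continuous fun x : Fibre i.forget (i.base k) => x.1 := continuous_subtype_val
    fun_prop

theorem smul_mem_pball (u : I) (q : PBall m) :
    ((1 - (u : ℝ)) + u / ‖q.1‖) • q.1 ≠ 0 ∧ ‖((1 - (u : ℝ)) + u / ‖q.1‖) • q.1‖ ≤ 1 := by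
  have hq : 0 < ‖q.1‖ := norm_pos_iff.2 q.2.1
  have h1 : 0 < (1 - (u : ℝ)) + u / ‖q.1‖ := by
    rcases u.2.1.eq_or_lt with h | h
    · rw [← h]
      norm_num
    · have := div_pos h hq
      have := u.2.2
      linarith
  refine ⟨smul_ne_zero h1.ne' q.2.1, ?_⟩
  rw [norm_smul, Real.norm_of_nonneg h1.le, add_mul, div_mul_cancel₀ _ hq.ne']
  nlinarith [q.2.2, u.2.2]

/-- Moving the points of the punctured ball radially to the boundary. -/
noncomputable def radial : C(I × PBall m, PBall m) where
  toFun x := ⟨((1 - (x.1 : ℝ)) + x.1 / ‖x.2.1‖) • x.2.1, smul_mem_pball x.1 x.2⟩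
  continuous_toFun := by
    have h1 : Continuous fun x : I × PBall m => (x.2.1 : EuclideanSpace ℝ (Fin (m + 2))) :=
      continuous_subtype_val.comp continuous_snd
    have h2 : Continuous fun x : I × PBall m => (x.1 : ℝ) :=
      continuous_subtype_val.comp continuous_fst
    exact Continuous.subtype_mk (((continuous_const.sub h2).add
      (h2.div h1.norm fun x => (norm_pos_iff.2 x.2.2.1).ne')).smul h1) _

theorem radial_of_norm_eq (u : I) {q : PBall m} (hq : ‖q.1‖ = 1) : radial (u, q) = q :=
  Subtype.ext (by simp [radial, hq])

theorem radial_zero (q : PBall m) : radial (0, q) = q := Subtype.ext (by simp [radial])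

/-- The choice that is constant along rays. -/
noncomputable def StabChoice.straight (κ : StabChoice i) : StabChoice i where
  r := κ.r
  r_pos := κ.r_pos
  r_le := κ.r_le
  f := κ.f.comp (radial.comp ⟨fun q => (1, q), by fun_prop⟩)
  south q hq hq' := by
    change κ.f (radial (1, q)) = _
    rw [radial_of_norm_eq 1 hq, κ.south q hq hq']
  charge := by
    obtain ⟨g, hg, hfg⟩ := κ.charge
    refine ⟨g, hg, fun y h => (hfg y h).trans ?_⟩
    change _ = κ.f (radial (1, _))
    rw [radial_of_norm_eq 1 (by simp)]

theorem StabChoice.straight_f_eq (κ : StabChoice i) {q q' : PBall m} {c : ℝ} (hc : 0 < c)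
    (h : q'.1 = c • q.1) : κ.straight.f q' = κ.straight.f q := by
  change κ.f (radial (1, q')) = κ.f (radial (1, q))
  congr 1
  refine Subtype.ext ?_
  have hq : 0 < ‖q.1‖ := norm_pos_iff.2 q.2.1
  simp only [radial, ContinuousMap.coe_mk, Set.Icc.coe_one, sub_self, zero_add, h, norm_smul,
    Real.norm_of_nonneg hc.le, smul_smul]
  congr 1
  field_simp

/-- The radial homotopy fixes the unit sphere, so `f` may be assumed to be constant along rays. The
combination in the plane depends on this. -/
theorem StabChoice.IsStab.homotopic_straight [T2Space M]
    [IsManifold (modelWithCornersEuclideanHalfSpace (m + 2)) ∞ M]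
    {κ : StabChoice i} {S S' : C(i.CGdot, i.CGdot)} (hS : κ.IsStab S)
    (hS' : κ.straight.IsStab S') (k : ℕ) : (hS.fibreMap k).Homotopic (hS'.fibreMap k) :=
  hS.homotopic hS' rfl (f := fun x => κ.f (radial x)) (by fun_prop)
    (fun u q hq => by rw [radial_of_norm_eq u hq]) (fun q => by rw [radial_zero]) (fun _ => rfl) k

end Inputs

end Deformation


/-! ### Combining several extensions -/

section Combination

namespace Inputs

/-- The upper half of the unit circle, starting at `(-1, 0)`. -/
noncomputable def arc : C(ℝ, PBall 0) where
  toFun t := ⟨!₂[max (-1) (min (t - 1) 1), √(1 - (max (-1) (min (t - 1) 1)) ^ 2)], by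
    have h1 : (-1 : ℝ) ≤ max (-1) (min (t - 1) 1) := le_max_left _ _
    have h2 : max (-1) (min (t - 1) 1) ≤ 1 := max_le (by norm_num) (min_le_right _ _)
    have h3 : ‖(!₂[max (-1) (min (t - 1) 1), √(1 - (max (-1) (min (t - 1) 1)) ^ 2)] :
        EuclideanSpace ℝ (Fin 2))‖ = 1 := by
      rw [EuclideanSpace.norm_eq, Fin.sum_univ_two]
      simp only [Matrix.cons_val_zero, Matrix.cons_val_one, Real.norm_eq_abs,
        sq_abs]
      rw [Real.sq_sqrt (by nlinarith), add_sub_cancel, Real.sqrt_one]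
    exact ⟨norm_ne_zero_iff.1 (by rw [h3]; exact one_ne_zero), h3.le⟩⟩
  continuous_toFun := by
    refine Continuous.subtype_mk ((PiLp.continuous_toLp 2 _).comp (continuous_pi fun j => ?_)) _
    refine Fin.cases ?_ (fun j => ?_) j
    · simp only [Matrix.cons_val_zero]
      fun_prop
    · simp only [Matrix.cons_val_succ, Matrix.cons_val_fin_one]
      fun_prop

theorem arc_val (t : ℝ) (ht : t ∈ Set.Icc (0 : ℝ) 2) :
    (arc t).1 = !₂[t - 1, √(1 - (t - 1) ^ 2)] := by
  have : max (-1) (min (t - 1) 1) = t - 1 := by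
    rw [min_eq_left (by linarith [ht.2]), max_eq_right (by linarith [ht.1])]
  simp only [arc, ContinuousMap.coe_mk, this]

theorem norm_arc (t : ℝ) (ht : t ∈ Set.Icc (0 : ℝ) 2) : ‖(arc t).1‖ = 1 := by
  rw [arc_val t ht, EuclideanSpace.norm_eq, Fin.sum_univ_two]
  simp only [Matrix.cons_val_zero, Matrix.cons_val_one, Real.norm_eq_abs, sq_abs]
  rw [Real.sq_sqrt (by nlinarith [ht.1, ht.2]), add_sub_cancel, Real.sqrt_one]

open Classical in
/-- The coordinate of the radial projection to the circle, where the lower half of the circle is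
collapsed to a point. -/
noncomputable def angle (v : EuclideanSpace ℝ (Fin 2)) : AddCircle (2 : ℝ) :=
  if 0 ≤ v 1 then ((v 0 / ‖v‖ + 1 : ℝ) : AddCircle (2 : ℝ)) else 0

theorem norm_sq_two (v : EuclideanSpace ℝ (Fin 2)) : ‖v‖ ^ 2 = v 0 ^ 2 + v 1 ^ 2 := by
  rw [EuclideanSpace.real_norm_sq_eq, Fin.sum_univ_two]

/-- On the horizontal axis the formula for the upper half gives `2` or `0`, and both vanish in the
circle of length `2`. -/
theorem angle_of_le {v : EuclideanSpace ℝ (Fin 2)} (hv : v ≠ 0) (h : v 1 ≤ 0) : angle v = 0 := by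
  rw [angle]
  split_ifs with h0
  · have h1 := norm_sq_two v
    have h2 : 0 < ‖v‖ := norm_pos_iff.2 hv
    rw [le_antisymm h h0, zero_pow two_ne_zero, add_zero, sq_eq_sq_iff_eq_or_eq_neg] at h1
    rcases h1 with h1 | h1
    · rw [← h1, div_self h2.ne', one_add_one_eq_two]
      exact AddCircle.coe_period 2
    · rw [eq_neg_iff_add_eq_zero, add_comm, ← eq_neg_iff_add_eq_zero] at h1
      rw [h1, neg_div, div_self h2.ne', neg_add_cancel]
      rfl
  · rfl

theorem angle_of_ge {v : EuclideanSpace ℝ (Fin 2)} (h : 0 ≤ v 1) :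
    angle v = ((v 0 / ‖v‖ + 1 : ℝ) : AddCircle (2 : ℝ)) := if_pos h

theorem continuousOn_angle : ContinuousOn angle {v | v ≠ 0} := by
  have h1 : Continuous fun v : EuclideanSpace ℝ (Fin 2) => v 1 := by fun_prop
  refine continuousOn_of_isClosed_cover (K := {v | 0 ≤ v 1}) (K' := {v | v 1 ≤ 0})
    (isClosed_le continuous_const h1) (isClosed_le h1 continuous_const)
    (fun v _ => le_total 0 (v 1)) ?_ ?_
  · refine ContinuousOn.congr (f := fun v : EuclideanSpace ℝ (Fin 2) =>
      ((v 0 / ‖v‖ + 1 : ℝ) : AddCircle (2 : ℝ))) ?_ fun v hv => angle_of_ge hv.2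
    refine (AddCircle.continuous_mk' 2).comp_continuousOn (ContinuousOn.add (ContinuousOn.div
      (by fun_prop) (by fun_prop) fun v hv => norm_ne_zero_iff.2 hv.1) (by fun_prop))
  · exact (continuousOn_const (c := (0 : AddCircle (2 : ℝ)))).congr fun v hv =>
      angle_of_le hv.1 hv.2

variable {m : ℕ} {M : Type u} [TopologicalSpace M] [ChartedSpace (EuclideanHalfSpace (m + 2)) M]
  {E : Type v} [TopologicalSpace E] {X : Type w} [TopologicalSpace X] {i : Inputs m M E X}

theorem StabChoice.continuousOn_ext (κ : i.StabChoice) :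
    ContinuousOn (i.extOf κ.f) {q | q ≠ 0} :=
  (continuousOn_extOf (i := i) (f := fun x : Unit × PBall m => κ.f x.2) (by fun_prop)
    fun _ => κ.south).comp (f := fun q => ((), q)) (by fun_prop) fun _ h => h

/-- The extensions around several points can be combined if the vertical cylinders over the balls
are disjoint. -/
theorem StabChoice.exists_combination_of_disjoint (κ : i.StabChoice) (ℓ : ℕ) :
    ∃ comb : (Fin ℓ → EuclideanSpace ℝ (Fin (m + 2))) → X,
      ContinuousOn comb {w | (∀ j, w j ≠ 0) ∧ ∀ j k, j ≠ k → ‖flat (w j)‖ < 1 → 1 ≤ ‖flat (w k)‖} ∧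
      (∀ w j, w j ≠ 0 → (∀ k, k ≠ j → 1 ≤ |w k 0|) → comb w = i.extOf κ.f (w j)) ∧
      ∀ w, (∀ k, 1 ≤ |w k 0|) → comb w = i.x₀ := by
  classical
  have hfar : ∀ q : EuclideanSpace ℝ (Fin (m + 2)), 1 ≤ |q 0| → ¬‖flat q‖ < 1 := fun q h =>
    not_lt.2 (h.trans (abs_le_norm_flat q))
  -- Over the stated domain at most one index satisfies the condition, so that the choice does not
  -- matter; all other fields are `x₀` there.
  refine ⟨fun w => if h : ∃ j, ‖flat (w j)‖ < 1 then i.extOf κ.f (w h.choose) else i.x₀, ?_, ?_, ?_⟩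
  · rintro w ⟨hw, hw'⟩
    have hc : ∀ j, ContinuousAt (fun w : Fin ℓ → EuclideanSpace ℝ (Fin (m + 2)) =>
        i.extOf κ.f (w j)) w := fun j =>
      (κ.continuousOn_ext.continuousAt (isOpen_ne.mem_nhds (hw j))).comp
        (f := fun w : Fin ℓ → EuclideanSpace ℝ (Fin (m + 2)) => w j)
            (continuous_apply j).continuousAt
    by_cases h : ∃ j, ‖flat (w j)‖ < 1
    · obtain ⟨j, hj⟩ := h
      have hev : ∀ᶠ w' : Fin ℓ → EuclideanSpace ℝ (Fin (m + 2)) in 𝓝 w, ‖flat (w' j)‖ < 1 :=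
        (isOpen_lt ((continuous_flat.comp (continuous_apply j)).norm)
          continuous_const).mem_nhds hj
      have e : ∀ w' : Fin ℓ → EuclideanSpace ℝ (Fin (m + 2)), ‖flat (w' j)‖ < 1 →
          (∀ j k, j ≠ k → ‖flat (w' j)‖ < 1 → 1 ≤ ‖flat (w' k)‖) →
          (if h : ∃ j, ‖flat (w' j)‖ < 1 then i.extOf κ.f (w' h.choose) else i.x₀) =
            i.extOf κ.f (w' j) := by
        intro w' h1 h2
        have h3 : ∃ j, ‖flat (w' j)‖ < 1 := ⟨j, h1⟩
        rw [dif_pos h3]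
        by_contra h4
        exact not_lt.2 (h2 j h3.choose (fun h => h4 (by rw [← h])) h1) h3.choose_spec
      refine (hc j).continuousWithinAt.congr_of_eventuallyEq ?_ (e w hj hw')
      filter_upwards [nhdsWithin_le_nhds hev, self_mem_nhdsWithin] with w' h1 h2
      exact e w' h1 h2.2
    -- Outside all open cylinders every single field has the value `x₀`, so nearby values are close
    -- to `x₀` whichever index is chosen.
    · refine Filter.Tendsto.mono_left ?_ nhdsWithin_le_nhds
      simp only [dif_neg h]
      intro N hN
      have hb : ∀ j, i.extOf κ.f (w j) = i.x₀ := fun j =>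
        Inputs.extOf_eq_base κ.south (not_lt.1 fun hj => h ⟨j, hj⟩)
      have : ∀ᶠ w' in 𝓝 w, ∀ j, i.extOf κ.f (w' j) ∈ N :=
        Filter.eventually_all.2 fun j => (hc j).eventually (show _ ∈ 𝓝 (i.extOf κ.f (w j)) by
          rw [hb j]; exact hN)
      refine Filter.mem_map.2 ?_
      filter_upwards [this] with w' hw'
      change dite _ _ _ ∈ N
      split_ifs with h'
      · exact hw' _
      · exact mem_of_mem_nhds hN
  · intro w j _ h
    change dite _ _ _ = _
    split_ifs with h'
    · by_contra h4
      exact hfar _ (h _ fun e => h4 (by rw [e])) h'.choose_spec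
    · exact (Inputs.extOf_eq_base κ.south (not_lt.1 fun hj => h' ⟨j, hj⟩)).symm
  · intro w h
    exact dif_neg fun ⟨j, hj⟩ => hfar _ (h j) hj

/-- In the plane, the extensions around several points can always be combined. -/
theorem StabChoice.exists_combination_of_plane {M : Type u} [TopologicalSpace M]
    [ChartedSpace (EuclideanHalfSpace (0 + 2)) M] {i : Inputs 0 M E X} (κ : i.StabChoice) (ℓ : ℕ) :
    ∃ comb : (Fin ℓ → EuclideanSpace ℝ (Fin 2)) → X, ContinuousOn comb {w | ∀ j, w j ≠ 0} ∧
      (∀ w j, w j ≠ 0 → (∀ k, k ≠ j → 1 ≤ |w k 0|) →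
        comb w = i.extOf κ.straight.f (w j)) ∧
      ∀ w, (∀ k, 1 ≤ |w k 0|) → comb w = i.x₀ := by
  have : Fact ((0 : ℝ) < 2) := ⟨by norm_num⟩
  have hend : ∀ t, t = 0 ∨ t = 2 → κ.straight.f (arc t) = i.x₀ := by
    intro t ht
    have ht' : t ∈ Set.Icc (0 : ℝ) 2 := by rcases ht with rfl | rfl <;> norm_num
    refine κ.straight.south _ (norm_arc t ht') ?_
    rw [arc_val t ht']
    change √(1 - (t - 1) ^ 2) ≤ 0
    rcases ht with rfl | rfl <;> norm_num
  -- Both ends of the upper half circle belong to the closed southern hemisphere, where the map is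
  -- `x₀`; so it restricts to a loop there.
  let γ := AddCircle.liftIco (2 : ℝ) 0 fun t => κ.straight.f (arc t)
  have hγ : Continuous γ := AddCircle.liftIco_zero_continuous
    ((hend 0 (Or.inl rfl)).trans (hend 2 (Or.inr rfl)).symm) (by fun_prop)
  have hγ1 : ∀ t ∈ Set.Icc (0 : ℝ) 2, γ t = κ.straight.f (arc t) := by
    intro t ht
    rcases ht.2.eq_or_lt with rfl | h
    · rw [AddCircle.coe_period, hend 2 (Or.inr rfl), ← hend 0 (Or.inl rfl)]
      exact AddCircle.liftIco_zero_coe_apply (x := 0) ⟨le_rfl, by norm_num⟩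
    · exact AddCircle.liftIco_zero_coe_apply ⟨ht.1, h⟩
  have hγ0 : γ 0 = i.x₀ := (hγ1 0 (by norm_num)).trans (hend 0 (Or.inl rfl))
  -- Since the map is constant along rays, it depends on the direction only: it is `x₀` on the lower
  -- half plane and is read off from the arc on the upper half plane.
  have hf : ∀ v (hv : v ≠ 0 ∧ ‖v‖ ≤ 1), κ.straight.f ⟨v, hv⟩ = γ (angle v) := by
    intro v hv
    have hp : 0 < ‖v‖ := norm_pos_iff.2 hv.1
    rcases le_total 0 (v 1) with h | h
    · have h1 := norm_sq_two v
      have h2 : |v 0| ≤ ‖v‖ := PiLp.norm_apply_le v 0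
      have h3 : v 0 / ‖v‖ + 1 ∈ Set.Icc (0 : ℝ) 2 := by
        have := abs_le.1 h2
        constructor
        · have : -1 ≤ v 0 / ‖v‖ := (le_div_iff₀ hp).2 (by linarith)
          linarith
        · have : v 0 / ‖v‖ ≤ 1 := (div_le_one hp).2 (by linarith)
          linarith
      rw [angle_of_ge h, hγ1 _ h3]
      refine κ.straight_f_eq hp ?_
      rw [arc_val _ h3]
      ext j
      refine Fin.cases ?_ (fun j => ?_) j
      · change v 0 = ‖v‖ * (v 0 / ‖v‖ + 1 - 1)
        field_simp
        ring
      · obtain rfl := Subsingleton.elim j 0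
        change v 1 = ‖v‖ * √(1 - (v 0 / ‖v‖ + 1 - 1) ^ 2)
        have h4 : 1 - (v 0 / ‖v‖ + 1 - 1) ^ 2 = (v 1 / ‖v‖) ^ 2 := by
          field_simp
          linarith
        rw [h4, Real.sqrt_sq (div_nonneg h hp.le)]
        field_simp
    · rw [angle_of_le hv.1 h, hγ0]
      have h1 : ‖‖v‖⁻¹ • v‖ = 1 := norm_smul_inv_norm hv.1
      rw [← κ.straight_f_eq (q := ⟨v, hv⟩)
        (q' := ⟨‖v‖⁻¹ • v, norm_ne_zero_iff.1 (by rw [h1]; exact one_ne_zero), h1.le⟩)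
        (inv_pos.2 hp) rfl]
      refine κ.straight.south _ h1 ?_
      change ‖v‖⁻¹ * v 1 ≤ 0
      exact mul_nonpos_of_nonneg_of_nonpos (inv_nonneg.2 hp.le) h
  have hfar : ∀ q : EuclideanSpace ℝ (Fin 2), 1 ≤ |q 0| → angle (pull (m := 0) q) = 0 := by
    intro q h
    have h0 : q ≠ 0 := by
      rintro rfl
      simp at h
      linarith
    refine angle_of_le (pull_ne_zero h0) ?_
    rw [pull_eq_flat (h.trans (abs_le_norm_flat _))]
    exact (flat_last (m := 0) q).le
  have hext : ∀ q : EuclideanSpace ℝ (Fin 2), q ≠ 0 →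
      i.extOf κ.straight.f q = γ (angle (pull (m := 0) q)) := by
    intro q hq
    rcases le_total ‖flat (m := 0) q‖ 1 with h | h
    · rw [extOf_of_flat_le hq h]
      exact hf _ _
    · rw [Inputs.extOf_eq_base κ.straight.south h, angle_of_le (pull_ne_zero hq), hγ0]
      rw [pull_eq_flat h]
      exact (flat_last (m := 0) q).le
  -- The angles are added in the circle before the loop is applied. This is continuous also where
  -- cylinders overlap, and points whose heights are far away contribute zero, so that a single
  -- field is recovered in its own slice.
  refine ⟨fun w => γ (∑ j, angle (pull (m := 0) (w j))), ?_, fun w j hj hk => ?_, fun w h => ?_⟩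
  · refine hγ.comp_continuousOn (continuousOn_finsetSum _ fun j _ => ?_)
    exact continuousOn_angle.comp (continuous_pull.comp (continuous_apply j)).continuousOn
      fun w hw => pull_ne_zero (hw j)
  · rw [hext _ hj]
    change γ _ = γ _
    rw [Finset.sum_eq_single j (fun k _ hkj => hfar _ (hk k hkj)) fun h =>
      (h (Finset.mem_univ j)).elim]
  · change γ _ = _
    rw [Finset.sum_eq_zero fun j _ => hfar _ (h j), hγ0]

/-- The extensions around several points can be combined if, in dimension at least three, the
vertical cylinders over the balls are disjoint. -/
theorem StabChoice.exists_combination (κ : i.StabChoice) (ℓ : ℕ) :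
    ∃ comb : (Fin ℓ → EuclideanSpace ℝ (Fin (m + 2))) → X,
      ContinuousOn comb {w | (∀ j, w j ≠ 0) ∧
        (m ≠ 0 → ∀ j k, j ≠ k → ‖flat (w j)‖ < 1 → 1 ≤ ‖flat (w k)‖)} ∧
      (∀ w j, w j ≠ 0 → (∀ k, k ≠ j → 1 ≤ |w k 0|) → comb w = i.extOf κ.straight.f (w j)) ∧
      ∀ w, (∀ k, 1 ≤ |w k 0|) → comb w = i.x₀ := by
  rcases eq_or_ne m 0 with rfl | hm
  · obtain ⟨comb, h1, h2, h3⟩ := κ.exists_combination_of_plane ℓ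
    exact ⟨comb, h1.mono fun w hw => hw.1, h2, h3⟩
  · obtain ⟨comb, h1, h2, h3⟩ := κ.straight.exists_combination_of_disjoint ℓ
    exact ⟨comb, h1.mono fun w hw => ⟨hw.1, hw.2 hm⟩, h2, h3⟩

end Inputs

end Combination


/-! ### Invariance under braids -/

section BraidInvariance

local notation "I" => unitInterval

/-- The minimum of the bounds and of `r`. Including `r` ensures that the original radius is
recovered wherever the bounds permit it, in particular at the base configurations. -/
theorem exists_radius {K A : Type*} [Finite K] [TopologicalSpace A] {g : K → A → ℝ}
    (hc : ∀ k, Continuous (g k)) {r : ℝ} (hr : 0 < r) (hg : ∀ k s, 0 < g k s) :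
    ∃ ρ : A → ℝ, Continuous ρ ∧ (∀ s, 0 < ρ s) ∧ (∀ s k, ρ s ≤ g k s) ∧
      ∀ s, (∀ k, r ≤ g k s) → ρ s = r := by
  have := Fintype.ofFinite K
  let G : Option K → A → ℝ := fun k s => k.elim r (g · s)
  refine ⟨fun s => Finset.univ.inf' ⟨none, Finset.mem_univ _⟩ fun k => G k s, ?_, fun s => ?_,
    fun s k => Finset.inf'_le (fun k => G k s) (Finset.mem_univ (some k)), fun s h => ?_⟩
  · refine Continuous.finset_inf'_apply _ fun k _ => ?_
    cases k
    · exact continuous_const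
    · exact hc _
  · refine (Finset.lt_inf'_iff _).2 fun k _ => ?_
    cases k
    · exact hr
    · exact hg _ s
  · refine le_antisymm (Finset.inf'_le (fun k => G k s) (Finset.mem_univ none))
      (Finset.le_inf' _ _ fun k _ => ?_)
    cases k
    · exact le_rfl
    · exact h _

namespace Inputs

variable {m : ℕ}

/-- If the centres differ by at least `2 * ρ` in height or in the first coordinate of the cube, the
vertical cylinders of radius `ρ` are disjoint. For `m = 0` the first coordinate is itself the
vertical one and is forgotten by `flat`, so the argument breaks down. -/
theorem le_norm_flat_of_dist {ρ : ℝ} (hρ : 0 < ρ) (hm : m ≠ 0) {h h' a a' : ℝ}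
    (hd : 2 * ρ ≤ |h - h'| ∨ 2 * ρ ≤ |a - a'|) {y : Fin (m + 1) → ℝ} {τ : ℝ}
    (h1 : ‖flat (rescale h a ρ y τ)‖ < 1) : 1 ≤ ‖flat (rescale h' a' ρ y τ)‖ := by
  have key : ∀ j : Fin (m + 2), j ≠ Fin.last _ →
      2 ≤ |rescale h a ρ y τ j - rescale h' a' ρ y τ j| → 1 ≤ ‖flat (rescale h' a' ρ y τ)‖ := by
    intro j hj h2
    have h3 := PiLp.norm_apply_le (flat (rescale h a ρ y τ)) j
    have h4 := PiLp.norm_apply_le (flat (rescale h' a' ρ y τ)) j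
    rw [flat_of_ne _ hj, Real.norm_eq_abs] at h3 h4
    have := abs_sub (rescale h a ρ y τ j) (rescale h' a' ρ y τ j)
    linarith
  rcases hd with hd | hd
  · refine key 0 (by simp [Fin.ext_iff]) ?_
    rw [rescale_apply_zero, rescale_apply_zero, ← sub_div, abs_div, abs_of_pos hρ, le_div_iff₀ hρ]
    rwa [sub_sub_sub_cancel_left, abs_sub_comm]
  · refine key (Fin.succ 0) (by simpa [Fin.ext_iff] using hm) ?_
    rw [rescale_apply_succ, rescale_apply_succ, ← sub_div, abs_div, abs_of_pos hρ, le_div_iff₀ hρ]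
    rwa [sub_sub_sub_cancel_left, abs_sub_comm, Pi.single_eq_same, Pi.single_eq_same]

variable {M : Type u} [TopologicalSpace M] [ChartedSpace (EuclideanHalfSpace (m + 2)) M]
  {E : Type v} [TopologicalSpace E] {X : Type w} [TopologicalSpace X] {i : Inputs m M E X}

namespace StabChoice.IsStab

variable {κ : StabChoice i} {S : C(i.CGdot, i.CGdot)} (hS : κ.IsStab S)

include hS

theorem forget_iterate (ℓ : ℕ) (x : i.CGdot) :
    i.forget (S^[ℓ] x) = Slab.base ℓ • i.forget x := by
  induction ℓ with
  | zero => rw [IsMulBase.zero (b := Slab.base), one_smul]; rfl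
  | succ ℓ ih =>
    rw [Function.iterate_succ_apply', hS.forget_eq, ih, ← mul_smul,
      ← IsMulBase.add (b := Slab.base)]

theorem len_iterate (ℓ : ℕ) (x : i.CGdot) : (S^[ℓ] x).1.2 = x.1.2 + ℓ :=
  congrArg Cdot.len (hS.forget_iterate ℓ x)

theorem notMem_of_notMem {x : i.CGdot} {p : i.Hat} (h : p ∉ (S x).1.1.cfg.carrier) :
    p ∉ x.1.1.cfg.carrier := fun hp => h (by
  have : (S x).1.1.cfg = (Slab.base 1 • i.forget x).cfg := congrArg Cdot.cfg (hS.forget_eq x)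
  rw [this]
  exact Or.inl hp)

theorem sec_iterate_of_le (ℓ : ℕ) (x : i.CGdot) {p : i.Hat} (h : i.height p ≤ x.1.2) (hp hp') :
    (S^[ℓ] x).1.1.sec ⟨p, hp⟩ = x.1.1.sec ⟨p, hp'⟩ := by
  induction ℓ with
  | zero => rfl
  | succ ℓ ih =>
    have e : ∀ z hz, z = S (S^[ℓ] x) → z.1.1.sec ⟨p, hz⟩ = x.1.1.sec ⟨p, hp'⟩ := by
      rintro _ hz rfl
      refine (hS.old _ p hz (hS.notMem_of_notMem hz) ?_).trans (ih _)
      rw [hS.len_iterate]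
      exact h.trans le_self_add
    exact e _ _ (Function.iterate_succ_apply' _ _ _)

/-- Each stabilisation contributes the slice between two consecutive integers, centred at `n + 1 /
2`. At an integer height two descriptions apply; as the radius is at most `1 / 2`, both give `x₀`.
-/
theorem sec_iterate_of_ge (ℓ : ℕ) (x : i.CGdot) {p : i.Hat} (hD : i.retr p ∈ i.D) {τ : ℝ≥0}
    (hτ : i.height p = x.1.2 + τ) {v : X}
    (h1 : ∀ n < ℓ, (n : ℝ≥0) ≤ τ → τ ≤ n + 1 →
      i.extOf κ.f (rescale (n + 1 / 2) 0 κ.r (i.coord (i.retr p)) τ) = v)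
    (h2 : (ℓ : ℝ≥0) ≤ τ → i.x₀ = v) (hp) : (S^[ℓ] x).1.1.sec ⟨p, hp⟩ = i.triv p hD v := by
  induction ℓ with
  | zero =>
    rw [← h2 (by simp)]
    exact x.2.2.2 p hD hp (hτ ▸ le_self_add)
  | succ ℓ ih =>
    have e : ∀ z hz, z = S (S^[ℓ] x) → z.1.1.sec ⟨p, hz⟩ = i.triv p hD v := by
      rintro _ hz rfl
      have hlen := hS.len_iterate ℓ x
      rcases le_total (i.height p) (S^[ℓ] x).1.2 with h | h
      · refine (hS.old _ p hz (hS.notMem_of_notMem hz) h).trans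
          (ih (fun n hn => h1 n (hn.trans ℓ.lt_succ_self)) (fun hℓ => ?_) _)
        rw [hlen, hτ, add_le_add_iff_left] at h
        rw [← h1 ℓ ℓ.lt_succ_self hℓ (h.trans le_self_add), le_antisymm h hℓ]
        refine (extOf_rescale_eq_base κ.south κ.r_pos ?_).symm
        have := κ.r_le
        rw [NNReal.coe_natCast, sub_add_cancel_left, abs_neg, abs_of_pos (by norm_num)]
        exact this
      · rw [hS.sec_of_ge _ hz hD h]
        have h' := h
        rw [hlen, hτ, add_le_add_iff_left] at h'
        have e2 : ((i.height p - (S^[ℓ] x).1.2 : ℝ≥0) : ℝ) = τ - ℓ := by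
          rw [NNReal.coe_sub h, hlen, hτ]
          push_cast
          ring
        rw [e2]
        congr 1
        rcases le_total τ (ℓ + 1) with h3 | h3
        · rw [← h1 ℓ ℓ.lt_succ_self h' h3]
          simp only [rescale, sub_sub]
        · rw [← h2 (by push_cast; exact h3)]
          refine extOf_rescale_eq_base κ.south κ.r_pos ?_
          have h4 : (ℓ : ℝ) + 1 ≤ τ := by exact_mod_cast h3
          have := κ.r_le
          exact this.trans ((by linarith : (1 / 2 : ℝ) ≤ τ - ℓ - 1 / 2).trans (le_abs_self _))
    exact e _ _ (Function.iterate_succ_apply' _ _ _)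

end StabChoice.IsStab

/-- A family of configurations in rectangles gives a family of maps from the complement to the
fibre that agree with the iterated stabilisation near the base configurations. -/
theorem StabChoice.exists_glueData (κ : i.StabChoice) (q : C(I, Slab)) :
    ∃ F : i.GlueData I, F.slab = q ∧ ∀ s ℓ, q s = Slab.base ℓ → ∀ (y : Fin (m + 1) → ℝ) (τ : ℝ≥0),
      (∀ z ∈ (Slab.base ℓ).cfg.carrier, ¬(y = Pi.single 0 z.1.1 ∧ τ = z.2)) →
      (∀ n < ℓ, (n : ℝ≥0) ≤ τ → τ ≤ n + 1 →
        i.extOf κ.straight.f (rescale (n + 1 / 2) 0 κ.r y τ) = F.field (s, y, τ)) ∧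
      ((ℓ : ℝ≥0) ≤ τ → i.x₀ = F.field (s, y, τ)) := by
  obtain ⟨k, c, hc⟩ := Cfg.exists_tracks ⟨fun s => (q s).cfg, by fun_prop⟩
  replace hc : ∀ s, (q s).cfg.carrier = Set.range (c s).1 := fun s => congrArg Cfg.carrier (hc s)
  have hcc : ∀ j, Continuous fun s => (c s).1 j := fun j =>
    (continuous_apply j).comp (continuous_subtype_val.comp c.continuous)
  have hmem : ∀ s j, (c s).1 j ∈ (q s).cfg.carrier := fun s j => hc s ▸ ⟨j, rfl⟩
  let a : Fin k → I → ℝ := fun j s => ((c s).1 j).1.1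
  let h : Fin k → I → ℝ := fun j s => ((c s).1 j).2
  have ha : ∀ j, Continuous (a j) := fun j =>
    continuous_subtype_val.comp (continuous_fst.comp (hcc j))
  have hh : ∀ j, Continuous (h j) := fun j =>
    NNReal.continuous_coe.comp (continuous_snd.comp (hcc j))
  have hlen : Continuous fun s => ((q s).len : ℝ) := by fun_prop
  have hpos : ∀ j s, 0 < h j s := fun j s => NNReal.coe_pos.2 ((q s).mem _ (hmem s j)).1
  have hlt : ∀ j s, h j s < (q s).len := fun j s => NNReal.coe_lt_coe.2 ((q s).mem _ (hmem s j)).2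
  -- Bounds for a common radius: the distances from both ends of the rectangle and, for different
  -- points, half of their distance in the maximum norm. Pairs of equal points get the positive
  -- value `κ.r` instead of their distance zero.
  let g : Fin k × Fin k → I → ℝ := fun jk s => min (min (h jk.1 s) ((q s).len - h jk.1 s))
    (if jk.1 = jk.2 then κ.r else max |h jk.1 s - h jk.2 s| |a jk.1 s - a jk.2 s| / 2)
  have hg : ∀ jk, Continuous (g jk) := by
    rintro ⟨j, l⟩
    have := ha j
    have := ha l
    have := hh j
    have := hh l
    refine Continuous.min (by fun_prop) ?_
    by_cases hjl : j = l
    · simp only [hjl, if_true]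
      exact continuous_const
    · simp only [hjl, if_false]
      fun_prop
  have hg0 : ∀ jk s, 0 < g jk s := by
    rintro ⟨j, l⟩ s
    refine lt_min (lt_min (hpos j s) (sub_pos.2 (hlt j s))) ?_
    dsimp only
    split_ifs with hjl
    · exact κ.r_pos
    · refine half_pos ?_
      by_contra hn
      rw [not_lt, max_le_iff, abs_nonpos_iff, abs_nonpos_iff, sub_eq_zero, sub_eq_zero] at hn
      exact hjl ((c s).2 (Prod.ext (Subtype.ext hn.2) (NNReal.coe_injective hn.1)))
  obtain ⟨ρ, hρ, hρ0, hρg, hρr⟩ := exists_radius hg κ.r_pos hg0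
  have hρh : ∀ j s, ρ s ≤ h j s := fun j s =>
    (hρg s (j, j)).trans ((min_le_left _ _).trans (min_le_left _ _))
  have hρl : ∀ j s, ρ s ≤ (q s).len - h j s := fun j s =>
    (hρg s (j, j)).trans ((min_le_left _ _).trans (min_le_right _ _))
  have hρd : ∀ j l s, j ≠ l → 2 * ρ s ≤ |h j s - h l s| ∨ 2 * ρ s ≤ |a j s - a l s| := by
    intro j l s hjl
    have h1 := (hρg s (j, l)).trans (min_le_right _ _)
    simp only [hjl, if_false] at h1
    rw [← le_max_iff]
    linarith
  have hbase : ∀ s ℓ, q s = Slab.base ℓ → (∀ j, a j s = 0) ∧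
      ∀ j, ∃ n < ℓ, h j s = n + 1 / 2 := by
    intro s ℓ hq
    have h1 : ∀ j, ∃ n < ℓ, ((⟨0, by simp⟩, (n : ℝ≥0) + 1 / 2) : Strip) = (c s).1 j := by
      intro j
      have h2 := hmem s j
      rw [hq] at h2
      exact h2
    refine ⟨fun j => ?_, fun j => ?_⟩
    · obtain ⟨n, -, hn⟩ := h1 j
      exact congrArg (fun z : Strip => z.1.1) hn.symm
    · obtain ⟨n, hnℓ, hn⟩ := h1 j
      refine ⟨n, hnℓ, ?_⟩
      have := congrArg (fun z : Strip => (z.2 : ℝ)) hn.symm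
      simpa using this
  have hdist : ∀ n n' : ℕ, n ≠ n' → (1 : ℝ) ≤ |(n : ℝ) - n'| := by
    intro n n' hn
    have : (n : ℤ) - n' ≠ 0 := sub_ne_zero.2 (by exact_mod_cast hn)
    exact_mod_cast Int.one_le_abs this
  -- At a base configuration the points have distance at least `1 / 2` from the ends and at least
  -- `1` from each other, so a radius of at most `1 / 2` meets all bounds.
  have hρbase : ∀ s ℓ, q s = Slab.base ℓ → ρ s = κ.r := by
    intro s ℓ hq
    obtain ⟨-, h1⟩ := hbase s ℓ hq
    refine hρr s fun ⟨j, l⟩ => ?_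
    obtain ⟨n, hnℓ, hn⟩ := h1 j
    obtain ⟨n', -, hn'⟩ := h1 l
    have hr := κ.r_le
    have h2 : ((q s).len : ℝ) = ℓ := by rw [hq]; simp [Slab.base]
    have h3 : (n : ℝ) + 1 ≤ ℓ := by exact_mod_cast hnℓ
    have h4 : (0 : ℝ) ≤ n := Nat.cast_nonneg n
    refine le_min (le_min ?_ ?_) ?_
    · dsimp only; linarith
    · dsimp only; linarith
    · dsimp only
      split_ifs with hjl
      · exact le_rfl
      · have h5 : n ≠ n' := by
          rintro rfl
          refine hjl ((c s).2 (Prod.ext (Subtype.ext ?_) (NNReal.coe_injective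
              (hn.trans hn'.symm))))
          exact ((hbase s ℓ hq).1 j).trans ((hbase s ℓ hq).1 l).symm
        have h6 := (hdist n n' h5).trans (le_max_left _ |a j s - a l s|)
        rw [hn, hn', add_sub_add_right_eq_sub]
        linarith
  obtain ⟨comb, hcomb, hcomb1, hcomb2⟩ := κ.exists_combination k
  have hw : ∀ j, Continuous fun x : I × (Fin (m + 1) → ℝ) × ℝ≥0 =>
      rescale (h j x.1) (a j x.1) (ρ x.1) x.2.1 (x.2.2 : ℝ) := fun j =>
    continuous_rescale (A := I × (Fin (m + 1) → ℝ) × ℝ≥0) (h := fun x => h j x.1)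
      (a := fun x => a j x.1) (ρ := fun x => ρ x.1) (y := fun x => x.2.1)
      (τ := fun x => (x.2.2 : ℝ)) ((hh j).comp continuous_fst) ((ha j).comp continuous_fst)
      (hρ.comp continuous_fst) (by fun_prop) (by fun_prop) fun x => (hρ0 _).ne'
  have hfar : ∀ (s : I) (y : Fin (m + 1) → ℝ) (τ : ℝ) j, ρ s ≤ |τ - h j s| →
      1 ≤ |rescale (h j s) (a j s) (ρ s) y τ 0| := by
    intro s y τ j hj
    rw [rescale_apply_zero, abs_div, abs_of_pos (hρ0 s)]
    exact (one_le_div (hρ0 s)).2 hj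
  refine ⟨⟨q, q.continuous, fun x => comb fun j => rescale (h j x.1) (a j x.1) (ρ x.1) x.2.1 x.2.2,
    ?_, fun s y => ?_, fun s y τ hτ => ?_⟩, rfl, fun s ℓ hq y τ hyτ =>
        ⟨fun n hn h1 h2 => ?_, fun hℓ => ?_⟩⟩
  · refine hcomb.comp (continuous_pi hw).continuousOn fun x hx => ⟨fun j => ?_, fun hm j l hjl =>
      ?_⟩
    · exact rescale_ne_zero (hρ0 _).ne' fun h0 =>
        hx.2 _ (hmem x.1 j) ⟨h0.1, NNReal.coe_injective h0.2⟩
    · exact le_norm_flat_of_dist (hρ0 _) hm (hρd j l x.1 hjl)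
  · refine hcomb2 _ fun j => hfar s y _ j ?_
    rw [NNReal.coe_zero, zero_sub, abs_neg, abs_of_pos (hpos j s)]
    exact hρh j s
  · refine hcomb2 _ fun j => hfar s y _ j ?_
    have h1 : ((q s).len : ℝ) ≤ τ := NNReal.coe_le_coe.2 hτ
    exact (hρl j s).trans ((by linarith : _ ≤ (τ : ℝ) - h j s).trans (le_abs_self _))
  · have hn' : ((⟨0, by simp⟩, (n : ℝ≥0) + 1 / 2) : Strip) ∈ (Slab.base ℓ).cfg.carrier := ⟨n, hn,
      rfl⟩
    have hcar := hc s
    rw [hq] at hcar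
    obtain ⟨j, hj⟩ : _ ∈ Set.range (c s).1 := hcar ▸ hn'
    have hhj : h j s = n + 1 / 2 := by
      have := congrArg (fun z : Strip => (z.2 : ℝ)) hj
      simpa using this
    have haj : a j s = 0 := (hbase s ℓ hq).1 j
    have hr := hρbase s ℓ hq
    have h1' : (n : ℝ) ≤ τ := by exact_mod_cast h1
    have h2' : (τ : ℝ) ≤ n + 1 := by exact_mod_cast h2
    change _ = comb fun j => rescale (h j s) (a j s) (ρ s) y τ
    rw [hcomb1 _ j]
    · simp only [hhj, haj, hr]
    · refine rescale_ne_zero (hρ0 _).ne' fun h0 => hyτ _ hn' ?_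
      rw [← hj]
      exact ⟨h0.1, NNReal.coe_injective h0.2⟩
    · intro l hl
      refine hfar s y τ l ?_
      obtain ⟨n', -, hn'⟩ := (hbase s ℓ hq).2 l
      have hne : n ≠ n' := by
        rintro rfl
        refine hl ((c s).2 (Prod.ext (Subtype.ext ?_) (NNReal.coe_injective (hn'.trans hhj.symm))))
        exact ((hbase s ℓ hq).1 l).trans haj.symm
      rw [hr, hn']
      have hκ := κ.r_le
      rcases lt_or_gt_of_ne hne with hlt' | hlt'
      · have : (n : ℝ) + 1 ≤ n' := by exact_mod_cast hlt'
        rw [abs_sub_comm]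
        exact hκ.trans ((by linarith : (1 / 2 : ℝ) ≤ _).trans (le_abs_self _))
      · have : (n' : ℝ) + 1 ≤ n := by exact_mod_cast hlt'
        exact hκ.trans ((by linarith : (1 / 2 : ℝ) ≤ _).trans (le_abs_self _))
  · refine (hcomb2 _ fun j => hfar s y _ j ?_).symm
    obtain ⟨n, hn, hn'⟩ := (hbase s ℓ hq).2 j
    have h1 : (n : ℝ) + 1 ≤ ℓ := by exact_mod_cast hn
    have h2 : (ℓ : ℝ) ≤ τ := by exact_mod_cast hℓ
    have hκ := κ.r_le
    dsimp only
    rw [hρbase s ℓ hq, hn']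
    exact hκ.trans ((by linarith : (1 / 2 : ℝ) ≤ _).trans (le_abs_self _))

/-- The iterated stabilisation extends over every path of configurations in rectangles. -/
theorem StabChoice.IsStab.exists_lift_smul [T2Space M]
    [IsManifold (modelWithCornersEuclideanHalfSpace (m + 2)) ∞ M] {κ : i.StabChoice}
    {S : C(i.CGdot, i.CGdot)} (hS : κ.straight.IsStab S) {ℓ ℓ' : ℕ}
    (q : Path (Slab.base ℓ) (Slab.base ℓ')) : ∃ g : C(i.CGdot × I, i.CGdot),
      (∀ x s, i.forget (g (x, s)) = q s • i.forget x) ∧ (∀ x, g (x, 0) = S^[ℓ] x) ∧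
      ∀ x, g (x, 1) = S^[ℓ'] x := by
  obtain ⟨F, hF, hFb⟩ := κ.exists_glueData (i := i) q.toContinuousMap
  have hend : ∀ s ℓ, q s = Slab.base ℓ → ∀ x, i.toFree (S^[ℓ] x) = F.glue (i.toFree x, s) := by
    intro s ℓ hs x
    have hs' : F.slab s = Slab.base ℓ := by rw [hF]; exact hs
    refine F.eq_glue ?_ (fun p hp hp' h => hS.sec_iterate_of_le ℓ x h hp hp') fun p hp hD h => ?_
    · rw [hs']
      exact hS.forget_iterate ℓ x
    · have hcar : (S^[ℓ] x).1.1.cfg = (Slab.base ℓ • i.forget x).cfg :=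
        congrArg Cdot.cfg (hS.forget_iterate ℓ x)
      have hb := hFb s ℓ hs (i.coord (i.retr p)) (i.height p - x.1.2) fun z hz hzp => hp (by
        change p ∈ (S^[ℓ] x).1.1.cfg.carrier
        rw [hcar]
        exact Or.inr ⟨z, hz, (strip_eq_iff hD h).2 hzp⟩)
      exact hS.sec_iterate_of_ge ℓ x hD (add_tsub_cancel_of_le h).symm hb.1 hb.2 hp
  -- At time zero the glued section is an iterated stabilisation, which is charged; the charge then
  -- persists along the path. So no charge of a combined field is ever computed.
  have hch : ∀ x : i.CGdot × I, i.Charged (F.glue (i.toFree x.1, x.2)).1.1 := by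
    rintro ⟨x, s⟩
    refine charged_of_path ⟨fun s => F.glue (i.toFree x, s), by fun_prop⟩ ?_ s
    rw [ContinuousMap.coe_mk, ← hend 0 ℓ q.source x]
    exact (S^[ℓ] x).2.2.1
  refine ⟨⟨fun x => Free.toCGdot _ (hch x), Continuous.subtype_mk (Free.continuous_val.comp
    (F.glue.continuous.comp (by fun_prop))) _⟩, fun x s => ?_, fun x => ?_, fun x => ?_⟩
  · change F.slab s • i.forget x = _
    rw [hF]
    rfl
  · exact Subtype.ext (congrArg Subtype.val (hend 0 ℓ q.source x)).symm
  · exact Subtype.ext (congrArg Subtype.val (hend 1 ℓ' q.target x)).symm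

end Inputs

end BraidInvariance


/-! ### The functor on the bracket category -/

section Transport

local notation "I" => unitInterval

/-- Any lift of a path to a homotopy ends with the transport of its start. -/
theorem IsTransport.comp_homotopic {T : Type u} {B : Type v} [TopologicalSpace T]
    [TopologicalSpace B] {p : C(T, B)} (hp : IsHurewiczFibration p) {b b' : B} {γ : Path b b'}
    {φ : C(Fibre p b, Fibre p b')} (h : IsTransport p γ φ) {A : Type u} [TopologicalSpace A]
    {f₀ : C(A, Fibre p b)} {f₁ : C(A, Fibre p b')} (g' : C(A × I, T))
    (g0' : ∀ x, g' (x, 0) = (f₀ x).1) (gp' : ∀ x s, p (g' (x, s)) = γ s)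
    (g1' : ∀ x, g' (x, 1) = (f₁ x).1) : (φ.comp f₀).Homotopic f₁ := by
  obtain ⟨g, g0, gp, g1⟩ := h
  obtain ⟨K⟩ := Path.Homotopic.symm_trans γ
  let i0 : C(A, T) := ⟨fun x => (f₀ x).1, continuous_subtype_val.comp f₀.continuous⟩
  let i1 : C(A, T) := ⟨fun x => (φ (f₀ x)).1,
    continuous_subtype_val.comp (φ.continuous.comp f₀.continuous)⟩
  let i1' : C(A, T) := ⟨fun x => (f₁ x).1, continuous_subtype_val.comp f₁.continuous⟩
  let h1 : ContinuousMap.Homotopy i0 i1 :=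
    { toFun := fun x => g (f₀ x.2, x.1), continuous_toFun := by fun_prop
      map_zero_left := fun x => g0 (f₀ x), map_one_left := fun x => g1 (f₀ x) }
  let h2 : ContinuousMap.Homotopy i0 i1' :=
    { toFun := fun x => g' (x.2, x.1), continuous_toFun := by fun_prop
      map_zero_left := fun x => g0' x, map_one_left := fun x => g1' x }
  -- Running back along one lift and forward along the other covers a null-homotopic path. Lifting
  -- the null-homotopy and reading the lift off along the other three sides of the square gives a
  -- homotopy inside the fibre.
  let G := h1.symm.trans h2
  have hG : ∀ s x, p (G (s, x)) = (γ.symm.trans γ) s := by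
    intro s x
    simp only [G, ContinuousMap.Homotopy.trans_apply, Path.trans_apply]
    split_ifs with hs
    · simp only [ContinuousMap.Homotopy.symm_apply]
      exact gp _ _
    · exact gp' _ _
  obtain ⟨L, L0, L1⟩ := hp.lift (A × I)
    ⟨fun x => K (x.2, x.1.2), by fun_prop⟩ ⟨fun x => G (x.2, x.1), by fun_prop⟩
    (fun a => by simp [hG])
  have hL : ∀ x s t, (s = 0 ∨ s = 1 ∨ t = 1) → p (L ((x, s), t)) = b' := by
    intro x s t hst
    rw [L1]
    rcases hst with rfl | rfl | rfl <;> simp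
  let ψ0 : C(A, Fibre p b') :=
    ⟨fun x => ⟨L ((x, 0), 1), hL x 0 1 (by simp)⟩, Continuous.subtype_mk (by fun_prop) _⟩
  let ψ1 : C(A, Fibre p b') :=
    ⟨fun x => ⟨L ((x, 1), 1), hL x 1 1 (by simp)⟩, Continuous.subtype_mk (by fun_prop) _⟩
  have e1 : (φ.comp f₀).Homotopic ψ0 := ⟨
    { toFun := fun q => ⟨L ((q.2, 0), q.1), hL q.2 0 q.1 (by simp)⟩
      continuous_toFun := Continuous.subtype_mk (by fun_prop) _
      map_zero_left := fun x => Subtype.ext (by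
        change L ((x, 0), 0) = _
        rw [L0]; simp [i1])
      map_one_left := fun x => rfl }⟩
  have e2 : ψ0.Homotopic ψ1 := ⟨
    { toFun := fun q => ⟨L ((q.2, q.1), 1), hL q.2 q.1 1 (by simp)⟩
      continuous_toFun := Continuous.subtype_mk (by fun_prop) _
      map_zero_left := fun x => rfl
      map_one_left := fun x => rfl }⟩
  have e3 : f₁.Homotopic ψ1 := ⟨
    { toFun := fun q => ⟨L ((q.2, 1), q.1), hL q.2 1 q.1 (by simp)⟩
      continuous_toFun := Continuous.subtype_mk (by fun_prop) _
      map_zero_left := fun x => Subtype.ext (by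
        change L ((x, 1), 0) = _
        rw [L0]; simp [i1'])
      map_one_left := fun x => rfl }⟩
  exact (e1.trans e2).trans e3.symm

end Transport

/-! ### Extension of the monodromy functor by the iterated stabilisation maps -/

section BracketFunctor

open BasedGpd
open scoped MonoidalCategory.MonoidalLeftAction

local notation "I" => unitInterval

namespace Inputs

variable {m : ℕ} {M : Type u} [TopologicalSpace M] [ChartedSpace (EuclideanHalfSpace (m + 2)) M]
  {E : Type v} [TopologicalSpace E] {X : Type w} [TopologicalSpace X] {i : Inputs m M E X}

/-- Together with `homMk_succ` this factors every morphism into canonical morphisms `ι` and a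
morphism from `Br(M)`, which is the reason for uniqueness. -/
theorem homMk_comp_toBrC_map {k l : i.Br} (d : BraidGpd) (φ : d ⊙ₗ k ⟶ l) :
    QBracket.homMk d (𝟙 (d ⊙ₗ k)) ≫ i.toBrC.map φ = QBracket.homMk d φ :=
  Quot.sound ⟨(λ_ d).hom, by
    change (αₗ (𝟙_ BraidGpd) d k).hom ≫ 𝟙_ BraidGpd ⊴ₗ 𝟙 (d ⊙ₗ k) ≫ (λₗ (d ⊙ₗ k)).hom ≫ φ =
      (λ_ d).hom ⊵ₗ k ≫ φ
    simp only [MonoidalCategory.MonoidalLeftAction.actionHomRight_id, Category.id_comp,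
      MonoidalCategory.MonoidalLeftAction.leftUnitor_actionHom, Category.assoc]⟩

theorem homMk_tensor (d e : BraidGpd) (k : i.Br) :
    QBracket.homMk (Y := e ⊙ₗ (d ⊙ₗ k)) (e ⊗ d) (αₗ e d k).hom =
      QBracket.homMk d (𝟙 (d ⊙ₗ k)) ≫ QBracket.homMk e (𝟙 (e ⊙ₗ (d ⊙ₗ k))) :=
  Quot.sound ⟨𝟙 _, by simp⟩

theorem homMk_succ (k ℓ : ℕ) :
    (QBracket.homMk (X := (⟨k⟩ : i.Br)) (⟨ℓ + 1⟩ : BraidGpd) (𝟙 (⟨k + (ℓ + 1)⟩ : i.Br))) =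
      (QBracket.homMk (X := (⟨k⟩ : i.Br)) (⟨ℓ⟩ : BraidGpd) (𝟙 (⟨k + ℓ⟩ : i.Br))) ≫ i.ι (k + ℓ) :=
  homMk_tensor (i := i) ⟨ℓ⟩ ⟨1⟩ ⟨k⟩

/-- A functor on `C(M)` is determined by its restriction to `Br(M)` and its values on the canonical
morphisms. -/
theorem brC_functor_ext {C : Type*} [Category C] {G G' : i.BrC ⥤ C}
    (h : i.toBrC ⋙ G = i.toBrC ⋙ G')
    (hι : ∀ k, G.map (i.ι k) = eqToHom (Functor.congr_obj h ⟨k⟩) ≫ G'.map (i.ι k) ≫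
      eqToHom (Functor.congr_obj h ⟨k + 1⟩).symm) : G = G' := by
  have hobj : ∀ x, G.obj x = G'.obj x := fun x => Functor.congr_obj h x.as
  let P : ∀ {x y : i.BrC}, (x ⟶ y) → Prop := fun {x y} f =>
    G.map f = eqToHom (hobj x) ≫ G'.map f ≫ eqToHom (hobj y).symm
  have hcomp : ∀ {x y z : i.BrC} (f : x ⟶ y) (g : y ⟶ z), P f → P g → P (f ≫ g) := by
    intro x y z f g hf hg
    change G.map (f ≫ g) = _
    rw [G.map_comp, hf, hg]
    simp
  have hpow : ∀ k ℓ : ℕ, P (QBracket.homMk (X := (⟨k⟩ : i.Br)) (⟨ℓ⟩ : BraidGpd)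
      (𝟙 (⟨k + ℓ⟩ : i.Br))) := by
    intro k ℓ
    induction ℓ with
    | zero =>
      have : QBracket.homMk (X := (⟨k⟩ : i.Br)) (⟨0⟩ : BraidGpd) (𝟙 (⟨k + 0⟩ : i.Br)) =
        𝟙 (⟨⟨k⟩⟩ : i.BrC) := rfl
      rw [this]
      change G.map (𝟙 _) = _ ≫ G'.map (𝟙 _) ≫ _
      simp
    | succ ℓ ih =>
      rw [homMk_succ]
      exact hcomp _ _ ih (hι _)
  refine CategoryTheory.Functor.ext hobj fun x y f => ?_
  induction f using Quot.ind with | mk f =>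
  obtain ⟨d, φ⟩ := f
  have hf := homMk_comp_toBrC_map d φ
  change P (QBracket.homMk d φ)
  rw [← hf]
  exact hcomp _ _ (hpow _ _) (Functor.congr_hom h φ)

/-- The homotopy class of a map between fibres, as a morphism between values of the monodromy
functor. -/
noncomputable def hoMap (hp : IsHurewiczFibration i.forget) {k l : i.Br}
    (f : C(Fibre i.forget (i.base k.idx), Fibre i.forget (i.base l.idx))) :
    (i.mon hp).obj k ⟶ (i.mon hp).obj l := HoTop.mk f

theorem hoMap_comp (hp : IsHurewiczFibration i.forget) {j k l : i.Br}
    (f : C(Fibre i.forget (i.base j.idx), Fibre i.forget (i.base k.idx)))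
    (g : C(Fibre i.forget (i.base k.idx), Fibre i.forget (i.base l.idx))) :
    hoMap hp (g.comp f) = hoMap hp f ≫ hoMap hp g := HoTop.mk_comp f g

theorem hoMap_id (hp : IsHurewiczFibration i.forget) (k : i.Br) :
    hoMap hp (k := k) (l := k) (ContinuousMap.id _) = 𝟙 _ := HoTop.mk_id

theorem mon_map_homMk (hp : IsHurewiczFibration i.forget) {k l : i.Br}
    (γ : Path (i.base k.idx) (i.base l.idx)) :
    (i.mon hp).map (homMk γ) = hoMap hp (exists_isTransport hp γ).choose := rfl

theorem hoMap_comp_mon_map (hp : IsHurewiczFibration i.forget) {j k l : i.Br}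
    (γ : Path (i.base k.idx) (i.base l.idx))
    {f₀ : C(Fibre i.forget (i.base j.idx), Fibre i.forget (i.base k.idx))}
    {f₁ : C(Fibre i.forget (i.base j.idx), Fibre i.forget (i.base l.idx))}
    (g : C(Fibre i.forget (i.base j.idx) × I, i.CGdot)) (g0 : ∀ x, g (x, 0) = (f₀ x).1)
    (gp : ∀ x s, i.forget (g (x, s)) = γ s) (g1 : ∀ x, g (x, 1) = (f₁ x).1) :
    hoMap hp f₀ ≫ (i.mon hp).map (homMk γ) = hoMap hp f₁ := by
  rw [mon_map_homMk, ← hoMap_comp]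
  exact (HoTop.mk_eq_iff _ _).2
    (IsTransport.comp_homotopic hp (exists_isTransport hp γ).choose_spec g g0 gp g1)

theorem hoMap_comp_mon_eqToHom (hp : IsHurewiczFibration i.forget) {j k l : i.Br} (h : k = l)
    {f₀ : C(Fibre i.forget (i.base j.idx), Fibre i.forget (i.base k.idx))}
    {f₁ : C(Fibre i.forget (i.base j.idx), Fibre i.forget (i.base l.idx))}
    (hf : ∀ x, (f₀ x).1 = (f₁ x).1) :
    hoMap hp f₀ ≫ (i.mon hp).map (eqToHom h) = hoMap hp f₁ := by
  subst h
  obtain rfl : f₀ = f₁ := ContinuousMap.ext fun x => Subtype.ext (hf x)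
  rw [eqToHom_refl, CategoryTheory.Functor.map_id, Category.comp_id]

namespace StabChoice.IsStab

variable {κ : StabChoice i} {S : C(i.CGdot, i.CGdot)} (hS : κ.IsStab S)

/-- The iterated stabilisation map on the fibres over the base points. -/
def fibrePow (k ℓ : ℕ) : C(Fibre i.forget (i.base k), Fibre i.forget (i.base (k + ℓ))) where
  toFun x := ⟨S^[ℓ] x.1, (hS.forget_iterate ℓ x.1).trans
    ((congrArg (Slab.base ℓ • ·) x.2).trans (IsActBase.add (b := Slab.base) ℓ k).symm)⟩
  continuous_toFun := Continuous.subtype_mk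
    ((S.continuous.iterate ℓ).comp continuous_subtype_val) _

/-- The iterated stabilisation maps commute with the monodromy. -/
theorem fibrePow_naturality (hp : IsHurewiczFibration i.forget) {k l : i.Br} (φ : k ⟶ l)
    (d : BraidGpd) :
    hoMap hp (k := k) (l := d ⊙ₗ k) (hS.fibrePow k.idx d.idx) ≫ (i.mon hp).map (d ⊴ₗ φ) =
      (i.mon hp).map φ ≫ hoMap hp (k := l) (l := d ⊙ₗ l) (hS.fibrePow l.idx d.idx) := by
  obtain ⟨γ, rfl⟩ := mk_surj φ
  obtain ⟨g, g0, gp, g1⟩ := (exists_isTransport hp γ).choose_spec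
  rw [mon_map_homMk, ← hoMap_comp]
  have hc : Continuous S^[d.idx] := S.continuous.iterate d.idx
  -- Applying the iterated stabilisation to a lift of `γ` gives a lift of the path that `γ` becomes
  -- when the constant rectangle is attached.
  refine hoMap_comp_mon_map hp (smulPath (Path.refl _) γ)
    ⟨fun x => S^[d.idx] (g x), by fun_prop⟩ (fun x => ?_) (fun x s => ?_) fun x => ?_
  · exact congrArg S^[d.idx] (g0 x)
  · exact (hS.forget_iterate d.idx _).trans (congrArg _ (gp x s))
  · exact congrArg S^[d.idx] (g1 x)

/-- The iterated stabilisation maps are invariant under braids. -/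
theorem fibrePow_braid [T2Space M] [IsManifold (modelWithCornersEuclideanHalfSpace (m + 2)) ∞ M]
    {S : C(i.CGdot, i.CGdot)} (hS : κ.straight.IsStab S) (hp : IsHurewiczFibration i.forget)
    (k : i.Br) {d d' : BraidGpd} (q : d ⟶ d') :
    hoMap hp (k := k) (l := d ⊙ₗ k) (hS.fibrePow k.idx d.idx) ≫ (i.mon hp).map (q ⊵ₗ k) =
      hoMap hp (k := k) (l := d' ⊙ₗ k) (hS.fibrePow k.idx d'.idx) := by
  obtain ⟨γ, rfl⟩ := mk_surj q
  obtain ⟨g, gp, g0, g1⟩ := hS.exists_lift_smul γ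
  have hc : Continuous fun x : Fibre i.forget (i.base k.idx) => x.1 := continuous_subtype_val
  -- The family over the braid `γ`, restricted to one fibre, is a lift of the path obtained by
  -- letting `γ` act on the constant base point. It starts and ends with an iterated stabilisation.
  refine hoMap_comp_mon_map hp (smulPath γ (Path.refl _))
    ⟨fun x => g (x.1.1, x.2), by fun_prop⟩ (fun x => g0 x.1) (fun x s => ?_) fun x => g1 x.1
  exact (gp x.1 s).trans (congrArg (γ s • ·) (show i.forget x.1 = i.base k.idx from x.2))

/-- The functor on `C(M)` given by the monodromy and the stabilisation maps. -/
noncomputable def bracketFunctor [T2Space M]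
    [IsManifold (modelWithCornersEuclideanHalfSpace (m + 2)) ∞ M]
    {S : C(i.CGdot, i.CGdot)} (hS : κ.straight.IsStab S) (hp : IsHurewiczFibration i.forget) :
    i.BrC ⥤ HoTop.{max u v} where
  obj x := (i.mon hp).obj x.as
  map {x y} := Quot.lift (fun f : QBracket.Pre x y =>
    hoMap hp (k := x.as) (l := f.1 ⊙ₗ x.as) (hS.fibrePow x.as.idx f.1.idx) ≫ (i.mon hp).map f.2) (by
      rintro ⟨d, φ⟩ ⟨d', φ'⟩ ⟨(q : d ⟶ d'), (h : φ = q ⊵ₗ x.as ≫ φ')⟩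
      subst h
      dsimp only
      rw [CategoryTheory.Functor.map_comp, ← hS.fibrePow_braid hp x.as q, Category.assoc])
  map_id x := hoMap_comp_mon_eqToHom hp (j := x.as) (k := x.as) (l := x.as) rfl
    (f₁ := ContinuousMap.id _) fun _ => rfl
  map_comp {x y z} f g := by
    induction f using Quot.ind with | mk f =>
    induction g using Quot.ind with | mk g =>
    obtain ⟨d, φ⟩ := f
    obtain ⟨e, ψ⟩ := g
    change hoMap hp (k := x.as) (l := (e ⊗ d) ⊙ₗ x.as)
        (hS.fibrePow x.as.idx (d.idx + e.idx)) ≫ (i.mon hp).map ((αₗ e d x.as).hom ≫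
      e ⊴ₗ φ ≫ ψ) = (hoMap hp (k := x.as) (l := d ⊙ₗ x.as)
        (hS.fibrePow x.as.idx d.idx) ≫ (i.mon hp).map φ) ≫
        hoMap hp (k := y.as) (l := e ⊙ₗ y.as) (hS.fibrePow y.as.idx e.idx) ≫ (i.mon hp).map ψ
    have h1 := hS.fibrePow_naturality hp φ e
    have h2 : hoMap hp (k := x.as) (l := (e ⊗ d) ⊙ₗ x.as)
        (hS.fibrePow x.as.idx (d.idx + e.idx)) ≫ (i.mon hp).map (αₗ e d x.as).hom =
        hoMap hp (k := x.as) (l := e ⊙ₗ d ⊙ₗ x.as)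
          ((hS.fibrePow (x.as.idx + d.idx) e.idx).comp (hS.fibrePow x.as.idx d.idx)) :=
      hoMap_comp_mon_eqToHom hp (congrArg BasedGpd.mk (Nat.add_assoc _ _ _).symm) fun a => by
        change S^[d.idx + e.idx] a.1 = S^[e.idx] (S^[d.idx] a.1)
        rw [Nat.add_comm, Function.iterate_add_apply]
    have h3 := hoMap_comp hp (j := x.as) (k := d ⊙ₗ x.as) (l := e ⊙ₗ d ⊙ₗ x.as)
      (hS.fibrePow x.as.idx d.idx) (hS.fibrePow (x.as.idx + d.idx) e.idx)
    have h1' : hoMap hp (k := d ⊙ₗ x.as) (l := e ⊙ₗ d ⊙ₗ x.as)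
        (hS.fibrePow (x.as.idx + d.idx) e.idx) ≫ (i.mon hp).map (e ⊴ₗ φ) =
      (i.mon hp).map φ ≫ hoMap hp (k := y.as) (l := e ⊙ₗ y.as) (hS.fibrePow y.as.idx e.idx) := h1
    rw [CategoryTheory.Functor.map_comp, CategoryTheory.Functor.map_comp, reassoc_of% h2, h3,
      Category.assoc, Category.assoc, reassoc_of% h1']

end StabChoice.IsStab

/-- There is a unique functor on `C(M)` that extends the monodromy functor and takes the canonical
morphisms to the stabilisation maps. -/
theorem StabChoice.IsStab.existsUnique_functor [T2Space M]
    [IsManifold (modelWithCornersEuclideanHalfSpace (m + 2)) ∞ M] {κ : i.StabChoice}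
    {S : C(i.CGdot, i.CGdot)} (hS : κ.IsStab S) (hp : IsHurewiczFibration i.forget) :
    ∃! F : i.BrC ⥤ HoTop.{max u v}, ∃ h : i.toBrC ⋙ F = i.mon hp, ∀ k : ℕ,
      F.map (i.ι k) = eqToHom (Functor.congr_obj h ⟨k⟩) ≫ HoTop.mk (hS.fibreMap k) ≫
        eqToHom (Functor.congr_obj h ⟨k + 1⟩).symm := by
  -- Braid invariance is available for the choice that is constant along rays. The functor is built
  -- from it, and the given stabilisation map enters through its homotopy to the straightened one
  -- only.
  obtain ⟨S', hS'⟩ := κ.straight.exists_isStab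
  have hF : i.toBrC ⋙ hS'.bracketFunctor hp = i.mon hp := by
    refine CategoryTheory.Functor.ext (fun _ => rfl) fun k l φ => ?_
    have h1 : hoMap hp (k := k) (l := k) (hS'.fibrePow k.idx 0) = 𝟙 _ := hoMap_id hp k
    have h2 : (i.toBrC ⋙ hS'.bracketFunctor hp).map φ =
        hoMap hp (k := k) (l := k) (hS'.fibrePow k.idx 0) ≫ (i.mon hp).map (𝟙 _ ≫ φ) := rfl
    rw [h2, h1, Category.id_comp]
    refine (congrArg (i.mon hp).map (Category.id_comp φ)).trans ?_
    exact ((Category.id_comp _).trans (Category.comp_id _)).symm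
  have hFι : ∀ k, (hS'.bracketFunctor hp).map (i.ι k) =
      hoMap hp (k := ⟨k⟩) (l := ⟨k + 1⟩) (hS.fibreMap k) := by
    intro k
    have h1 : hoMap hp (k := ⟨k⟩) (l := ⟨k + 1⟩) (hS.fibreMap k) =
        hoMap hp (k := ⟨k⟩) (l := ⟨k + 1⟩) (hS'.fibrePow k 1) :=
      (HoTop.mk_eq_iff _ _).2 (hS.homotopic_straight hS' k)
    have h2 : (hS'.bracketFunctor hp).map (i.ι k) =
      hoMap hp (k := ⟨k⟩) (l := ⟨k + 1⟩) (hS'.fibrePow k 1) ≫ (i.mon hp).map (𝟙 _) := rfl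
    rw [h2, h1, CategoryTheory.Functor.map_id, Category.comp_id]
  refine ⟨hS'.bracketFunctor hp, ⟨hF, fun k => ?_⟩, ?_⟩
  · rw [hFι]
    exact ((Category.id_comp _).trans (Category.comp_id _)).symm
  · rintro G ⟨hG, hGι⟩
    refine brC_functor_ext (hG.trans hF.symm) fun k => ?_
    rw [hGι, hFι]
    rfl

end Inputs

end BracketFunctor

end ConfSec

theorem proposition6p3 (m : ℕ) {M : Type u} [TopologicalSpace M] [T2Space M]
    [SecondCountableTopology M] [ConnectedSpace M] [ChartedSpace (EuclideanHalfSpace (m + 2)) M]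
    [IsManifold (modelWithCornersEuclideanHalfSpace (m + 2)) ∞ M]
    {E : Type v} [TopologicalSpace E] {X : Type w} [TopologicalSpace X]
    (i : ConfSec.Inputs m M E X) (σ : i.StabChoice) :
    ∃ (hp : ConfSec.IsHurewiczFibration i.forget) (S : C(i.CGdot, i.CGdot)) (hS : σ.IsStab S),
      ∃! F : i.BrC ⥤ ConfSec.HoTop.{max u v},
        ∃ h : i.toBrC ⋙ F = i.mon hp, ∀ k : ℕ,
          F.map (i.ι k) = eqToHom (Functor.congr_obj h ⟨k⟩) ≫ ConfSec.HoTop.mk (hS.fibreMap k) ≫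
            eqToHom (Functor.congr_obj h ⟨k + 1⟩).symm := by
  obtain ⟨S, hS⟩ := σ.exists_isStab
  exact ⟨i.isHurewiczFibration_forget, S, hS, hS.existsUnique_functor _⟩
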